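/- Let $M$ be a smooth Riemannian three-manifold with Levi-Civita connection $\nabla$, let $\xi$ be a Killing field on $M$ with $\|\xi\|=1$ everywhere, and let $p\in M$. By a totally geodesic surface through $p$ we mean a smooth embedded surface $\Sigma\subset M$ containing $p$ whose shape operator vanishes identically; it is tangent (orthogonal) to $\xi$ at $p$ if $\xi(p)\in T_p\Sigma$ (if $\xi(p)\perp T_p\Sigma$). For a choice of orientation near $p$, with cross product $\times$, let $\tau$ be the function determined by $\nabla_X\xi=\tau\,(X\times\xi)$ for all tangent vectors $X$; its value $\tau(p)$ exists and is unique, and whether it vanishes does not depend on the orientation. Suppose that there is a totally geodesic surface $\Sigma_1$ through $p$ which is neither orthogonal nor tangent to $\xi$ at $p$. Then: (1) There is a second totally geodesic surface $\Sigma_0$ through $p$ which is orthogonal to $\Sigma_1$ (at every point of $\Sigma_0\cap\Sigma_1$) and which is neither orthogonal nor tangent to $\xi$ at $p$. (2) If there is a third totally geodesic surface $\Sigma_2$ through $p$ (that is, $\Sigma_2$ coincides neither with $\Sigma_0$ nor with $\Sigma_1$ in any neighbourhood of $p$) which is not tangent to $\xi$ at $p$, then there is a constant $c\ge 0$ such that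 all sectional curvatures of $M$ in a neighbourhood of $p$ equal $c$. Consequently a neighbourhood of $p$ is isometric to an open subset of the round three-sphere of radius $1/\sqrt c$ if $c>0$, and to an open subset of Euclidean space $\mathbb{R}^3$ if $c=0$. (3) If $M$ does not have constant positive sectional curvature in a neighbourhood of $p$ (that is, if there are no $c>0$ and no neighbourhood of $p$ in which all sectional curvatures equal $c$), then there exists a totally geodesic surface through $p$ which is tangent to $\xi$ at $p$ if and only if $\tau(p)=0$. -/

import Mathlib

open scoped Manifold ContDiff Topology RealInnerProductSpace Matrix
open Bundle Filter

/-- Three-dimensional Euclidean space, the model space of the manifolds below. -/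
abbrev E3 : Type := EuclideanSpace ℝ (Fin 3)

/-- Four-dimensional Euclidean space. -/
abbrev E4 : Type := EuclideanSpace ℝ (Fin 4)

/-- The unit three-sphere in `E4`, with Mathlib's smooth structure. -/
abbrev S3 : Type := Metric.sphere (0 : E4) 1

noncomputable section

section Defs

variable {M : Type*} [TopologicalSpace M] [ChartedSpace E3 M] [IsManifold (𝓡 3) ∞ M]

/-- The vector field `X` is smooth at `q`. -/
def SmoothFieldAt (X : ∀ x : M, TangentSpace (𝓡 3) x) (q : M) : Prop :=
  ContMDiffAt (𝓡 3) (𝓡 3).tangent ∞ (fun x => (⟨x, X x⟩ : TangentBundle (𝓡 3) M)) q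

/-- A vector field which is smooth near `q` and takes the value `v` at `q` (constant in a local
trivialization of the tangent bundle). -/
def extendVec {q : M} (v : TangentSpace (𝓡 3) q) : ∀ x : M, TangentSpace (𝓡 3) x :=
  FiberBundle.extend E3 v

/-- The tangent plane at `q` of an embedded surface `S`: the common kernel of the differentials
at `q` of all functions which are smooth at `q` and vanish on `S` near `q`. -/
def tangentPlane (S : Set M) (q : M) : Submodule ℝ (TangentSpace (𝓡 3) q) where
  carrier := {v | ∀ f : M → ℝ, ContMDiffAt (𝓡 3) 𝓘(ℝ, ℝ) ∞ f q →
    (∀ᶠ x in 𝓝 q, x ∈ S → f x = 0) → mvfderiv (𝓡 3) f q v = 0}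
  add_mem' := fun {v w} hv hw f hf h0 => by
    rw [map_add, hv f hf h0, hw f hf h0, add_zero]
  zero_mem' := fun f _ _ => map_zero _
  smul_mem' := fun c v hv f hf h0 => by
    rw [map_smul, hv f hf h0, smul_zero]

/-- `S` is a smooth embedded surface: around each of its points there is a chart of the maximal
atlas in which `S` is the coordinate plane where the last coordinate vanishes. -/
def IsEmbeddedSurface (S : Set M) : Prop :=
  ∀ q ∈ S, ∃ φ ∈ IsManifold.maximalAtlas (𝓡 3) ∞ M, q ∈ φ.source ∧
    ∀ x ∈ φ.source, x ∈ S ↔ φ x 2 = 0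

variable [RiemannianBundle (fun x : M => TangentSpace (𝓡 3) x)]

/-- The function `⟨X, Y⟩`. -/
def innerFun (X Y : ∀ x : M, TangentSpace (𝓡 3) x) (x : M) : ℝ := inner ℝ (X x) (Y x)

/-- The derivative at `q` of the function `⟨Y, Z⟩` in the direction of the vector field `X`. -/
def derivInner (X Y Z : ∀ x : M, TangentSpace (𝓡 3) x) (q : M) : ℝ :=
  mvfderiv (𝓡 3) (innerFun Y Z) q (X q)

/-- The Lie bracket of vector fields. -/
def bracket (X Y : ∀ x : M, TangentSpace (𝓡 3) x) : ∀ x : M, TangentSpace (𝓡 3) x :=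
  VectorField.mlieBracket (𝓡 3) X Y

/-- The right-hand side of Koszul's formula for `⟨∇_X Y, Z⟩` at `q`. -/
def koszul (X Y Z : ∀ x : M, TangentSpace (𝓡 3) x) (q : M) : ℝ :=
  (1 / 2) * (derivInner X Y Z q + derivInner Y X Z q - derivInner Z X Y q
    + innerFun (bracket X Y) Z q - innerFun (bracket X Z) Y q - innerFun (bracket Y Z) X q)

/-- The Levi-Civita derivative `∇_v Y` at `q` of the vector field `Y` in the direction
`v ∈ T_qM`, given by Koszul's formula. -/
def leviCivita (Y : ∀ x : M, TangentSpace (𝓡 3) x) (q : M) (v : TangentSpace (𝓡 3) q) :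
    TangentSpace (𝓡 3) q :=
  letI : FiniteDimensional ℝ (TangentSpace (𝓡 3) q) := inferInstanceAs (FiniteDimensional ℝ E3)
  letI e := stdOrthonormalBasis ℝ (TangentSpace (𝓡 3) q)
  ∑ i, koszul (extendVec v) Y (extendVec (e i)) q • e i

/-- The vector field `∇_X Y`. -/
def nabla (X Y : ∀ x : M, TangentSpace (𝓡 3) x) : ∀ x : M, TangentSpace (𝓡 3) x :=
  fun x => leviCivita Y x (X x)

/-- The curvature `R(X, Y) Z = ∇_X ∇_Y Z - ∇_Y ∇_X Z - ∇_[X, Y] Z`. -/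
def curvature (X Y Z : ∀ x : M, TangentSpace (𝓡 3) x) : ∀ x : M, TangentSpace (𝓡 3) x :=
  fun x => nabla X (nabla Y Z) x - nabla Y (nabla X Z) x - nabla (bracket X Y) Z x

/-- The sectional curvature of the plane spanned by two independent tangent vectors `v`, `w`. -/
def sectionalCurvature {q : M} (v w : TangentSpace (𝓡 3) q) : ℝ :=
  inner ℝ (curvature (extendVec v) (extendVec w) (extendVec w) q) v /
    (inner ℝ v v * inner ℝ w w - (inner ℝ v w) ^ 2)

/-- All sectional curvatures at all points near `p` are equal to `c`. -/
def HasConstantCurvatureNear (p : M) (c : ℝ) : Prop :=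
  ∀ᶠ q in 𝓝 p, ∀ v w : TangentSpace (𝓡 3) q,
    LinearIndependent ℝ ![v, w] → sectionalCurvature v w = c

/-- `ξ` is a Killing field: a smooth vector field such that `𝓛_ξ g = 0`, that is,
`ξ⟨X, Y⟩ = ⟨[ξ, X], Y⟩ + ⟨X, [ξ, Y]⟩`. -/
def IsKillingField (ξ : ∀ x : M, TangentSpace (𝓡 3) x) : Prop :=
  (∀ q, SmoothFieldAt ξ q) ∧
  ∀ (q : M) (X Y : ∀ x : M, TangentSpace (𝓡 3) x), SmoothFieldAt X q → SmoothFieldAt Y q →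
    derivInner ξ X Y q - innerFun (bracket ξ X) Y q - innerFun X (bracket ξ Y) q = 0

/-- `S` is a totally geodesic surface: the shape operator `v ↦ -∇_v N` vanishes for every smooth
local unit normal field `N`. -/
def IsTotallyGeodesicSurface (S : Set M) : Prop :=
  IsEmbeddedSurface S ∧
  ∀ q ∈ S, ∀ N : ∀ x : M, TangentSpace (𝓡 3) x, SmoothFieldAt N q →
    (∀ᶠ x in 𝓝 q, x ∈ S → ‖N x‖ = 1 ∧ N x ∈ (tangentPlane S x)ᗮ) →
    ∀ v ∈ tangentPlane S q, -leviCivita N q v = 0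

/-- The cross product on `T_qM` for the orientation in which the orthonormal basis `e` is
positive. -/
def crossProd {q : M} (e : OrthonormalBasis (Fin 3) ℝ (TangentSpace (𝓡 3) q))
    (v w : TangentSpace (𝓡 3) q) : TangentSpace (𝓡 3) q :=
  e.repr.symm (WithLp.toLp 2 ((e.repr v).ofLp ⨯₃ (e.repr w).ofLp))

/-- `t` is the value at `q`, with respect to the orientation of `e`, of the function `τ`
determined by `∇_X ξ = τ (X × ξ)`. -/
def IsTau (ξ : ∀ x : M, TangentSpace (𝓡 3) x) {q : M}
    (e : OrthonormalBasis (Fin 3) ℝ (TangentSpace (𝓡 3) q)) (t : ℝ) : Prop :=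
  ∀ v : TangentSpace (𝓡 3) q, leviCivita ξ q v = t • crossProd e v (ξ q)

/-- A neighbourhood of `p` is isometric to an open subset of the three-sphere with the metric
`r ^ 2 • g`, where `g` is the standard metric of the unit sphere `S3`, that is, to an open subset
of the round sphere of radius `r`. -/
def IsLocallyIsometricToSphere (p : M) (r : ℝ) : Prop :=
  ∃ Φ : OpenPartialHomeomorph M S3, p ∈ Φ.source ∧
    ContMDiffOn (𝓡 3) (𝓡 3) ∞ Φ Φ.source ∧ ContMDiffOn (𝓡 3) (𝓡 3) ∞ Φ.symm Φ.target ∧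
    ∀ q ∈ Φ.source, ∀ v w : TangentSpace (𝓡 3) q,
      inner ℝ v w = r ^ 2 * inner ℝ
        (mvfderiv (𝓡 3) (fun y : S3 => (y : E4)) (Φ q) (mfderiv (𝓡 3) (𝓡 3) Φ q v))
        (mvfderiv (𝓡 3) (fun y : S3 => (y : E4)) (Φ q) (mfderiv (𝓡 3) (𝓡 3) Φ q w))

/-- A neighbourhood of `p` is isometric to an open subset of Euclidean three-space. -/
def IsLocallyIsometricToEuclidean (p : M) : Prop :=
  ∃ Φ : OpenPartialHomeomorph M E3, p ∈ Φ.source ∧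
    ContMDiffOn (𝓡 3) 𝓘(ℝ, E3) ∞ Φ Φ.source ∧ ContMDiffOn 𝓘(ℝ, E3) (𝓡 3) ∞ Φ.symm Φ.target ∧
    ∀ q ∈ Φ.source, ∀ v w : TangentSpace (𝓡 3) q,
      inner ℝ v w = inner ℝ (mvfderiv (𝓡 3) Φ q v) (mvfderiv (𝓡 3) Φ q w)

end Defs

end

set_option linter.unusedSectionVars false

noncomputable section


/-! Everything is read off from one normal form. Near `p` there are coordinates in which the metric
is `dx₀² + r(x₀) dx₁² + (1 - r(x₀)) dx₂²` with `0 < r < 1`, the Killing field is `ξ = ∂₁ + ∂₂`, and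
`S₁` is the plane `x₂ = 0` (`exists_adaptedChart`).

To find them, straighten `ξ` along its flow so that `S₁` becomes a coordinate plane; the metric is
then invariant along `ξ`. Split `ξ = T + C` into its parts tangent and normal to the slices. The
second fundamental form of `S₁` vanishes, so `T` is a Killing field of the slice metric. Let `E` be
the unit field in the slices orthogonal to `T`. The flow of `T` preserves the slice metric and `T`,
hence `E`, so `[T, E] = 0`; invariance along `ξ` makes `E`, `T`, `C` commute. They are coordinate
fields, orthogonal, with `|E|² = 1`, `|T|² = r` and `|C|² = 1 - r` because `|ξ| = 1`. The function
`r` is constant along `T` and `C`. That `ξ` is neither orthogonal nor tangent to `S₁` says `T ≠ 0`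
and `C ≠ 0`.

(1) The Christoffel symbols show that `x₁ = 0` is totally geodesic; it is `S₀`.

(2) The unit normal `N` of a totally geodesic surface is parallel along it, so `R(X, Y)N = 0` for
tangent `X`, `Y` (`curvVec_normal`). The curvature is diagonal in the coordinate frame. Where
`bending r ≠ 0` the three curvatures of the coordinate planes are distinct, which forces `N` to be a
multiple of a coordinate field (`mul_eq_zero_of_bending_ne`). If `bending r` is not identically zero
near `0`, a surface transverse to `ξ` therefore has normal along `∂₁` or `∂₂` at `p`. A totally
geodesic surface is determined by its tangent plane at one point (`normal_eq_zero_on_ball`), so it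
is `S₀` or `S₁`. A third surface thus gives `bending r = 0`; then all sectional curvatures equal
`r'² / (4r(1 - r)) ≥ 0`, which is constant, and explicit maps to the sphere or to Euclidean space
exist.

(3) In the normal form, `τ(p) = 0` if and only if `r'(0) = 0`. If `r'(0) = 0`, the plane `x₀ = 0` is
totally geodesic and tangent to `ξ`. Conversely let a totally geodesic surface be tangent to `ξ` at
`p` and let `r'(0) ≠ 0`. Either its normal is not along `∂₀`, which is treated as in (2), or it
touches the level `x₀ = 0`, whose principal curvatures have opposite signs. In the second case the
surface enters both sides of this level, with normals that are not coordinate directions, so again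
`bending r = 0` (`IsNormalPatch.eventually_bending_eq_zero`). The curvature is then a positive
constant, which is the case excluded in (3). -/

instance : NormedAddCommGroup (E3 →L[ℝ] E3 →L[ℝ] ℝ) := inferInstance

instance : SeminormedAddCommGroup (E3 →L[ℝ] E3 →L[ℝ] ℝ) := inferInstance

instance : NormedSpace ℝ (E3 →L[ℝ] E3 →L[ℝ] ℝ) := inferInstance

instance : NormedAddCommGroup (E3 →L[ℝ] ℝ) := inferInstance

instance : SeminormedAddCommGroup (E3 →L[ℝ] ℝ) := inferInstance

instance : NormedSpace ℝ (E3 →L[ℝ] ℝ) := inferInstance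

/-! ### Vector fields, the metric and Koszul's formula in a chart -/

section ChartCalculus

variable {M : Type*} [TopologicalSpace M] [ChartedSpace E3 M] [IsManifold (𝓡 3) ∞ M]
variable {Ψ : OpenPartialHomeomorph M E3} {q : M}

/-- The vector field on the domain of the chart `Ψ` with coordinate expression `a`. -/
def fld (Ψ : OpenPartialHomeomorph M E3) (a : E3 → E3) : ∀ x : M, TangentSpace (𝓡 3) x :=
  VectorField.mpullback (𝓡 3) 𝓘(ℝ, E3) Ψ a

/-- The coordinate expression in the chart `Ψ` of the vector field `X`. -/
def coordRep (Ψ : OpenPartialHomeomorph M E3) (X : ∀ x : M, TangentSpace (𝓡 3) x) (y : E3) : E3 :=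
  mvfderiv (𝓡 3) Ψ (Ψ.symm y) (X (Ψ.symm y))

lemma chart_mdifferentiable (hΨ : Ψ ∈ IsManifold.maximalAtlas (𝓡 3) ∞ M) :
    Ψ.MDifferentiable (𝓡 3) 𝓘(ℝ, E3) :=
  ⟨fun _ hx => ((contMDiffAt_of_mem_maximalAtlas hΨ hx).mdifferentiableAt
      (by simp)).mdifferentiableWithinAt,
    fun _ hx => ((contMDiffAt_symm_of_mem_maximalAtlas hΨ hx).mdifferentiableAt
      (by simp)).mdifferentiableWithinAt⟩

lemma chart_isInvertible (hΨ : Ψ ∈ IsManifold.maximalAtlas (𝓡 3) ∞ M) (hq : q ∈ Ψ.source) :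
    (mfderiv (𝓡 3) 𝓘(ℝ, E3) Ψ q).IsInvertible :=
  ⟨(chart_mdifferentiable hΨ).mfderiv hq, rfl⟩

lemma chart_symm_isInvertible (hΨ : Ψ ∈ IsManifold.maximalAtlas (𝓡 3) ∞ M) {y : E3}
    (hy : y ∈ Ψ.target) :
    (mfderiv 𝓘(ℝ, E3) (𝓡 3) Ψ.symm y).IsInvertible :=
  ⟨(chart_mdifferentiable hΨ).symm.mfderiv (by simpa using hy), rfl⟩

lemma mvfderiv_fld (hΨ : Ψ ∈ IsManifold.maximalAtlas (𝓡 3) ∞ M) (hq : q ∈ Ψ.source)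
    (a : E3 → E3) : mvfderiv (𝓡 3) Ψ q (fld Ψ a q) = a (Ψ q) :=
  (chart_isInvertible hΨ hq).self_apply_inverse _

lemma mvfderiv_chart_injective (hΨ : Ψ ∈ IsManifold.maximalAtlas (𝓡 3) ∞ M)
    (hq : q ∈ Ψ.source) : Function.Injective (mvfderiv (𝓡 3) Ψ q) :=
  (chart_isInvertible hΨ hq).injective

lemma fld_eq_iff (hΨ : Ψ ∈ IsManifold.maximalAtlas (𝓡 3) ∞ M) (hq : q ∈ Ψ.source)
    (a : E3 → E3) (v : TangentSpace (𝓡 3) q) :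
    fld Ψ a q = v ↔ mvfderiv (𝓡 3) Ψ q v = a (Ψ q) := by
  constructor
  · rintro rfl
    exact mvfderiv_fld hΨ hq a
  · intro h
    apply mvfderiv_chart_injective hΨ hq
    rw [h, mvfderiv_fld hΨ hq]

lemma fld_coordRep (hΨ : Ψ ∈ IsManifold.maximalAtlas (𝓡 3) ∞ M) (hq : q ∈ Ψ.source)
    (X : ∀ x : M, TangentSpace (𝓡 3) x) : fld Ψ (coordRep Ψ X) q = X q := by
  rw [fld_eq_iff hΨ hq, coordRep, Ψ.left_inv hq]

lemma fld_coordRep_eventuallyEq (hΨ : Ψ ∈ IsManifold.maximalAtlas (𝓡 3) ∞ M)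
    (hq : q ∈ Ψ.source) (X : ∀ x : M, TangentSpace (𝓡 3) x) :
    ∀ᶠ x in 𝓝 q, X x = fld Ψ (coordRep Ψ X) x := by
  filter_upwards [Ψ.open_source.mem_nhds hq] with x hx using (fld_coordRep hΨ hx X).symm

lemma smoothFieldAt_fld (hΨ : Ψ ∈ IsManifold.maximalAtlas (𝓡 3) ∞ M) (hq : q ∈ Ψ.source)
    {a : E3 → E3} (ha : ContDiffAt ℝ ∞ a (Ψ q)) : SmoothFieldAt (fld Ψ a) q := by
  have : IsManifold (𝓡 3) 1 M := IsManifold.of_le (n := ∞) (by simp)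
  exact ContMDiffAt.mpullback_vectorField_preimage (n := ∞)
    (contMDiffAt_vectorSpace_iff_contDiffAt.2 ha)
    (contMDiffAt_of_mem_maximalAtlas hΨ hq) (chart_isInvertible hΨ hq) (by simp)

lemma coordRep_eq_mpullback (hΨ : Ψ ∈ IsManifold.maximalAtlas (𝓡 3) ∞ M)
    (X : ∀ x : M, TangentSpace (𝓡 3) x) {y : E3} (hy : y ∈ Ψ.target) :
    coordRep Ψ X y = VectorField.mpullback 𝓘(ℝ, E3) (𝓡 3) Ψ.symm X y := by
  have h := (chart_mdifferentiable hΨ).comp_symm_deriv hy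
  have h' := (chart_mdifferentiable hΨ).symm_comp_deriv (Ψ.map_target hy)
  rw [Ψ.right_inv hy] at h'
  have hi := chart_symm_isInvertible hΨ hy
  apply hi.injective
  rw [VectorField.mpullback_apply, hi.self_apply_inverse]
  exact DFunLike.congr_fun h' (X (Ψ.symm y))

lemma contDiffAt_coordRep (hΨ : Ψ ∈ IsManifold.maximalAtlas (𝓡 3) ∞ M) (hq : q ∈ Ψ.source)
    {X : ∀ x : M, TangentSpace (𝓡 3) x} (hX : SmoothFieldAt X q) :
    ContDiffAt ℝ ∞ (coordRep Ψ X) (Ψ q) := by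
  have : IsManifold (𝓡 3) 1 M := IsManifold.of_le (n := ∞) (by simp)
  have hy := Ψ.map_source hq
  have h : ContDiffAt ℝ ∞ (VectorField.mpullback 𝓘(ℝ, E3) (𝓡 3) Ψ.symm X) (Ψ q) := by
    apply contMDiffAt_vectorSpace_iff_contDiffAt.1
    refine ContMDiffAt.mpullback_vectorField_preimage (n := ∞) ?_
      (contMDiffAt_symm_of_mem_maximalAtlas hΨ hy) (chart_symm_isInvertible hΨ hy) (by simp)
    rw [Ψ.left_inv hq]
    exact hX
  refine h.congr_of_eventuallyEq ?_
  filter_upwards [Ψ.open_target.mem_nhds hy] with y hy using coordRep_eq_mpullback hΨ X hy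

lemma bracket_fld (hΨ : Ψ ∈ IsManifold.maximalAtlas (𝓡 3) ∞ M) (hq : q ∈ Ψ.source)
    {a b : E3 → E3} (ha : ContDiffAt ℝ 1 a (Ψ q)) (hb : ContDiffAt ℝ 1 b (Ψ q)) :
    bracket (fld Ψ a) (fld Ψ b) q = fld Ψ (VectorField.lieBracket ℝ a b) q := by
  have h2 : IsManifold (𝓡 3) (minSmoothness ℝ 3) M :=
    IsManifold.of_le (n := ∞)
      (by rw [minSmoothness_of_isRCLikeNormedField]; exact WithTop.coe_le_coe.2 (le_top : (3 : ℕ∞) ≤ ⊤))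
  have h := VectorField.mpullback_mlieBracket (I := 𝓡 3) (I' := 𝓘(ℝ, E3)) (f := Ψ) (x₀ := q)
    (n := ∞) (V := a) (W := b) (𝕜 := ℝ)
    ((contMDiffAt_vectorSpace_iff_contDiffAt.2 ha).mdifferentiableAt one_ne_zero)
    ((contMDiffAt_vectorSpace_iff_contDiffAt.2 hb).mdifferentiableAt one_ne_zero)
    (contMDiffAt_of_mem_maximalAtlas hΨ hq)
    (by rw [minSmoothness_of_isRCLikeNormedField]; exact WithTop.coe_le_coe.2 (le_top : (2 : ℕ∞) ≤ ⊤))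
  have h' : VectorField.mlieBracket 𝓘(ℝ, E3) a b = VectorField.lieBracket ℝ a b := by
    have h3 := VectorField.mlieBracketWithin_eq_lieBracketWithin (𝕜 := ℝ) (V := a) (W := b)
      (s := Set.univ)
    exact VectorField.mlieBracketWithin_univ.symm.trans
      (h3.trans VectorField.lieBracketWithin_univ)
  rw [h'] at h
  exact h.symm

lemma mvfderiv_comp_chart {F : Type*} [NormedAddCommGroup F] [NormedSpace ℝ F]
    (hΨ : Ψ ∈ IsManifold.maximalAtlas (𝓡 3) ∞ M) (hq : q ∈ Ψ.source) {f : M → F} {h : E3 → F}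
    (hf : ∀ᶠ x in 𝓝 q, f x = h (Ψ x)) (hh : DifferentiableAt ℝ h (Ψ q))
    (v : TangentSpace (𝓡 3) q) :
    mvfderiv (𝓡 3) f q v = fderiv ℝ h (Ψ q) (mvfderiv (𝓡 3) Ψ q v) := by
  have h1 : mfderiv (𝓡 3) 𝓘(ℝ, F) f q = mfderiv (𝓡 3) 𝓘(ℝ, F) (h ∘ Ψ) q :=
    Filter.EventuallyEq.mfderiv_eq hf
  have h2 := mfderiv_comp_apply (I := 𝓡 3) (I' := 𝓘(ℝ, E3)) (I'' := 𝓘(ℝ, F)) (g := h) (f := Ψ) q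
    hh.mdifferentiableAt ((chart_mdifferentiable hΨ).mdifferentiableAt hq) v
  rw [mfderiv_eq_fderiv] at h2
  exact (DFunLike.congr_fun h1 v).trans h2

lemma contDiffAt_comp_symm {F : Type*} [NormedAddCommGroup F] [NormedSpace ℝ F]
    (hΨ : Ψ ∈ IsManifold.maximalAtlas (𝓡 3) ∞ M) (hq : q ∈ Ψ.source) {f : M → F}
    (hf : ContMDiffAt (𝓡 3) 𝓘(ℝ, F) ∞ f q) : ContDiffAt ℝ ∞ (f ∘ Ψ.symm) (Ψ q) := by
  rw [← contMDiffAt_iff_contDiffAt]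
  refine ContMDiffAt.comp (I' := 𝓡 3) (Ψ q) ?_
    (contMDiffAt_symm_of_mem_maximalAtlas hΨ (Ψ.map_source hq))
  rwa [Ψ.left_inv hq]

lemma contMDiffAt_comp_chart {F : Type*} [NormedAddCommGroup F] [NormedSpace ℝ F]
    (hΨ : Ψ ∈ IsManifold.maximalAtlas (𝓡 3) ∞ M) (hq : q ∈ Ψ.source) {h : E3 → F}
    (hh : ContDiffAt ℝ ∞ h (Ψ q)) : ContMDiffAt (𝓡 3) 𝓘(ℝ, F) ∞ (h ∘ Ψ) q :=
  ContMDiffAt.comp (I' := 𝓘(ℝ, E3)) q hh.contMDiffAt (contMDiffAt_of_mem_maximalAtlas hΨ hq)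

lemma mvfderiv_eq_fderiv_chart {F : Type*} [NormedAddCommGroup F] [NormedSpace ℝ F]
    (hΨ : Ψ ∈ IsManifold.maximalAtlas (𝓡 3) ∞ M) (hq : q ∈ Ψ.source) {f : M → F}
    (hf : ContMDiffAt (𝓡 3) 𝓘(ℝ, F) ∞ f q) (v : TangentSpace (𝓡 3) q) :
    mvfderiv (𝓡 3) f q v = fderiv ℝ (f ∘ Ψ.symm) (Ψ q) (mvfderiv (𝓡 3) Ψ q v) := by
  refine mvfderiv_comp_chart hΨ hq ?_ ((contDiffAt_comp_symm hΨ hq hf).differentiableAt (by simp)) v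
  filter_upwards [Ψ.open_source.mem_nhds hq] with x hx
  simp [Ψ.left_inv hx]

variable [RiemannianBundle (fun x : M => TangentSpace (𝓡 3) x)]

/-- The coefficients of the metric in the chart `Ψ`. -/
def gram (Ψ : OpenPartialHomeomorph M E3) (i j : Fin 3) (y : E3) : ℝ :=
  innerFun (fld Ψ fun _ => EuclideanSpace.single i 1) (fld Ψ fun _ => EuclideanSpace.single j 1)
    (Ψ.symm y)

/-- The metric in the chart `Ψ`. -/
def metricForm (Ψ : OpenPartialHomeomorph M E3) (y : E3) : E3 →L[ℝ] E3 →L[ℝ] ℝ :=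
  ∑ i, ∑ j, gram Ψ i j y •
    ((EuclideanSpace.proj i : E3 →L[ℝ] ℝ).smulRight (EuclideanSpace.proj j : E3 →L[ℝ] ℝ))

lemma metricForm_apply (y a b : E3) :
    metricForm Ψ y a b = ∑ i, ∑ j, gram Ψ i j y * (a i * b j) := by
  simp [metricForm]

lemma inner_eq_metricForm (hΨ : Ψ ∈ IsManifold.maximalAtlas (𝓡 3) ∞ M) (hq : q ∈ Ψ.source)
    (v w : TangentSpace (𝓡 3) q) :
    inner ℝ v w = metricForm Ψ (Ψ q) (mvfderiv (𝓡 3) Ψ q v) (mvfderiv (𝓡 3) Ψ q w) := by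
  have key : ∀ v : TangentSpace (𝓡 3) q,
      v = ∑ i, (mvfderiv (𝓡 3) Ψ q v) i • fld Ψ (fun _ => EuclideanSpace.single i 1) q := by
    intro v
    apply mvfderiv_chart_injective hΨ hq
    simp only [map_sum, map_smul, mvfderiv_fld hΨ hq]
    ext j
    simp [Fin.sum_univ_three]
    fin_cases j <;> simp
  have hg : ∀ i j, gram Ψ i j (Ψ q) = inner ℝ (fld Ψ (fun _ => EuclideanSpace.single i 1) q)
      (fld Ψ (fun _ => EuclideanSpace.single j 1) q) := by
    intro i j
    rw [gram, Ψ.left_inv hq, innerFun]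
  conv_lhs => rw [key v, key w]
  rw [metricForm_apply]
  simp only [sum_inner, inner_sum, real_inner_smul_left, real_inner_smul_right, hg]
  rw [Finset.sum_comm]
  refine Finset.sum_congr rfl fun i _ => Finset.sum_congr rfl fun j _ => ?_
  ring

lemma innerFun_fld (hΨ : Ψ ∈ IsManifold.maximalAtlas (𝓡 3) ∞ M) (hq : q ∈ Ψ.source)
    (a b : E3 → E3) :
    innerFun (fld Ψ a) (fld Ψ b) q = metricForm Ψ (Ψ q) (a (Ψ q)) (b (Ψ q)) := by
  rw [innerFun, inner_eq_metricForm hΨ hq, mvfderiv_fld hΨ hq, mvfderiv_fld hΨ hq]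

lemma metricForm_symm (hΨ : Ψ ∈ IsManifold.maximalAtlas (𝓡 3) ∞ M) {y : E3}
    (hy : y ∈ Ψ.target) (a b : E3) : metricForm Ψ y a b = metricForm Ψ y b a := by
  have h := innerFun_fld hΨ (Ψ.map_target hy) (fun _ => a) (fun _ => b)
  have h' := innerFun_fld hΨ (Ψ.map_target hy) (fun _ => b) (fun _ => a)
  rw [Ψ.right_inv hy] at h h'
  rw [← h, ← h', innerFun, innerFun, real_inner_comm]

lemma metricForm_pos (hΨ : Ψ ∈ IsManifold.maximalAtlas (𝓡 3) ∞ M) {y : E3}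
    (hy : y ∈ Ψ.target) {a : E3} (ha : a ≠ 0) : 0 < metricForm Ψ y a a := by
  have h := innerFun_fld hΨ (Ψ.map_target hy) (fun _ => a) (fun _ => a)
  rw [Ψ.right_inv hy] at h
  rw [← h, innerFun, real_inner_self_pos]
  intro h0
  rw [fld_eq_iff hΨ (Ψ.map_target hy), map_zero] at h0
  exact ha h0.symm

variable [IsContMDiffRiemannianBundle (𝓡 3) ∞ E3 (fun x : M => TangentSpace (𝓡 3) x)]

lemma contDiffAt_gram (hΨ : Ψ ∈ IsManifold.maximalAtlas (𝓡 3) ∞ M) {y : E3}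
    (hy : y ∈ Ψ.target) (i j : Fin 3) : ContDiffAt ℝ ∞ (gram Ψ i j) y := by
  have hq := Ψ.map_target hy
  have h := contDiffAt_comp_symm hΨ hq (F := ℝ)
    (ContMDiffAt.inner_bundle (smoothFieldAt_fld hΨ hq (a := fun _ => EuclideanSpace.single i 1)
      contDiffAt_const)
    (smoothFieldAt_fld hΨ hq (a := fun _ => EuclideanSpace.single j 1) contDiffAt_const))
  rw [Ψ.right_inv hy] at h
  exact h

lemma contDiffAt_metricForm (hΨ : Ψ ∈ IsManifold.maximalAtlas (𝓡 3) ∞ M) {y : E3}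
    (hy : y ∈ Ψ.target) : ContDiffAt ℝ ∞ (metricForm Ψ) y := by
  unfold metricForm
  refine ContDiffAt.sum fun i _ => ContDiffAt.sum fun j _ => ?_
  exact (ContinuousLinearMap.toSpanSingleton ℝ ((EuclideanSpace.proj i : E3 →L[ℝ] ℝ).smulRight
    (EuclideanSpace.proj j : E3 →L[ℝ] ℝ))).contDiff.contDiffAt.comp y (contDiffAt_gram hΨ hy i j)

lemma fderiv_metricForm_apply (hΨ : Ψ ∈ IsManifold.maximalAtlas (𝓡 3) ∞ M) {y : E3}
    (hy : y ∈ Ψ.target) {a b : E3 → E3} (ha : DifferentiableAt ℝ a y)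
    (hb : DifferentiableAt ℝ b y) (v : E3) :
    fderiv ℝ (fun z => metricForm Ψ z (a z) (b z)) y v =
      fderiv ℝ (metricForm Ψ) y v (a y) (b y) + metricForm Ψ y (fderiv ℝ a y v) (b y)
        + metricForm Ψ y (a y) (fderiv ℝ b y v) := by
  have hg := (contDiffAt_metricForm hΨ hy).differentiableAt (by simp)
  rw [fderiv_clm_apply (hg.clm_apply ha) hb, fderiv_clm_apply hg ha]
  simp
  ring

lemma derivInner_fld (hΨ : Ψ ∈ IsManifold.maximalAtlas (𝓡 3) ∞ M) (hq : q ∈ Ψ.source)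
    (c : E3 → E3) {a b : E3 → E3} (ha : DifferentiableAt ℝ a (Ψ q))
    (hb : DifferentiableAt ℝ b (Ψ q)) :
    derivInner (fld Ψ c) (fld Ψ a) (fld Ψ b) q =
      fderiv ℝ (metricForm Ψ) (Ψ q) (c (Ψ q)) (a (Ψ q)) (b (Ψ q))
        + metricForm Ψ (Ψ q) (fderiv ℝ a (Ψ q) (c (Ψ q))) (b (Ψ q))
        + metricForm Ψ (Ψ q) (a (Ψ q)) (fderiv ℝ b (Ψ q) (c (Ψ q))) := by
  have hg := (contDiffAt_metricForm hΨ (Ψ.map_source hq)).differentiableAt (by simp)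
  rw [derivInner, mvfderiv_comp_chart hΨ hq (h := fun z => metricForm Ψ z (a z) (b z)) ?_
    ((hg.clm_apply ha).clm_apply hb), mvfderiv_fld hΨ hq,
    fderiv_metricForm_apply hΨ (Ψ.map_source hq) ha hb]
  filter_upwards [Ψ.open_source.mem_nhds hq] with x hx using innerFun_fld hΨ hx a b

/-- Koszul's formula in a chart. -/
def koszulForm (Ψ : OpenPartialHomeomorph M E3) (y a b c : E3) : ℝ :=
  (1 / 2) * (fderiv ℝ (metricForm Ψ) y a b c + fderiv ℝ (metricForm Ψ) y b a c
    - fderiv ℝ (metricForm Ψ) y c a b)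

/-- The bracket terms cancel all derivatives of the coefficient functions except the one of `b`
along `a`; what remains is algebraic in the values at the point. Hence `∇_v Y` depends on `v` only
pointwise. -/
lemma koszul_fld (hΨ : Ψ ∈ IsManifold.maximalAtlas (𝓡 3) ∞ M) (hq : q ∈ Ψ.source)
    {a b c : E3 → E3} (ha : ContDiffAt ℝ 1 a (Ψ q)) (hb : ContDiffAt ℝ 1 b (Ψ q))
    (hc : ContDiffAt ℝ 1 c (Ψ q)) :
    koszul (fld Ψ a) (fld Ψ b) (fld Ψ c) q =
      metricForm Ψ (Ψ q) (fderiv ℝ b (Ψ q) (a (Ψ q))) (c (Ψ q))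
        + koszulForm Ψ (Ψ q) (a (Ψ q)) (b (Ψ q)) (c (Ψ q)) := by
  have hda := ha.differentiableAt one_ne_zero
  have hdb := hb.differentiableAt one_ne_zero
  have hdc := hc.differentiableAt one_ne_zero
  have hbr : ∀ {a b c : E3 → E3}, ContDiffAt ℝ 1 a (Ψ q) → ContDiffAt ℝ 1 b (Ψ q) →
      innerFun (bracket (fld Ψ a) (fld Ψ b)) (fld Ψ c) q =
        metricForm Ψ (Ψ q) (fderiv ℝ b (Ψ q) (a (Ψ q))) (c (Ψ q))
          - metricForm Ψ (Ψ q) (fderiv ℝ a (Ψ q) (b (Ψ q))) (c (Ψ q)) := by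
    intro a b c ha hb
    rw [innerFun, bracket_fld hΨ hq ha hb, inner_eq_metricForm hΨ hq, mvfderiv_fld hΨ hq,
      mvfderiv_fld hΨ hq, VectorField.lieBracket_eq]
    simp
  have hs := metricForm_symm hΨ (Ψ.map_source hq)
  rw [koszul, hbr ha hb, hbr ha hc, hbr hb hc, derivInner_fld hΨ hq a hdb hdc,
    derivInner_fld hΨ hq b hda hdc, derivInner_fld hΨ hq c hda hdb, koszulForm,
    hs (b (Ψ q)) (fderiv ℝ c (Ψ q) (a (Ψ q))), hs (a (Ψ q)) (fderiv ℝ c (Ψ q) (b (Ψ q))),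
    hs (a (Ψ q)) (fderiv ℝ b (Ψ q) (c (Ψ q)))]
  ring

end ChartCalculus
end

noncomputable section
-- Locality of Koszul's formula and the Levi-Civita derivative in a chart
section LeviCivita

variable {M : Type*} [TopologicalSpace M] [ChartedSpace E3 M] [IsManifold (𝓡 3) ∞ M]
variable {Ψ : OpenPartialHomeomorph M E3} {q : M}

lemma extendVec_apply (v : TangentSpace (𝓡 3) q) : extendVec v q = v :=
  FiberBundle.extend_apply_self ..

lemma smoothFieldAt_extendVec (v : TangentSpace (𝓡 3) q) : SmoothFieldAt (extendVec v) q :=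
  FiberBundle.contMDiffAt_extend ..

variable [RiemannianBundle (fun x : M => TangentSpace (𝓡 3) x)]

lemma innerFun_congr {X X' Y Y' : ∀ x : M, TangentSpace (𝓡 3) x} (hX : ∀ᶠ x in 𝓝 q, X x = X' x)
    (hY : ∀ᶠ x in 𝓝 q, Y x = Y' x) : ∀ᶠ x in 𝓝 q, innerFun X Y x = innerFun X' Y' x := by
  filter_upwards [hX, hY] with x hx hy
  rw [innerFun, innerFun, hx, hy]

lemma derivInner_congr {X X' Y Y' Z Z' : ∀ x : M, TangentSpace (𝓡 3) x}
    (hX : ∀ᶠ x in 𝓝 q, X x = X' x)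
    (hY : ∀ᶠ x in 𝓝 q, Y x = Y' x) (hZ : ∀ᶠ x in 𝓝 q, Z x = Z' x) :
    derivInner X Y Z q = derivInner X' Y' Z' q := by
  have h : mfderiv (𝓡 3) 𝓘(ℝ, ℝ) (innerFun Y Z) q = mfderiv (𝓡 3) 𝓘(ℝ, ℝ) (innerFun Y' Z') q :=
    Filter.EventuallyEq.mfderiv_eq (innerFun_congr hY hZ)
  rw [derivInner, derivInner, hX.self_of_nhds]
  exact DFunLike.congr_fun h _

lemma bracket_congr {X X' Y Y' : ∀ x : M, TangentSpace (𝓡 3) x} (hX : ∀ᶠ x in 𝓝 q, X x = X' x)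
    (hY : ∀ᶠ x in 𝓝 q, Y x = Y' x) : bracket X Y q = bracket X' Y' q :=
  Filter.EventuallyEq.mlieBracket_vectorField_eq hX hY

lemma koszul_congr {X X' Y Y' Z Z' : ∀ x : M, TangentSpace (𝓡 3) x}
    (hX : ∀ᶠ x in 𝓝 q, X x = X' x)
    (hY : ∀ᶠ x in 𝓝 q, Y x = Y' x) (hZ : ∀ᶠ x in 𝓝 q, Z x = Z' x) :
    koszul X Y Z q = koszul X' Y' Z' q := by
  rw [koszul, koszul, derivInner_congr hX hY hZ, derivInner_congr hY hX hZ,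
    derivInner_congr hZ hX hY, innerFun, innerFun, innerFun, innerFun, innerFun, innerFun,
    bracket_congr hX hY, bracket_congr hX hZ, bracket_congr hY hZ, hX.self_of_nhds,
    hY.self_of_nhds, hZ.self_of_nhds]

variable [IsContMDiffRiemannianBundle (𝓡 3) ∞ E3 (fun x : M => TangentSpace (𝓡 3) x)]

lemma koszul_eq_koszulForm (hΨ : Ψ ∈ IsManifold.maximalAtlas (𝓡 3) ∞ M) (hq : q ∈ Ψ.source)
    {X Y Z : ∀ x : M, TangentSpace (𝓡 3) x} (hX : SmoothFieldAt X q) (hY : SmoothFieldAt Y q)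
    (hZ : SmoothFieldAt Z q) :
    koszul X Y Z q =
      metricForm Ψ (Ψ q) (fderiv ℝ (coordRep Ψ Y) (Ψ q) (mvfderiv (𝓡 3) Ψ q (X q)))
          (mvfderiv (𝓡 3) Ψ q (Z q))
        + koszulForm Ψ (Ψ q) (mvfderiv (𝓡 3) Ψ q (X q)) (mvfderiv (𝓡 3) Ψ q (Y q))
            (mvfderiv (𝓡 3) Ψ q (Z q)) := by
  have h1 : ∀ {X : ∀ x : M, TangentSpace (𝓡 3) x}, SmoothFieldAt X q →
      ContDiffAt ℝ 1 (coordRep Ψ X) (Ψ q) := fun hX => (contDiffAt_coordRep hΨ hq hX).of_le (by simp)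
  have h2 : ∀ X : ∀ x : M, TangentSpace (𝓡 3) x,
      coordRep Ψ X (Ψ q) = mvfderiv (𝓡 3) Ψ q (X q) := by
    intro X
    rw [coordRep, Ψ.left_inv hq]
  rw [koszul_congr (fld_coordRep_eventuallyEq hΨ hq X) (fld_coordRep_eventuallyEq hΨ hq Y)
    (fld_coordRep_eventuallyEq hΨ hq Z), koszul_fld hΨ hq (h1 hX) (h1 hY) (h1 hZ)]
  simp only [h2]

/-- The Levi-Civita derivative in a chart. -/
lemma inner_leviCivita (hΨ : Ψ ∈ IsManifold.maximalAtlas (𝓡 3) ∞ M) (hq : q ∈ Ψ.source)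
    {Y : ∀ x : M, TangentSpace (𝓡 3) x} (hY : SmoothFieldAt Y q) (v z : TangentSpace (𝓡 3) q) :
    inner ℝ (leviCivita Y q v) z =
      metricForm Ψ (Ψ q) (fderiv ℝ (coordRep Ψ Y) (Ψ q) (mvfderiv (𝓡 3) Ψ q v))
          (mvfderiv (𝓡 3) Ψ q z)
        + koszulForm Ψ (Ψ q) (mvfderiv (𝓡 3) Ψ q v) (mvfderiv (𝓡 3) Ψ q (Y q))
            (mvfderiv (𝓡 3) Ψ q z) := by
  have : FiniteDimensional ℝ (TangentSpace (𝓡 3) q) := inferInstanceAs (FiniteDimensional ℝ E3)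
  let e := stdOrthonormalBasis ℝ (TangentSpace (𝓡 3) q)
  -- `leviCivita` is defined by its Koszul coefficients against an orthonormal basis, so it is
  -- enough that the right-hand side is linear in `z`.
  have hz : z = ∑ i, inner ℝ (e i) z • e i := (e.sum_repr' z).symm
  conv_rhs => rw [hz]
  have hl : leviCivita Y q v = ∑ i, koszul (extendVec v) Y (extendVec (e i)) q • e i := rfl
  rw [hl, sum_inner]
  have hk : ∀ a b : E3, ∀ c : Fin (Module.finrank ℝ (TangentSpace (𝓡 3) q)) → ℝ,
      koszulForm Ψ (Ψ q) a b (∑ i, c i • mvfderiv (𝓡 3) Ψ q (e i)) =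
        ∑ i, c i * koszulForm Ψ (Ψ q) a b (mvfderiv (𝓡 3) Ψ q (e i)) := by
    intro a b c
    simp only [koszulForm, map_sum, map_smul, sum_apply,
      smul_apply, smul_eq_mul, Finset.mul_sum, ← Finset.sum_add_distrib,
      ← Finset.sum_sub_distrib]
    refine Finset.sum_congr rfl fun i _ => ?_
    ring
  simp only [map_sum, map_smul, hk]
  rw [← Finset.sum_add_distrib]
  refine Finset.sum_congr rfl fun i _ => ?_
  rw [real_inner_smul_left, koszul_eq_koszulForm hΨ hq (smoothFieldAt_extendVec v) hY
    (smoothFieldAt_extendVec (e i)), extendVec_apply, extendVec_apply, smul_eq_mul]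
  ring

end LeviCivita
end

noncomputable section

/-! ### The inverse function theorem with smoothness on the whole domain -/

section InverseFunction

variable {E F : Type*} [NormedAddCommGroup E] [NormedSpace ℝ E] [CompleteSpace E]
  [NormedAddCommGroup F] [NormedSpace ℝ F] [CompleteSpace F]

/-- The inverse function theorem for smooth functions, with smoothness on the whole domain. -/
lemma exists_smooth_openPartialHomeomorph {f : E → F} {B : Set E} (hB : IsOpen B)
    (hf : ∀ x ∈ B, ContDiffAt ℝ ∞ f x) {x : E} (hx : x ∈ B)
    (hinv : (fderiv ℝ f x).IsInvertible) :
    ∃ e : OpenPartialHomeomorph E F, x ∈ e.source ∧ e.source ⊆ B ∧ (∀ y, e y = f y) ∧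
      (∀ y ∈ e.target, ContDiffAt ℝ ∞ e.symm y) ∧
      ∀ y ∈ e.source, (fderiv ℝ f y).IsInvertible := by
  obtain ⟨f', hf'⟩ := hinv
  have hd : HasFDerivAt f (f' : E →L[ℝ] F) x := by
    rw [hf']
    exact ((hf x hx).differentiableAt (by simp)).hasFDerivAt
  let e₀ := (hf x hx).toOpenPartialHomeomorph f hd (by simp)
  have hcont : ContinuousOn (fderiv ℝ f) B := fun y hy =>
    ((hf y hy).continuousAt_fderiv (by simp)).continuousWithinAt
  -- Invertible maps form an open set. Restricting to points with invertible derivative makes the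
  -- inverse smooth on its whole domain and not only at the image of `x`.
  let V : Set E := B ∩ fderiv ℝ f ⁻¹' Set.range ((↑) : (E ≃L[ℝ] F) → E →L[ℝ] F)
  have hV : IsOpen V := hcont.isOpen_inter_preimage hB ContinuousLinearEquiv.isOpen
  have hxV : x ∈ V := ⟨hx, f', hf'⟩
  refine ⟨e₀.restrOpen V hV, ⟨(hf x hx).mem_toOpenPartialHomeomorph_source hd (by simp), hxV⟩,
    fun y hy => hy.2.1, fun y => rfl, fun y hy => ?_, fun y hy => hy.2.2⟩
  have hy' := (e₀.restrOpen V hV).map_target hy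
  obtain ⟨g', hg'⟩ := hy'.2.2
  refine OpenPartialHomeomorph.contDiffAt_symm (f₀' := g') _ hy ?_ ?_
  · rw [hg']
    exact ((hf _ hy'.2.1).differentiableAt (by simp)).hasFDerivAt
  · exact hf _ hy'.2.1

end InverseFunction

/-! ### Smoothness of composition on spaces of continuous functions -/

section Superposition

variable {K : Type*} [TopologicalSpace K] [CompactSpace K]

/-- A bilinear map, applied pointwise to continuous functions. -/
def pointwiseBilin {G E F : Type} [NormedAddCommGroup G] [NormedSpace ℝ G]
    [NormedAddCommGroup E] [NormedSpace ℝ E] [NormedAddCommGroup F] [NormedSpace ℝ F]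
    (B : G →L[ℝ] E →L[ℝ] F) : C(K, G) →L[ℝ] C(K, E) →L[ℝ] C(K, F) :=
  LinearMap.mkContinuous₂
    (LinearMap.mk₂ ℝ (fun (A : C(K, G)) (h : C(K, E)) =>
        (⟨fun k => B (A k) (h k), (B.continuous.comp A.continuous).clm_apply h.continuous⟩ : C(K, F)))
      (fun _ _ _ => by ext; simp) (fun _ _ _ => by ext; simp)
      (fun _ _ _ => by ext; simp) (fun _ _ _ => by ext; simp)) ‖B‖ (fun A h => by
      rw [ContinuousMap.norm_le _ (by positivity)]
      intro k
      refine (B.le_opNorm₂ _ _).trans ?_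
      gcongr
      · exact A.norm_coe_le_norm k
      · exact h.norm_coe_le_norm k)

variable {E F : Type} [NormedAddCommGroup E] [NormedSpace ℝ E]
  [NormedAddCommGroup F] [NormedSpace ℝ F]

/-- Pointwise application, as a bilinear map of spaces of continuous functions. -/
def pointwiseApply (K : Type*) [TopologicalSpace K] [CompactSpace K] (E F : Type)
    [NormedAddCommGroup E] [NormedSpace ℝ E] [NormedAddCommGroup F] [NormedSpace ℝ F] :
    C(K, E →L[ℝ] F) →L[ℝ] C(K, E) →L[ℝ] C(K, F) :=
  pointwiseBilin (ContinuousLinearMap.id ℝ (E →L[ℝ] F))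

/-- The range of `γ` is compact, so `f'` is uniformly continuous at it; the mean value inequality on
the segment from `γ k` to `η k` then gives an error bound independent of `k`. -/
lemma hasFDerivAt_postcomp {f : C(E, F)} {f' : C(E, E →L[ℝ] F)}
    (hf : ∀ x, HasFDerivAt f (f' x) x) (γ : C(K, E)) :
    HasFDerivAt (fun γ : C(K, E) => f.comp γ) (pointwiseApply K E F (f'.comp γ)) γ := by
  rw [hasFDerivAt_iff_isLittleO, Asymptotics.isLittleO_iff]
  intro ε hε
  have hK : IsCompact (Set.range γ) := isCompact_range γ.continuous
  have hu := hK.uniformContinuousAt_of_continuousAt f'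
    (fun x _ => f'.continuous.continuousAt) (Metric.dist_mem_uniformity hε)
  obtain ⟨δ, hδ, h⟩ := Metric.mem_uniformity_dist.1 hu
  filter_upwards [Metric.ball_mem_nhds γ hδ] with η hη
  rw [ContinuousMap.norm_le _ (by positivity)]
  intro k
  have hk : ∀ y ∈ segment ℝ (γ k) (η k), ‖f' y - f' (γ k)‖ ≤ ε := by
    intro y hy
    have h1 : dist (γ k) y < δ := by
      have h2 : ‖y - γ k‖ ≤ ‖η k - γ k‖ := by
        obtain ⟨t, ht, rfl⟩ := (segment_eq_image' ℝ (γ k) (η k) ▸ hy :)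
        simp only [add_sub_cancel_left, norm_smul, Real.norm_eq_abs, abs_of_nonneg ht.1]
        exact mul_le_of_le_one_left (norm_nonneg _) ht.2
      rw [dist_comm, dist_eq_norm]
      calc ‖y - γ k‖ ≤ ‖η k - γ k‖ := h2
        _ = dist (η k) (γ k) := (dist_eq_norm _ _).symm
        _ ≤ dist η γ := ContinuousMap.dist_apply_le_dist k
        _ < δ := hη
    have h3 := h h1 (Set.mem_range_self k)
    rw [Set.mem_ofPred_eq, dist_comm, dist_eq_norm] at h3
    exact h3.le
  have h4 := (convex_segment (γ k) (η k)).norm_image_sub_le_of_norm_hasFDerivWithin_le' (f := f)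
    (φ := f' (γ k)) (C := ε) (fun y _ => (hf y).hasFDerivWithinAt) hk
    (left_mem_segment ℝ _ _) (right_mem_segment ℝ _ _)
  change ‖f (η k) - f (γ k) - f' (γ k) (η k - γ k)‖ ≤ _
  refine h4.trans ?_
  gcongr
  exact (η - γ).norm_coe_le_norm k

-- The derivative of composition with `f` is composition with `f'` followed by a continuous bilinear
-- map. The target changes from `F` to `E →L[ℝ] F`, so the induction quantifies over all targets.
set_option synthInstance.maxHeartbeats 200000 in
lemma contDiff_postcomp_nat (n : ℕ) : ∀ {F : Type} [NormedAddCommGroup F] [NormedSpace ℝ F]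
    (f : C(E, F)), ContDiff ℝ n f → ContDiff ℝ n (fun γ : C(K, E) => f.comp γ) := by
  induction n with
  | zero =>
    intro F _ _ f hf
    rw [Nat.cast_zero, contDiff_zero]
    exact ContinuousMap.continuous_postcomp _
  | succ n ih =>
    intro F _ _ f hf
    rw [Nat.cast_succ, contDiff_succ_iff_fderiv] at hf ⊢
    let f' : C(E, E →L[ℝ] F) := ⟨fderiv ℝ f, hf.2.2.continuous⟩
    have hd := hasFDerivAt_postcomp (K := K) (f := f) (f' := f') fun x => (hf.1 x).hasFDerivAt
    refine ⟨fun γ => (hd γ).differentiableAt, by simp, ?_⟩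
    rw [show fderiv ℝ (fun γ : C(K, E) => f.comp γ) = fun γ => pointwiseApply K E F (f'.comp γ)
      from funext fun γ => (hd γ).fderiv]
    exact (pointwiseApply K E F).contDiff.comp (ih f' hf.2.2)

lemma contDiff_postcomp (f : C(E, F)) (hf : ContDiff ℝ ∞ f) :
    ContDiff ℝ ∞ (fun γ : C(K, E) => f.comp γ) := by
  rw [contDiff_infty]
  exact fun n => contDiff_postcomp_nat n f (hf.of_le (by exact_mod_cast le_top))

end Superposition
end

noncomputable section

/-! ### Smooth local flows from the inverse function theorem in a function space -/

section Flow

variable {E : Type} [NormedAddCommGroup E] [NormedSpace ℝ E] [CompleteSpace E]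

/-- The primitive vanishing at `0` of a continuous function on the unit interval. -/
def primitiveCLM (E : Type) [NormedAddCommGroup E] [NormedSpace ℝ E] [CompleteSpace E] :
    C(unitInterval, E) →L[ℝ] C(unitInterval, E) :=
  LinearMap.mkContinuous
    { toFun := fun g => ⟨fun t => ∫ s in (0 : ℝ)..t, g (Set.projIcc 0 1 zero_le_one s),
        (intervalIntegral.continuous_primitive (fun a b =>
          (g.continuous.comp continuous_projIcc).intervalIntegrable a b) 0).comp
          continuous_subtype_val⟩
      map_add' := fun g h => by
        ext t
        exact intervalIntegral.integral_add
          ((g.continuous.comp continuous_projIcc).intervalIntegrable _ _)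
          ((h.continuous.comp continuous_projIcc).intervalIntegrable _ _)
      map_smul' := fun c g => by
        ext t
        exact intervalIntegral.integral_smul c _ } 1 (fun g => by
      rw [one_mul, ContinuousMap.norm_le _ (norm_nonneg _)]
      intro t
      refine (intervalIntegral.norm_integral_le_of_norm_le_const
        (fun s _ => g.norm_coe_le_norm _)).trans ?_
      rw [sub_zero, abs_of_nonneg t.2.1]
      exact mul_le_of_le_one_right (norm_nonneg _) t.2.2)

/-- The constant functions. -/
def constCLM (E : Type) [NormedAddCommGroup E] [NormedSpace ℝ E] : E →L[ℝ] C(unitInterval, E) :=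
  ContinuousLinearMap.const ℝ unitInterval

lemma constCLM_apply (x : E) (t : unitInterval) : constCLM E x t = x := rfl

/-- The defect of `γ` as a solution of the integral equation `γ = x + ε ∫ X ∘ γ`. -/
def flowDefect (X : C(E, E)) (z : (ℝ × E) × C(unitInterval, E)) :
    (ℝ × E) × C(unitInterval, E) :=
  (z.1, z.2 - constCLM E z.1.2 - z.1.1 • primitiveCLM E (X.comp z.2))

lemma contDiff_flowDefect {X : C(E, E)} (hX : ContDiff ℝ ∞ X) : ContDiff ℝ ∞ (flowDefect X) := by
  have h1 := (contDiff_postcomp (K := unitInterval) X hX).comp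
    (contDiff_snd (𝕜 := ℝ) (E := ℝ × E) (F := C(unitInterval, E)))
  exact contDiff_fst.prodMk ((contDiff_snd.sub ((constCLM E).contDiff.comp
    (contDiff_snd.comp contDiff_fst))).sub
    ((contDiff_fst.comp contDiff_fst).smul ((primitiveCLM E).contDiff.comp h1)))

/-- At `ε = 0` the integral term has no derivative in the direction of the curve, because its factor
`ε` vanishes. The derivative is therefore triangular with identities on the diagonal, and changing
the sign of the off-diagonal block `A` inverts it. -/
lemma fderiv_flowDefect_isInvertible {X : C(E, E)} (hX : ContDiff ℝ ∞ X) (x : E) :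
    (fderiv ℝ (flowDefect X) ((0, x), constCLM E x)).IsInvertible := by
  let A : ℝ × E →L[ℝ] C(unitInterval, E) :=
    (constCLM E).comp (ContinuousLinearMap.snd ℝ ℝ E)
      + (ContinuousLinearMap.fst ℝ ℝ E).smulRight (primitiveCLM E (X.comp (constCLM E x)))
  have hd : HasFDerivAt (flowDefect X)
      ((ContinuousLinearMap.fst ℝ (ℝ × E) C(unitInterval, E)).prod
        (ContinuousLinearMap.snd ℝ (ℝ × E) C(unitInterval, E)
          - A.comp (ContinuousLinearMap.fst ℝ (ℝ × E) C(unitInterval, E))))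
      ((0, x), constCLM E x) := by
    have h1 := ((contDiff_postcomp (K := unitInterval) X hX).comp
      (contDiff_snd (𝕜 := ℝ) (E := ℝ × E) (F := C(unitInterval, E)))).differentiable (by simp)
      ((0, x), constCLM E x)
    have h2 := (primitiveCLM E).hasFDerivAt.comp _ h1.hasFDerivAt
    have h3 : HasFDerivAt (fun z : (ℝ × E) × C(unitInterval, E) => z.1.1)
      ((ContinuousLinearMap.fst ℝ ℝ E).comp
        (ContinuousLinearMap.fst ℝ (ℝ × E) C(unitInterval, E))) ((0, x), constCLM E x) :=
      hasFDerivAt_fst.comp _ hasFDerivAt_fst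
    have h4 : HasFDerivAt (fun z : (ℝ × E) × C(unitInterval, E) => constCLM E z.1.2)
      ((constCLM E).comp ((ContinuousLinearMap.snd ℝ ℝ E).comp
        (ContinuousLinearMap.fst ℝ (ℝ × E) C(unitInterval, E)))) ((0, x), constCLM E x) :=
      (constCLM E).hasFDerivAt.comp _ (hasFDerivAt_snd.comp _ hasFDerivAt_fst)
    refine HasFDerivAt.congr_fderiv
      (hasFDerivAt_fst.prodMk ((hasFDerivAt_snd.sub h4).sub (h3.smul h2))) ?_
    refine ContinuousLinearMap.ext fun z => ?_
    simp [A, sub_sub]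
  rw [hd.fderiv]
  refine ContinuousLinearMap.IsInvertible.of_inverse
    (g := (ContinuousLinearMap.fst ℝ (ℝ × E) C(unitInterval, E)).prod
        (ContinuousLinearMap.snd ℝ (ℝ × E) C(unitInterval, E)
          + A.comp (ContinuousLinearMap.fst ℝ (ℝ × E) C(unitInterval, E)))) ?_ ?_
  · refine ContinuousLinearMap.ext fun z => ?_
    simp
  · refine ContinuousLinearMap.ext fun z => ?_
    simp

/-- A smooth vector field has a smooth local flow. -/
lemma exists_smooth_flow {X : E → E} (hX : ContDiff ℝ ∞ X) (x₀ : E) :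
    ∃ (φ : ℝ × E → E) (W : Set (ℝ × E)), IsOpen W ∧ (0, x₀) ∈ W ∧
      (∀ z ∈ W, ContDiffAt ℝ ∞ φ z) ∧ (∀ x, (0, x) ∈ W → φ (0, x) = x) ∧
      ∀ z ∈ W, fderiv ℝ φ z (1, 0) = X (φ z) := by
  let Xc : C(E, E) := ⟨X, hX.continuous⟩
  obtain ⟨e, he0, -, hef, hes, -⟩ := exists_smooth_openPartialHomeomorph isOpen_univ
    (fun z _ => (contDiff_flowDefect (X := Xc) hX).contDiffAt (x := z)) (Set.mem_univ _)
    (fderiv_flowDefect_isInvertible (X := Xc) hX x₀)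
  obtain ⟨δ, hδ, hball⟩ := Metric.isOpen_iff.1 e.open_source _ he0
  -- `γ (ε, x)` is the integral curve from `x` on the time interval from `0` to `ε`, rescaled to the
  -- unit interval; the flow is its value at `1`.
  let γ : ℝ × E → C(unitInterval, E) := fun z => (e.symm (z, 0)).2
  let O : Set (ℝ × E) := {z | (z, (0 : C(unitInterval, E))) ∈ e.target}
  have hO : IsOpen O := e.open_target.preimage (by fun_prop)
  have hγ : ∀ z ∈ O, ContDiffAt ℝ ∞ γ z := fun z hz =>
    contDiffAt_snd.comp z ((hes _ hz).comp z (contDiffAt_id.prodMk contDiffAt_const))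
  have hinv : ∀ z ∈ O, e.symm (z, 0) = (z, γ z) ∧
      γ z = constCLM E z.2 + z.1 • primitiveCLM E (Xc.comp (γ z)) := by
    intro z hz
    have h := e.right_inv hz
    rw [hef, flowDefect, Prod.mk.injEq] at h
    obtain ⟨h1, h2⟩ := h
    refine ⟨Prod.ext h1 rfl, ?_⟩
    rw [h1, sub_sub, sub_eq_zero] at h2
    exact h2
  have huniq : ∀ (z : ℝ × E) (η : C(unitInterval, E)), (z, η) ∈ e.source →
      η = constCLM E z.2 + z.1 • primitiveCLM E (Xc.comp η) → η = γ z := by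
    intro z η hz hη
    have h := e.left_inv hz
    rw [hef, flowDefect] at h
    rw [sub_sub, ← hη, sub_self] at h
    exact (congrArg Prod.snd h).symm
  have he0' : e ((0, x₀), constCLM E x₀) = ((0, x₀), 0) := by
    rw [hef, flowDefect]; simp
  have hx₀O : ((0 : ℝ), x₀) ∈ O := by
    have := e.map_source he0
    rwa [he0'] at this
  have hγ0 : γ (0, x₀) = constCLM E x₀ := by
    have := (hinv _ hx₀O).2
    rwa [zero_smul, add_zero] at this
  -- The ball in the sup metric also contains the curves obtained by slowing `γ z` down, so the
  -- uniqueness statement `huniq` applies to them.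
  let W : Set (ℝ × E) := O ∩ (fun z => (z, γ z)) ⁻¹' Metric.ball ((0, x₀), constCLM E x₀) δ
  have hW : IsOpen W := by
    refine ContinuousOn.isOpen_inter_preimage (fun z hz => ?_) hO Metric.isOpen_ball
    exact (continuousAt_id.prodMk (hγ z hz).continuousAt).continuousWithinAt
  have hφ : ∀ z ∈ O, ContDiffAt ℝ ∞ (fun z => γ z 1) z := fun z hz =>
    (ContinuousMap.evalCLM ℝ (1 : unitInterval) : C(unitInterval, E) →L[ℝ] E).contDiff.contDiffAt.comp
      z (hγ z hz)
  refine ⟨fun z => γ z 1, W, hW, ⟨hx₀O, ?_⟩, fun z hz => hφ z hz.1, ?_, ?_⟩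
  · rw [Set.mem_preimage, hγ0]
    exact Metric.mem_ball_self hδ
  · intro x hx
    change γ (0, x) 1 = x
    rw [(hinv _ hx.1).2]
    simp [constCLM_apply]
  -- the equation away from `ε = 0`
  have hne : ∀ z ∈ W, z.1 ≠ 0 → fderiv ℝ (fun z => γ z 1) z (1, 0) = X (γ z 1) := by
    rintro ⟨ε, x⟩ hz hε
    let g : ℝ → E := fun t => x + ε • ∫ s in (0 : ℝ)..t, X (γ (ε, x) (Set.projIcc 0 1 zero_le_one s))
    have hcont : Continuous fun s : ℝ => X (γ (ε, x) (Set.projIcc 0 1 zero_le_one s)) :=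
      hX.continuous.comp ((γ (ε, x)).continuous.comp continuous_projIcc)
    have hγg : ∀ t : unitInterval, γ (ε, x) t = g t := by
      intro t
      have := DFunLike.congr_fun (hinv _ hz.1).2 t
      exact this
    -- The slowed curve `u ↦ γ (ε, x) (t * u)` solves the integral equation with parameter `t * ε`,
    -- hence equals `γ (t * ε, x)`. This turns differentiation in `ε` into differentiation along one
    -- curve.
    have hresc : ∀ t ∈ Set.Icc (0 : ℝ) 1, γ (t * ε, x) 1 = g t := by
      intro t ht
      let η : C(unitInterval, E) :=
        ⟨fun u => γ (ε, x) (⟨t, ht⟩ * u), (γ (ε, x)).continuous.comp (by fun_prop)⟩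
      have hη : η = γ (t * ε, x) := by
        refine huniq _ _ (hball ?_) ?_
        · have h1 : dist ((ε, x), γ (ε, x)) ((0, x₀), constCLM E x₀) < δ := hz.2
          rw [Metric.mem_ball]
          refine lt_of_le_of_lt ?_ h1
          rw [Prod.dist_eq, Prod.dist_eq, Prod.dist_eq, Prod.dist_eq]
          refine max_le_max (max_le_max ?_ le_rfl) ?_
          · simp only [dist_zero_right, norm_mul, Real.norm_eq_abs, abs_of_nonneg ht.1]
            exact mul_le_of_le_one_left (abs_nonneg _) ht.2
          · rw [ContinuousMap.dist_le dist_nonneg]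
            intro u
            exact ContinuousMap.dist_apply_le_dist (f := γ (ε, x)) (g := constCLM E x₀)
              (⟨t, ht⟩ * u)
        · ext u
          change γ (ε, x) (⟨t, ht⟩ * u) = x + (t * ε) • ∫ s in (0 : ℝ)..u,
            X (γ (ε, x) (⟨t, ht⟩ * Set.projIcc 0 1 zero_le_one s))
          rw [hγg, mul_comm t ε, mul_smul]
          change x + ε • ∫ s in (0 : ℝ)..(t * u), X (γ (ε, x) (Set.projIcc 0 1 zero_le_one s)) = _
          congr 2
          have hsub := intervalIntegral.smul_integral_comp_mul_left (a := 0) (b := (u : ℝ))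
            (fun s : ℝ => X (γ (ε, x) (Set.projIcc 0 1 zero_le_one s))) t
          rw [mul_zero] at hsub
          rw [← hsub]
          congr 1
          refine intervalIntegral.integral_congr fun s hs => ?_
          rw [Set.uIcc_of_le u.2.1] at hs
          have hs' : s ∈ Set.Icc (0 : ℝ) 1 := ⟨hs.1, hs.2.trans u.2.2⟩
          have hts : t * s ∈ Set.Icc (0 : ℝ) 1 :=
            ⟨mul_nonneg ht.1 hs'.1, mul_le_one₀ ht.2 hs'.1 hs'.2⟩
          simp only [Set.projIcc_of_mem zero_le_one hs', Set.projIcc_of_mem zero_le_one hts]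
          rfl
      have h2 : γ (t * ε, x) 1 = η 1 := by rw [hη]
      rw [h2]
      change γ (ε, x) (⟨t, ht⟩ * 1) = _
      rw [mul_one, hγg]
    have hg : HasDerivAt g (ε • X (γ (ε, x) 1)) 1 := by
      have h1 : HasDerivAt (fun t => ∫ s in (0 : ℝ)..t,
          X (γ (ε, x) (Set.projIcc 0 1 zero_le_one s)))
          (X (γ (ε, x) (Set.projIcc 0 1 zero_le_one 1))) 1 :=
        intervalIntegral.integral_hasDerivAt_right (hcont.intervalIntegrable _ _)
          hcont.aestronglyMeasurable.stronglyMeasurableAtFilter hcont.continuousAt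
      rw [Set.projIcc_right] at h1
      exact (h1.const_smul ε).const_add x
    -- The comparison with `g` is known only for `t ≤ 1`; a one-sided derivative suffices because
    -- the two-sided one exists by smoothness.
    have h2 : HasDerivWithinAt (fun t : ℝ => γ (t * ε, x) 1) (ε • X (γ (ε, x) 1))
        (Set.Icc 0 1) 1 :=
      hg.hasDerivWithinAt.congr (fun t ht => hresc t ht) (hresc 1 (by simp))
    have h3 : HasDerivAt (fun t : ℝ => γ (t * ε, x) 1)
        (fderiv ℝ (fun z => γ z 1) (ε, x) (ε, 0)) 1 := by
      have h4 : HasDerivAt (fun t : ℝ => (t * ε, x)) (ε, (0 : E)) 1 := by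
        have := (hasDerivAt_id (1 : ℝ)).mul_const ε
        simp only [one_mul] at this
        exact this.prodMk (hasDerivAt_const _ _)
      have h5 : HasFDerivAt (fun z => γ z 1) (fderiv ℝ (fun z => γ z 1) (ε, x))
          ((fun t : ℝ => (t * ε, x)) 1) := by
        simp only [one_mul]
        exact ((hφ _ hz.1).differentiableAt (by simp)).hasFDerivAt
      exact h5.comp_hasDerivAt 1 h4
    have h6 := (uniqueDiffOn_Icc zero_lt_one 1 (Set.right_mem_Icc.2 zero_le_one)).eq_deriv _
      h3.hasDerivWithinAt h2
    have h7 : ((ε, 0) : ℝ × E) = ε • (1, 0) := by simp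
    rw [h7, map_smul] at h6
    exact smul_right_injective E hε h6
  rintro ⟨ε, x⟩ hz
  rcases ne_or_eq ε 0 with hε | rfl
  · exact hne _ hz hε
  -- Rescaling loses all information at `ε = 0`, where the equation follows by continuity of both
  -- sides.
  have hpath : Tendsto (fun s : ℝ => (s, x)) (𝓝[≠] 0) (𝓝 (0, x)) :=
    (Continuous.tendsto (by fun_prop) 0).mono_left nhdsWithin_le_nhds
  have hA : Tendsto (fun s : ℝ => fderiv ℝ (fun z => γ z 1) (s, x) (1, 0)) (𝓝[≠] 0)
      (𝓝 (fderiv ℝ (fun z => γ z 1) (0, x) (1, 0))) :=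
    ((((hφ _ hz.1).continuousAt_fderiv (by simp)).clm_apply continuousAt_const).tendsto).comp hpath
  have hB : Tendsto (fun s : ℝ => X (γ (s, x) 1)) (𝓝[≠] 0) (𝓝 (X (γ (0, x) 1))) :=
    ((hX.continuous.continuousAt.comp (hφ _ hz.1).continuousAt).tendsto).comp hpath
  refine tendsto_nhds_unique hA (hB.congr' ?_)
  filter_upwards [hpath.eventually (hW.mem_nhds hz), self_mem_nhdsWithin] with s hs hs0
  exact (hne _ hs hs0).symm

end Flow
end

noncomputable section

/-! ### Flow boxes and simultaneous straightening of commuting frames -/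

section CoordinateChanges

/-- The standard basis vectors of `E3`. -/
abbrev stdVec (i : Fin 3) : E3 := EuclideanSpace.single i 1

lemma eq_sum_stdVec (v : E3) : v = v 0 • stdVec 0 + v 1 • stdVec 1 + v 2 • stdVec 2 := by
  ext j
  fin_cases j <;> simp

lemma isInvertible_of_injective {A : E3 →L[ℝ] E3} (hA : ∀ v, A v = 0 → v = 0) :
    A.IsInvertible := by
  have h : Function.Injective (A : E3 →ₗ[ℝ] E3) := by
    rw [← LinearMap.ker_eq_bot, LinearMap.ker_eq_bot']
    exact hA
  refine ⟨(LinearEquiv.ofInjectiveEndo _ h).toContinuousLinearEquiv, ?_⟩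
  ext1 v
  rfl

/-- A smooth vector field transverse to a coordinate plane can be straightened, keeping the
plane. -/
lemma exists_flowBox {U : Set E3} (hU : IsOpen U) {V : E3 → E3}
    (hV : ∀ y ∈ U, ContDiffAt ℝ ∞ V y) {y₀ : E3} (hy₀ : y₀ ∈ U) (h0 : y₀ 2 = 0)
    (htr : V y₀ 2 ≠ 0) :
    ∃ e : OpenPartialHomeomorph E3 E3, y₀ ∈ e.source ∧ e.source ⊆ U ∧
      (∀ y ∈ e.source, ContDiffAt ℝ ∞ e y) ∧ (∀ y ∈ e.target, ContDiffAt ℝ ∞ e.symm y) ∧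
      (∀ y ∈ e.source, fderiv ℝ e y (V y) = stdVec 2) ∧
      ∀ y ∈ e.source, y 2 = 0 ↔ e y 2 = 0 := by
  obtain ⟨R, hR, hRU⟩ := Metric.isOpen_iff.1 hU y₀ hy₀
  -- The cut-off extends `V` to a global smooth field, equal to `V` on the ball of radius `R / 4`;
  -- the flow is kept in this ball by the choice of `B` below.
  let χ : ContDiffBump y₀ := ⟨R / 4, R / 2, by linarith, by linarith⟩
  let X : E3 → E3 := fun y => χ y • V y
  have hX : ContDiff ℝ ∞ X := by
    rw [contDiff_iff_contDiffAt]
    intro y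
    by_cases hy : y ∈ U
    · exact χ.contDiff.contDiffAt.smul (hV y hy)
    · have hy' : y ∈ (tsupport χ)ᶜ := by
        rw [χ.tsupport_eq]
        exact fun h => hy (hRU (Metric.closedBall_subset_ball (by change R / 2 < R; linarith) h))
      refine (contDiffAt_const (c := (0 : E3))).congr_of_eventuallyEq ?_
      filter_upwards [(isClosed_tsupport χ).isOpen_compl.mem_nhds hy'] with z hz
      simp [X, image_eq_zero_of_notMem_tsupport hz]
  have hXV : ∀ y ∈ Metric.ball y₀ (R / 4), X y = V y := by
    intro y hy
    simp [X, χ.one_of_mem_closedBall (Metric.ball_subset_closedBall hy)]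
  obtain ⟨φ, W, hW, h0W, hφ, hφ0, hφd⟩ := exists_smooth_flow hX y₀
  let c : E3 →L[ℝ] ℝ := EuclideanSpace.proj 2
  let pr : E3 →L[ℝ] E3 := ContinuousLinearMap.id ℝ E3 - c.smulRight (stdVec 2)
  have hpr : ∀ v : E3, v 2 = 0 → pr v = v := by
    intro v hv
    simp [pr, c, hv]
  let L : E3 → ℝ × E3 := fun z => (z 2, y₀ + pr z)
  have hL : ∀ z, HasFDerivAt L (c.prod pr) z := fun z =>
    c.hasFDerivAt.prodMk (pr.hasFDerivAt.const_add y₀)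
  have hLs : ContDiff ℝ ∞ L := c.contDiff.prodMk (contDiff_const.add pr.contDiff)
  -- The inverse of the flow box: start in the plane at `y₀ + pr z` and flow for the time `z 2`.
  let H : E3 → E3 := fun z => φ (L z)
  let B : Set E3 := L ⁻¹' (W ∩ φ ⁻¹' Metric.ball y₀ (R / 4))
  have hWb : IsOpen (W ∩ φ ⁻¹' Metric.ball y₀ (R / 4)) :=
    ContinuousOn.isOpen_inter_preimage (fun z hz => (hφ z hz).continuousAt.continuousWithinAt) hW
      Metric.isOpen_ball
  have hB : IsOpen B := hWb.preimage hLs.continuous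
  have hL0 : L 0 = (0, y₀) := by simp [L]
  have h0B : (0 : E3) ∈ B := by
    refine ⟨by rw [hL0]; exact h0W, ?_⟩
    rw [Set.mem_preimage, hL0, hφ0 _ h0W]
    exact Metric.mem_ball_self (by linarith)
  have hH : ∀ z ∈ B, ContDiffAt ℝ ∞ H z := fun z hz => (hφ _ hz.1).comp z hLs.contDiffAt
  have hHd : ∀ z ∈ B, fderiv ℝ H z = (fderiv ℝ φ (L z)).comp (c.prod pr) := fun z hz =>
    (((hφ _ hz.1).differentiableAt (by simp)).hasFDerivAt.comp z (hL z)).fderiv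
  have hφ' : ∀ b : E3, fderiv ℝ φ (0, y₀) (0, b) = b := by
    intro b
    have h1 : HasFDerivAt (fun x : E3 => φ (0, x))
        ((fderiv ℝ φ (0, y₀)).comp (ContinuousLinearMap.inr ℝ ℝ E3)) y₀ :=
      HasFDerivAt.comp y₀ ((hφ _ h0W).differentiableAt (by simp)).hasFDerivAt
        (hasFDerivAt_prodMk_right 0 y₀)
    have h2 : HasFDerivAt (fun x : E3 => φ (0, x)) (ContinuousLinearMap.id ℝ E3) y₀ := by
      refine (hasFDerivAt_id y₀).congr_of_eventuallyEq ?_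
      filter_upwards [(hW.preimage (by fun_prop : Continuous fun x : E3 => ((0 : ℝ), x))).mem_nhds
        h0W] with x hx using hφ0 x hx
    exact DFunLike.congr_fun (h1.unique h2) b
  have hVH : ∀ z ∈ B, fderiv ℝ H z (stdVec 2) = V (H z) := by
    intro z hz
    have h1 : (c.prod pr) (stdVec 2) = (1, 0) := by
      simp [c, pr]
    rw [hHd z hz, ContinuousLinearMap.comp_apply, h1, hφd _ hz.1]
    exact hXV _ hz.2
  have hinv : (fderiv ℝ H 0).IsInvertible := by
    refine isInvertible_of_injective fun v hv => ?_
    have hv2 : (c.prod pr) v = v 2 • (c.prod pr) (stdVec 2) + (0, pr v) := by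
      simp [c, pr]
    rw [hHd 0 h0B, ContinuousLinearMap.comp_apply, hv2, map_add, map_smul,
      ← ContinuousLinearMap.comp_apply, ← hHd 0 h0B, hVH 0 h0B, hL0, hφ'] at hv
    have hH0 : H 0 = y₀ := by
      change φ (L 0) = y₀
      rw [hL0, hφ0 _ h0W]
    rw [hH0] at hv
    have h2 : v 2 = 0 := by
      have := congrArg (fun w : E3 => w 2) hv
      simpa [pr, c, htr] using this
    rw [h2, zero_smul, zero_add, hpr v h2] at hv
    exact hv
  obtain ⟨e, he0, heB, hef, hes, -⟩ := exists_smooth_openPartialHomeomorph hB hH h0B hinv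
  have hH0 : e 0 = y₀ := by
    rw [hef]
    change φ (L 0) = y₀
    rw [hL0, hφ0 _ h0W]
  -- On the plane, `H` is the translation by `y₀`. To conclude that a point `y` of the plane is sent
  -- back to the plane, `y - y₀` has to lie in the domain of `e`; restricting to `Y` ensures this.
  let Y : Set E3 := (fun y => pr (y - y₀)) ⁻¹' e.source
  have hY : IsOpen Y := e.open_source.preimage (by fun_prop)
  have hplane : ∀ z ∈ B, z 2 = 0 → H z = y₀ + z := by
    intro z hz hz2
    have h1 : L z = (0, y₀ + z) := by simp only [L, hz2, hpr z hz2]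
    change φ (L z) = _
    rw [h1]
    exact hφ0 _ (h1 ▸ hz.1)
  have hsource : ∀ y ∈ (e.symm.restrOpen Y hY).source, y ∈ e.target ∧ pr (y - y₀) ∈ e.source :=
    fun y hy => hy
  refine ⟨e.symm.restrOpen Y hY, ⟨?_, ?_⟩, ?_, ?_, ?_, ?_, ?_⟩
  · rw [← hH0]
    exact e.map_source he0
  · change pr (y₀ - y₀) ∈ e.source
    rwa [sub_self, map_zero]
  · intro y hy
    have h1 := e.right_inv (hsource y hy).1
    rw [← h1, hef]
    exact hRU (Metric.ball_subset_ball (by linarith) (heB (e.map_target (hsource y hy).1)).2)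
  · exact fun y hy => hes y (hsource y hy).1
  · intro z hz
    have h1 : z ∈ e.source := hz.1
    have h2 : ContDiffAt ℝ ∞ e z :=
      (hH z (heB h1)).congr_of_eventuallyEq (Eventually.of_forall hef)
    exact h2
  · intro y hy
    have hyt := (hsource y hy).1
    have h1 := e.map_target hyt
    have h2 : e (e.symm y) = y := e.right_inv hyt
    have h3 : V y = fderiv ℝ H (e.symm y) (stdVec 2) := by
      rw [hVH _ (heB h1), ← hef, h2]
    have h4 : HasFDerivAt e.symm (fderiv ℝ e.symm y) (H (e.symm y)) := by
      rw [← hef, h2]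
      exact ((hes y hyt).differentiableAt (by simp)).hasFDerivAt
    have h5 := h4.comp (e.symm y) ((hH _ (heB h1)).differentiableAt (by simp)).hasFDerivAt
    have h6 : HasFDerivAt (e.symm ∘ H) (ContinuousLinearMap.id ℝ E3) (e.symm y) := by
      refine (hasFDerivAt_id _).congr_of_eventuallyEq ?_
      filter_upwards [e.open_source.mem_nhds h1] with z hz
      rw [Function.comp_apply, ← hef, e.left_inv hz, id]
    change fderiv ℝ e.symm y (V y) = _
    rw [h3]
    exact DFunLike.congr_fun (h5.unique h6) _
  · intro y hy
    obtain ⟨hyt, hyp⟩ := hsource y hy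
    have h1 := e.map_target hyt
    have h2 : e (e.symm y) = y := e.right_inv hyt
    change y 2 = 0 ↔ e.symm y 2 = 0
    constructor
    · intro hy2
      have h3 : (y - y₀) 2 = 0 := by simp [hy2, h0]
      rw [hpr _ h3] at hyp
      have h4 : e (y - y₀) = y := by
        rw [hef, hplane _ (heB hyp) h3]
        abel
      rw [← h4, e.left_inv hyp]
      exact h3
    · intro hz
      rw [← h2, hef, hplane _ (heB h1) hz]
      simp [h0, hz]

/-- Vector fields which commute and form a frame are coordinate vector fields. -/
lemma exists_coordinates_of_commuting {B : Set E3} (hBo : IsOpen B) (hBc : Convex ℝ B)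
    {a : Fin 3 → E3 → E3} (ha : ∀ i, ∀ y ∈ B, ContDiffAt ℝ ∞ (a i) y)
    (hli : ∀ y ∈ B, ∀ c : E3, c 0 • a 0 y + c 1 • a 1 y + c 2 • a 2 y = 0 → c = 0)
    (hcomm : ∀ i j, ∀ y ∈ B, VectorField.lieBracket ℝ (a i) (a j) y = 0) (y₀ : E3) :
    ∃ f : E3 → E3, f y₀ = 0 ∧ (∀ y ∈ B, ContDiffAt ℝ ∞ f y) ∧
      (∀ y ∈ B, (fderiv ℝ f y).IsInvertible) ∧
      ∀ y ∈ B, ∀ i, fderiv ℝ f y (a i y) = stdVec i := by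
  let A : E3 → E3 →L[ℝ] E3 := fun y =>
    ∑ i, (EuclideanSpace.proj i : E3 →L[ℝ] ℝ).smulRight (a i y)
  have hA : ∀ y ∈ B, ContDiffAt ℝ ∞ A y := by
    intro y hy
    refine ContDiffAt.sum fun i _ => ?_
    exact (ContinuousLinearMap.smulRightL ℝ E3 E3
      (EuclideanSpace.proj i : E3 →L[ℝ] ℝ)).contDiff.contDiffAt.comp y (ha i y hy)
  have hAv : ∀ y c, A y c = c 0 • a 0 y + c 1 • a 1 y + c 2 • a 2 y := by
    intro y c
    simp [A, Fin.sum_univ_three]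
  have hinv : ∀ y ∈ B, (A y).IsInvertible := fun y hy =>
    isInvertible_of_injective fun v hv => hli y hy v (by rw [← hAv, hv])
  -- The dual coframe, as one form with values in `E3`. Coordinates with the prescribed coordinate
  -- fields are exactly its primitives.
  let η : E3 → E3 →L[ℝ] E3 := fun y => (A y).inverse
  have hη : ∀ y ∈ B, ContDiffAt ℝ ∞ η y := by
    intro y hy
    obtain ⟨A', hA'⟩ := hinv y hy
    have h1 := contDiffAt_map_inverse (𝕜 := ℝ) (n := ∞) A'
    rw [hA'] at h1
    exact h1.comp y (hA y hy)
  have hηa : ∀ y ∈ B, ∀ i, η y (a i y) = stdVec i := by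
    intro y hy i
    have h1 : a i y = A y (stdVec i) := by
      rw [hAv]
      fin_cases i <;> simp
    rw [h1]
    exact (hinv y hy).inverse_apply_self _
  have hηd : ∀ y ∈ B, ∀ i v, fderiv ℝ η y v (a i y) = - η y (fderiv ℝ (a i) y v) := by
    intro y hy i v
    have h1 : HasFDerivAt (fun y => η y (a i y)) (0 : E3 →L[ℝ] E3) y := by
      refine (hasFDerivAt_const (stdVec i) y).congr_of_eventuallyEq ?_
      filter_upwards [hBo.mem_nhds hy] with z hz using hηa z hz i
    have h2 := h1.fderiv
    rw [fderiv_clm_apply ((hη y hy).differentiableAt (by simp))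
      ((ha i y hy).differentiableAt (by simp))] at h2
    have h3 := DFunLike.congr_fun h2 v
    simp at h3
    rw [add_eq_zero_iff_eq_neg'] at h3
    exact h3
  -- Closedness of `η`: on frame vectors the antisymmetric part of its derivative is `-η` of their
  -- bracket, which vanishes. The Poincaré lemma on the convex set `B` then applies.
  have hsymm : ∀ y ∈ B, ∀ v w, fderiv ℝ η y v w = fderiv ℝ η y w v := by
    intro y hy
    have hbas : ∀ i j, fderiv ℝ η y (a i y) (a j y) = fderiv ℝ η y (a j y) (a i y) := by
      intro i j
      have h1 := hcomm i j y hy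
      rw [VectorField.lieBracket_eq, sub_eq_zero] at h1
      rw [hηd y hy, hηd y hy, h1]
    have hspan : ∀ v : E3, ∃ c : E3, v = ∑ i, c i • a i y := by
      intro v
      refine ⟨η y v, ?_⟩
      rw [Fin.sum_univ_three, ← hAv]
      exact ((hinv y hy).self_apply_inverse _).symm
    intro v w
    obtain ⟨c, hc⟩ := hspan v
    obtain ⟨d, hd⟩ := hspan w
    rw [hc, hd]
    simp only [map_sum, map_smul, sum_apply, smul_apply]
    simp only [Finset.smul_sum]
    rw [Finset.sum_comm]
    refine Finset.sum_congr rfl fun i _ => Finset.sum_congr rfl fun j _ => ?_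
    rw [hbas, smul_comm]
  obtain ⟨f, hf⟩ := hBc.exists_forall_hasFDerivAt_of_fderiv_symmetric hBo
    (fun y hy => ((hη y hy).differentiableAt (by simp)).differentiableWithinAt) hsymm
  have hfd : ∀ y ∈ B, fderiv ℝ f y = η y := fun y hy => (hf y hy).fderiv
  have hfs : ContDiffOn ℝ ∞ f B := by
    refine (contDiffOn_infty_iff_fderiv_of_isOpen hBo).2
      ⟨fun y hy => (hf y hy).differentiableAt.differentiableWithinAt, ?_⟩
    exact ContDiffOn.congr (fun y hy => (hη y hy).contDiffWithinAt) hfd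
  have hd : ∀ y, fderiv ℝ (fun y => f y - f y₀) y = fderiv ℝ f y := fun y => fderiv_sub_const _
  refine ⟨fun y => f y - f y₀, sub_self _, fun y hy => ?_, fun y hy => ?_, fun y hy i => ?_⟩
  · exact (hfs.contDiffAt (hBo.mem_nhds hy)).sub contDiffAt_const
  · rw [hd, hfd y hy]
    obtain ⟨A', hA'⟩ := hinv y hy
    exact ⟨A'.symm, by rw [← ContinuousLinearMap.inverse_equiv, hA']⟩
  · rw [hd, hfd y hy, hηa y hy]

end CoordinateChanges
end

noncomputable section

/-! ### Metrics invariant along a unit field with a totally geodesic slice -/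

section AdaptedCoordinates

/-- Only the derivative in the direction of the segment enters. It is therefore suited to showing
that a function does not depend on certain coordinates. -/
lemma eq_of_fderiv_apply_eq_zero {E F : Type*} [NormedAddCommGroup E] [NormedSpace ℝ E]
    [NormedAddCommGroup F] [NormedSpace ℝ F] {B : Set E} (hB : Convex ℝ B) {f : E → F}
    (hf : ∀ y ∈ B, DifferentiableAt ℝ f y) {x y : E} (hx : x ∈ B) (hy : y ∈ B)
    (h0 : ∀ z ∈ B, fderiv ℝ f z (y - x) = 0) : f y = f x := by
  have hmem : ∀ t ∈ Set.Icc (0 : ℝ) 1, x + t • (y - x) ∈ B := fun t ht =>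
    hB.add_smul_sub_mem hx hy ht
  have hline : ∀ t, HasDerivAt (fun t : ℝ => x + t • (y - x)) (y - x) t := fun t => by
    simpa using ((hasDerivAt_id t).smul_const (y - x)).const_add x
  have hd : ∀ t ∈ Set.Icc (0 : ℝ) 1, HasDerivAt (fun t : ℝ => f (x + t • (y - x))) 0 t := by
    intro t ht
    have h := (hf _ (hmem t ht)).hasFDerivAt.comp_hasDerivAt t (hline t)
    rwa [h0 _ (hmem t ht)] at h
  have h1 := constant_of_has_deriv_right_zero
    (fun t ht => (hd t ht).continuousAt.continuousWithinAt)
    (fun t ht => (hd t ⟨ht.1, ht.2.le⟩).hasDerivWithinAt) 1 (by simp)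
  simpa using h1

variable {g : E3 → E3 →L[ℝ] E3 →L[ℝ] ℝ}

/-- The determinant of the metric on the planes spanned by the first two coordinate vectors. -/
def sliceDet (g : E3 → E3 →L[ℝ] E3 →L[ℝ] ℝ) (y : E3) : ℝ :=
  g y (stdVec 0) (stdVec 0) * g y (stdVec 1) (stdVec 1) - g y (stdVec 0) (stdVec 1) ^ 2

/-- The orthogonal projection of the third coordinate vector to the plane spanned by the first
two. -/
def sliceProj (g : E3 → E3 →L[ℝ] E3 →L[ℝ] ℝ) (y : E3) : E3 :=
  ((g y (stdVec 1) (stdVec 1) * g y (stdVec 2) (stdVec 0)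
      - g y (stdVec 0) (stdVec 1) * g y (stdVec 2) (stdVec 1)) / sliceDet g y) • stdVec 0
    + ((g y (stdVec 0) (stdVec 0) * g y (stdVec 2) (stdVec 1)
      - g y (stdVec 0) (stdVec 1) * g y (stdVec 2) (stdVec 0)) / sliceDet g y) • stdVec 1

/-- A vector in the plane spanned by the first two coordinate vectors which is orthogonal to
`sliceProj`. -/
def slicePerp (g : E3 → E3 →L[ℝ] E3 →L[ℝ] ℝ) (y : E3) : E3 :=
  g y (stdVec 2) (stdVec 1) • stdVec 0 - g y (stdVec 2) (stdVec 0) • stdVec 1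

/-- The unit vector in the direction of `slicePerp`. -/
def sliceUnit (g : E3 → E3 →L[ℝ] E3 →L[ℝ] ℝ) (y : E3) : E3 :=
  (√(g y (slicePerp g y) (slicePerp g y)))⁻¹ • slicePerp g y

lemma stdVec_zero_add_ne_zero {a b : ℝ} (h : a ≠ 0 ∨ b ≠ 0) :
    a • stdVec 0 + b • stdVec 1 ≠ 0 := by
  intro h0
  have h1 := congrArg (fun v : E3 => v 0) h0
  have h2 := congrArg (fun v : E3 => v 1) h0
  simp at h1 h2
  tauto

lemma sliceDet_pos {y : E3} (hsymm : ∀ a b, g y a b = g y b a) (hpos : ∀ a, a ≠ 0 → 0 < g y a a) :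
    0 < sliceDet g y := by
  have h0 : 0 < g y (stdVec 0) (stdVec 0) := hpos _ (by simp)
  have h1 := hpos ((g y (stdVec 0) (stdVec 1)) • stdVec 0 + (-g y (stdVec 0) (stdVec 0)) • stdVec 1)
    (stdVec_zero_add_ne_zero (Or.inr (neg_ne_zero.2 h0.ne')))
  simp only [map_add, map_smul, add_apply, smul_apply, smul_eq_mul,
    hsymm (stdVec 1) (stdVec 0)] at h1
  have h2 : 0 < g y (stdVec 0) (stdVec 0) * sliceDet g y := by
    rw [sliceDet]
    linarith
  exact pos_of_mul_pos_right h2 h0.le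

lemma sliceProj_apply_two (y : E3) : sliceProj g y 2 = 0 := by
  simp [sliceProj]

lemma sliceUnit_apply_two (y : E3) : sliceUnit g y 2 = 0 := by
  simp [sliceUnit, slicePerp]

lemma metric_sliceProj {y : E3} (hsymm : ∀ a b, g y a b = g y b a) (hD : sliceDet g y ≠ 0)
    {v : E3} (hv : v 2 = 0) : g y (sliceProj g y) v = g y (stdVec 2) v := by
  have h0 : g y (sliceProj g y) (stdVec 0) = g y (stdVec 2) (stdVec 0) := by
    simp only [sliceProj, map_add, map_smul, add_apply, smul_apply, smul_eq_mul,
      hsymm (stdVec 1) (stdVec 0)]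
    field_simp
    rw [sliceDet]
    ring
  have h1 : g y (sliceProj g y) (stdVec 1) = g y (stdVec 2) (stdVec 1) := by
    simp only [sliceProj, map_add, map_smul, add_apply, smul_apply, smul_eq_mul]
    field_simp
    rw [sliceDet]
    ring
  rw [eq_sum_stdVec v, hv]
  simp only [map_add, map_smul, zero_smul, add_zero, h0, h1]

lemma metric_stdVec_two_slicePerp (y : E3) : g y (stdVec 2) (slicePerp g y) = 0 := by
  simp only [slicePerp, map_sub, map_smul, smul_eq_mul]
  ring

lemma metric_sliceProj_sliceUnit {y : E3} (hsymm : ∀ a b, g y a b = g y b a)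
    (hD : sliceDet g y ≠ 0) : g y (sliceProj g y) (sliceUnit g y) = 0 := by
  rw [metric_sliceProj hsymm hD (sliceUnit_apply_two y), sliceUnit, map_smul,
    metric_stdVec_two_slicePerp, smul_zero]

lemma metric_slicePerp_pos {y : E3} (hpos : ∀ a, a ≠ 0 → 0 < g y a a)
    (hb : g y (stdVec 2) (stdVec 0) ≠ 0 ∨ g y (stdVec 2) (stdVec 1) ≠ 0) :
    0 < g y (slicePerp g y) (slicePerp g y) := by
  refine hpos _ ?_
  rw [slicePerp, sub_eq_add_neg, ← neg_smul]
  exact stdVec_zero_add_ne_zero (by simpa using hb.symm)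

lemma metric_sliceUnit_self {y : E3} (hpos : ∀ a, a ≠ 0 → 0 < g y a a)
    (hb : g y (stdVec 2) (stdVec 0) ≠ 0 ∨ g y (stdVec 2) (stdVec 1) ≠ 0) :
    g y (sliceUnit g y) (sliceUnit g y) = 1 := by
  have h := metric_slicePerp_pos hpos hb
  simp only [sliceUnit, map_smul, smul_apply, smul_eq_mul]
  rw [← mul_assoc, ← mul_inv, Real.mul_self_sqrt h.le, inv_mul_cancel₀ h.ne']

lemma metric_sliceProj_self_pos {y : E3} (hsymm : ∀ a b, g y a b = g y b a)
    (hpos : ∀ a, a ≠ 0 → 0 < g y a a)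
    (hb : g y (stdVec 2) (stdVec 0) ≠ 0 ∨ g y (stdVec 2) (stdVec 1) ≠ 0) :
    0 < g y (sliceProj g y) (sliceProj g y) := by
  have hD := (sliceDet_pos hsymm hpos).ne'
  refine hpos _ fun h0 => ?_
  have h1 := metric_sliceProj hsymm hD (v := stdVec 0) (by simp)
  have h2 := metric_sliceProj hsymm hD (v := stdVec 1) (by simp)
  rw [h0, map_zero, zero_apply] at h1 h2
  rcases hb with hb | hb
  · exact hb h1.symm
  · exact hb h2.symm

lemma contDiffAt_metric_const {y : E3} (hg : ContDiffAt ℝ ∞ g y) (v w : E3) :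
    ContDiffAt ℝ ∞ (fun z => g z v w) y :=
  (hg.clm_apply contDiffAt_const).clm_apply contDiffAt_const

lemma contDiffAt_sliceProj {y : E3} (hg : ContDiffAt ℝ ∞ g y) (hD : sliceDet g y ≠ 0) :
    ContDiffAt ℝ ∞ (sliceProj g) y := by
  have h := fun i j => contDiffAt_metric_const hg (stdVec i) (stdVec j)
  have hd : ContDiffAt ℝ ∞ (sliceDet g) y := ((h 0 0).mul (h 1 1)).sub ((h 0 1).pow 2)
  exact (((((h 1 1).mul (h 2 0)).sub ((h 0 1).mul (h 2 1))).div hd hD).smul contDiffAt_const).add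
    (((((h 0 0).mul (h 2 1)).sub ((h 0 1).mul (h 2 0))).div hd hD).smul contDiffAt_const)

lemma contDiffAt_sliceUnit {y : E3} (hg : ContDiffAt ℝ ∞ g y)
    (hQ : 0 < g y (slicePerp g y) (slicePerp g y)) : ContDiffAt ℝ ∞ (sliceUnit g) y := by
  have h := fun i j => contDiffAt_metric_const hg (stdVec i) (stdVec j)
  have hE : ContDiffAt ℝ ∞ (slicePerp g) y :=
    ((h 2 1).smul contDiffAt_const).sub ((h 2 0).smul contDiffAt_const)
  exact ((((hg.clm_apply hE).clm_apply hE).sqrt hQ.ne').inv (Real.sqrt_pos.2 hQ).ne').smul hE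

lemma fderiv_metric_apply {y : E3} (hg : DifferentiableAt ℝ g y) {a b : E3 → E3}
    (ha : DifferentiableAt ℝ a y) (hb : DifferentiableAt ℝ b y) (v : E3) :
    fderiv ℝ (fun z => g z (a z) (b z)) y v =
      fderiv ℝ g y v (a y) (b y) + g y (fderiv ℝ a y v) (b y) + g y (a y) (fderiv ℝ b y v) := by
  rw [fderiv_clm_apply (hg.clm_apply ha) hb, fderiv_clm_apply hg ha]
  simp
  ring

/-- The projection to the plane spanned by the first two coordinate vectors. -/
def slicePr : E3 →L[ℝ] E3 :=
  ContinuousLinearMap.id ℝ E3 -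
    ContinuousLinearMap.smulRight (EuclideanSpace.proj 2 : E3 →L[ℝ] ℝ) (stdVec 2)

lemma slicePr_apply (y : E3) : slicePr y = y - y 2 • stdVec 2 := rfl

lemma slicePr_apply_two (y : E3) : slicePr y 2 = 0 := by
  simp [slicePr_apply]

lemma slicePr_of_apply_two {y : E3} (hy : y 2 = 0) : slicePr y = y := by
  simp [slicePr_apply, hy]

lemma norm_slicePr_le (y : E3) : ‖slicePr y‖ ≤ ‖y‖ := by
  rw [EuclideanSpace.norm_eq, EuclideanSpace.norm_eq]
  refine Real.sqrt_le_sqrt ?_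
  simp only [Fin.sum_univ_three, slicePr_apply]
  simp
  positivity

/-- The metric `g` on `B` does not depend on the last coordinate, the last coordinate field has
length one, and the coordinate plane where the last coordinate vanishes is totally geodesic. -/
structure IsSliceMetric (g : E3 → E3 →L[ℝ] E3 →L[ℝ] ℝ) (B : Set E3) : Prop where
  isOpen : IsOpen B
  convex : Convex ℝ B
  contDiffAt : ∀ y ∈ B, ContDiffAt ℝ ∞ g y
  symm : ∀ y ∈ B, ∀ a b, g y a b = g y b a
  pos : ∀ y ∈ B, ∀ a, a ≠ 0 → 0 < g y a a
  slicePr_mem : ∀ y ∈ B, slicePr y ∈ B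
  eq_slicePr : ∀ y ∈ B, g y = g (slicePr y)
  unit : ∀ y ∈ B, g y (stdVec 2) (stdVec 2) = 1
  ne_zero : ∀ y ∈ B, g y (stdVec 2) (stdVec 0) ≠ 0 ∨ g y (stdVec 2) (stdVec 1) ≠ 0
  -- By Koszul's formula for constant fields this is `⟨∇_v w, C⟩ = 0`, where `C = stdVec 2 -
  -- sliceProj g y` is normal to the slice.
  geodesic : ∀ y ∈ B, y 2 = 0 → ∀ v w : E3, v 2 = 0 → w 2 = 0 →
    fderiv ℝ g y (stdVec 2 - sliceProj g y) v w =
      fderiv ℝ g y v (stdVec 2 - sliceProj g y) w + fderiv ℝ g y w (stdVec 2 - sliceProj g y) v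

namespace IsSliceMetric

variable {B : Set E3}

lemma fderiv_eq_comp (h : IsSliceMetric g B) {F : Type*} [NormedAddCommGroup F] [NormedSpace ℝ F]
    {f : E3 → F} (hf : ∀ y ∈ B, DifferentiableAt ℝ f y) (hinv : ∀ y ∈ B, f y = f (slicePr y))
    {y : E3} (hy : y ∈ B) : fderiv ℝ f y = (fderiv ℝ f (slicePr y)).comp slicePr := by
  have h1 : f =ᶠ[𝓝 y] f ∘ slicePr := by
    filter_upwards [h.isOpen.mem_nhds hy] with z hz using hinv z hz
  rw [h1.fderiv_eq]
  exact ((hf _ (h.slicePr_mem y hy)).hasFDerivAt.comp y slicePr.hasFDerivAt).fderiv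

lemma sliceDet_ne (h : IsSliceMetric g B) {y : E3} (hy : y ∈ B) : sliceDet g y ≠ 0 :=
  (sliceDet_pos (h.symm y hy) (h.pos y hy)).ne'

lemma contDiffAt_proj (h : IsSliceMetric g B) {y : E3} (hy : y ∈ B) :
    ContDiffAt ℝ ∞ (sliceProj g) y :=
  contDiffAt_sliceProj (h.contDiffAt y hy) (h.sliceDet_ne hy)

lemma contDiffAt_unit (h : IsSliceMetric g B) {y : E3} (hy : y ∈ B) :
    ContDiffAt ℝ ∞ (sliceUnit g) y :=
  contDiffAt_sliceUnit (h.contDiffAt y hy) (metric_slicePerp_pos (h.pos y hy) (h.ne_zero y hy))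

lemma differentiableAt (h : IsSliceMetric g B) {y : E3} (hy : y ∈ B) : DifferentiableAt ℝ g y :=
  (h.contDiffAt y hy).differentiableAt (by simp)

lemma differentiableAt_proj (h : IsSliceMetric g B) {y : E3} (hy : y ∈ B) :
    DifferentiableAt ℝ (sliceProj g) y := (h.contDiffAt_proj hy).differentiableAt (by simp)

lemma differentiableAt_unit (h : IsSliceMetric g B) {y : E3} (hy : y ∈ B) :
    DifferentiableAt ℝ (sliceUnit g) y := (h.contDiffAt_unit hy).differentiableAt (by simp)

lemma proj_eq_slicePr (h : IsSliceMetric g B) {y : E3} (hy : y ∈ B) :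
    sliceProj g y = sliceProj g (slicePr y) := by
  simp only [sliceProj, sliceDet, ← h.eq_slicePr y hy]

lemma unit_eq_slicePr (h : IsSliceMetric g B) {y : E3} (hy : y ∈ B) :
    sliceUnit g y = sliceUnit g (slicePr y) := by
  simp only [sliceUnit, slicePerp, ← h.eq_slicePr y hy]

lemma slicePr_stdVec_two : slicePr (stdVec 2) = 0 := by
  simp [slicePr_apply]

lemma fderiv_proj_stdVec_two (h : IsSliceMetric g B) {y : E3} (hy : y ∈ B) :
    fderiv ℝ (sliceProj g) y (stdVec 2) = 0 := by
  rw [h.fderiv_eq_comp (fun y hy => h.differentiableAt_proj hy) (fun y hy => h.proj_eq_slicePr hy)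
    hy, ContinuousLinearMap.comp_apply, slicePr_stdVec_two, map_zero]

lemma fderiv_unit_stdVec_two (h : IsSliceMetric g B) {y : E3} (hy : y ∈ B) :
    fderiv ℝ (sliceUnit g) y (stdVec 2) = 0 := by
  rw [h.fderiv_eq_comp (fun y hy => h.differentiableAt_unit hy) (fun y hy => h.unit_eq_slicePr hy)
    hy, ContinuousLinearMap.comp_apply, slicePr_stdVec_two, map_zero]

lemma fderiv_metric_stdVec_two (h : IsSliceMetric g B) {y : E3} (hy : y ∈ B) :
    fderiv ℝ g y (stdVec 2) = 0 := by
  rw [h.fderiv_eq_comp (fun y hy => h.differentiableAt hy) h.eq_slicePr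
    hy, ContinuousLinearMap.comp_apply, slicePr_stdVec_two, map_zero]

lemma metric_proj (h : IsSliceMetric g B) {y : E3} (hy : y ∈ B) {v : E3} (hv : v 2 = 0) :
    g y (sliceProj g y) v = g y (stdVec 2) v :=
  metric_sliceProj (h.symm y hy) (h.sliceDet_ne hy) hv

/-- This is the Killing equation of the slice for the tangential part `T` of the Killing field
`stdVec 2`. The normal part contributes only the second fundamental form, which is zero. -/
lemma killing_proj_of_slice (h : IsSliceMetric g B) {y : E3} (hy : y ∈ B) (hy2 : y 2 = 0)
    {v w : E3} (hv : v 2 = 0) (hw : w 2 = 0) :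
    fderiv ℝ g y (sliceProj g y) v w + g y (fderiv ℝ (sliceProj g) y v) w
      + g y (fderiv ℝ (sliceProj g) y w) v = 0 := by
  -- Differentiate `g(C, w) = 0` along `v`; the derivative of `C = stdVec 2 - T` is minus that of
  -- `T`.
  have key : ∀ v w : E3, w 2 = 0 → fderiv ℝ g y v (stdVec 2 - sliceProj g y) w =
      g y (fderiv ℝ (sliceProj g) y v) w := by
    intro v w hw
    have h1 : (fun z => g z (stdVec 2 - sliceProj g z) w) =ᶠ[𝓝 y] fun _ => 0 := by
      filter_upwards [h.isOpen.mem_nhds hy] with z hz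
      rw [map_sub, sub_apply, h.metric_proj hz hw, sub_self]
    have h2 := fderiv_metric_apply (h.differentiableAt hy)
      ((h.differentiableAt_proj hy).const_sub (stdVec 2)) (differentiableAt_const w) v
    rw [h1.fderiv_eq, fderiv_fun_const, fderiv_const_sub, fderiv_fun_const] at h2
    simp only [Pi.zero_apply, zero_apply, neg_apply, map_neg, map_zero, add_zero] at h2
    linarith
  have h1 := h.geodesic y hy hy2 v w hv hw
  rw [key v w hw, key w v hv, map_sub, h.fderiv_metric_stdVec_two hy] at h1
  simp only [sub_apply, zero_apply] at h1
  linarith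

/-- Neither `g` nor `T` depends on the last coordinate, so the equation spreads from the slice to
`B`. -/
lemma killing_proj (h : IsSliceMetric g B) {y : E3} (hy : y ∈ B)
    {v w : E3} (hv : v 2 = 0) (hw : w 2 = 0) :
    fderiv ℝ g y (sliceProj g y) v w + g y (fderiv ℝ (sliceProj g) y v) w
      + g y (fderiv ℝ (sliceProj g) y w) v = 0 := by
  have h1 := h.killing_proj_of_slice (h.slicePr_mem y hy) (slicePr_apply_two y) hv hw
  rw [h.fderiv_eq_comp (fun y hy => h.differentiableAt hy) h.eq_slicePr hy,
    h.fderiv_eq_comp (fun y hy => h.differentiableAt_proj hy) (fun y hy => h.proj_eq_slicePr hy)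
    hy, h.eq_slicePr y hy, h.proj_eq_slicePr hy]
  simp only [ContinuousLinearMap.comp_apply, slicePr_of_apply_two hv, slicePr_of_apply_two hw,
    slicePr_of_apply_two (sliceProj_apply_two _)]
  exact h1

lemma fderiv_apply_two_eq_zero {f : E3 → E3} {y : E3} (hf : DifferentiableAt ℝ f y)
    (h0 : ∀ z, f z 2 = 0) (v : E3) : fderiv ℝ f y v 2 = 0 := by
  have h1 := (EuclideanSpace.proj 2 : E3 →L[ℝ] ℝ).hasFDerivAt.comp y hf.hasFDerivAt
  have h2 : (⇑(EuclideanSpace.proj 2 : E3 →L[ℝ] ℝ) ∘ f) = fun _ => 0 := funext h0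
  rw [h2] at h1
  exact DFunLike.congr_fun (h1.unique (hasFDerivAt_const 0 y)) v

lemma eq_zero_of_orthogonal (h : IsSliceMetric g B) {y : E3} (hy : y ∈ B) {w : E3} (h2 : w 2 = 0)
    (hT : g y (sliceProj g y) w = 0) (hE : g y w (sliceUnit g y) = 0) : w = 0 := by
  have hQ := metric_slicePerp_pos (h.pos y hy) (h.ne_zero y hy)
  rw [h.metric_proj hy h2, eq_sum_stdVec w, h2] at hT
  simp only [map_add, map_smul, zero_smul, add_zero, smul_eq_mul] at hT
  have hk : ∃ k : ℝ, w = k • slicePerp g y := by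
    rcases h.ne_zero y hy with hb | hb
    · refine ⟨-w 1 / g y (stdVec 2) (stdVec 0), ?_⟩
      conv_lhs => rw [eq_sum_stdVec w, h2]
      rw [slicePerp, smul_sub, smul_smul, smul_smul, zero_smul, add_zero, sub_eq_add_neg,
        ← neg_smul]
      congr 2 <;> field_simp
      linarith
    · refine ⟨w 0 / g y (stdVec 2) (stdVec 1), ?_⟩
      conv_lhs => rw [eq_sum_stdVec w, h2]
      rw [slicePerp, smul_sub, smul_smul, smul_smul, zero_smul, add_zero, sub_eq_add_neg,
        ← neg_smul]
      congr 2 <;> field_simp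
      linarith
  obtain ⟨k, rfl⟩ := hk
  rw [sliceUnit] at hE
  simp only [map_smul, smul_apply, smul_eq_mul] at hE
  have h3 : (√(g y (slicePerp g y) (slicePerp g y)))⁻¹ ≠ 0 := (inv_pos.2 (Real.sqrt_pos.2 hQ)).ne'
  have h4 : k = 0 := by
    rcases mul_eq_zero.1 hE with h5 | h5
    · exact absurd h5 h3
    · exact (mul_eq_zero.1 h5).resolve_right hQ.ne'
  rw [h4, zero_smul]

/-- This is `[T, E] = 0`: a Killing field `T` of the slice preserves itself, hence also the unit
field `E` orthogonal to it. The bracket is shown to be orthogonal to both `T` and `E`, by pairing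
the Killing equation with the derivatives of `g(E, E) = 1` and `g(T, E) = 0` along `T`. -/
lemma fderiv_proj_unit (h : IsSliceMetric g B) {y : E3} (hy : y ∈ B) :
    fderiv ℝ (sliceProj g) y (sliceUnit g y) = fderiv ℝ (sliceUnit g) y (sliceProj g y) := by
  have hT2 := sliceProj_apply_two (g := g) y
  have hE2 := sliceUnit_apply_two (g := g) y
  have hs := h.symm y hy
  have dT := h.differentiableAt_proj hy
  have dE := h.differentiableAt_unit hy
  have hn := h.isOpen.mem_nhds hy
  have e1 := fderiv_metric_apply (h.differentiableAt hy) dE dE (sliceProj g y)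
  have e2 := fderiv_metric_apply (h.differentiableAt hy) dT dE (sliceProj g y)
  have h1 : (fun z => g z (sliceUnit g z) (sliceUnit g z)) =ᶠ[𝓝 y] fun _ => 1 := by
    filter_upwards [hn] with z hz using metric_sliceUnit_self (h.pos z hz) (h.ne_zero z hz)
  have h2 : (fun z => g z (sliceProj g z) (sliceUnit g z)) =ᶠ[𝓝 y] fun _ => 0 := by
    filter_upwards [hn] with z hz using metric_sliceProj_sliceUnit (h.symm z hz) (h.sliceDet_ne hz)
  rw [h1.fderiv_eq, fderiv_fun_const] at e1
  rw [h2.fderiv_eq, fderiv_fun_const] at e2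
  have k1 := h.killing_proj hy hE2 hE2
  have k2 := h.killing_proj hy hT2 hE2
  simp only [Pi.zero_apply, zero_apply] at e1 e2
  refine sub_eq_zero.1 (h.eq_zero_of_orthogonal hy ?_ ?_ ?_)
  · rw [PiLp.sub_apply, fderiv_apply_two_eq_zero dT sliceProj_apply_two,
      fderiv_apply_two_eq_zero dE sliceUnit_apply_two, sub_zero]
  · rw [map_sub]
    rw [hs (fderiv ℝ (sliceProj g) y (sliceUnit g y)) (sliceProj g y)] at k2
    linarith
  · rw [map_sub, sub_apply]
    rw [hs (sliceUnit g y)] at e1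
    linarith

/-- The Killing equation evaluated on the pair `(T, T)`. -/
lemma fderiv_normSq (h : IsSliceMetric g B) {y : E3} (hy : y ∈ B) :
    fderiv ℝ (fun z => g z (sliceProj g z) (sliceProj g z)) y (sliceProj g y) = 0 := by
  have hT2 := sliceProj_apply_two (g := g) y
  have dT := h.differentiableAt_proj hy
  have k := h.killing_proj hy hT2 hT2
  rw [fderiv_metric_apply (h.differentiableAt hy) dT dT, h.symm y hy (sliceProj g y)]
  exact k

lemma fderiv_normSq_stdVec_two (h : IsSliceMetric g B) {y : E3} (hy : y ∈ B) :
    fderiv ℝ (fun z => g z (sliceProj g z) (sliceProj g z)) y (stdVec 2) = 0 := by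
  have dT := h.differentiableAt_proj hy
  rw [fderiv_metric_apply (h.differentiableAt hy) dT dT, h.fderiv_metric_stdVec_two hy,
    h.fderiv_proj_stdVec_two hy]
  simp

end IsSliceMetric

end AdaptedCoordinates
end

noncomputable section

/-! ### The commuting orthogonal frame and its coordinates -/

section AdaptedCoordinates

variable {g : E3 → E3 →L[ℝ] E3 →L[ℝ] ℝ}

/-- An orthogonal frame adapted to a slice metric. -/
def sliceFrame (g : E3 → E3 →L[ℝ] E3 →L[ℝ] ℝ) : Fin 3 → E3 → E3 :=
  ![sliceUnit g, sliceProj g, fun y => stdVec 2 - sliceProj g y]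

namespace IsSliceMetric

variable {B : Set E3}

lemma contDiffAt_frame (h : IsSliceMetric g B) (i : Fin 3) {y : E3} (hy : y ∈ B) :
    ContDiffAt ℝ ∞ (sliceFrame g i) y := by
  fin_cases i
  · exact h.contDiffAt_unit hy
  · exact h.contDiffAt_proj hy
  · exact contDiffAt_const.sub (h.contDiffAt_proj hy)

lemma lieBracket_frame (h : IsSliceMetric g B) (i j : Fin 3) {y : E3} (hy : y ∈ B) :
    VectorField.lieBracket ℝ (sliceFrame g i) (sliceFrame g j) y = 0 := by
  have d2 : fderiv ℝ (fun y => stdVec 2 - sliceProj g y) y = -fderiv ℝ (sliceProj g) y :=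
    fderiv_const_sub _
  have e1 := h.fderiv_proj_unit hy
  have e2 := h.fderiv_proj_stdVec_two hy
  have e3 := h.fderiv_unit_stdVec_two hy
  rw [VectorField.lieBracket]
  fin_cases i <;> fin_cases j <;>
    simp [sliceFrame, d2, e1, e2, e3]

/-- The frame is orthogonal, and Pythagoras for the unit vector `stdVec 2 = T + C` gives `|C|² = 1 -
|T|²`. This is the origin of the coefficients `r` and `1 - r`. -/
lemma metric_frame (h : IsSliceMetric g B) {y : E3} (hy : y ∈ B) (v w : E3) :
    g y (v 0 • sliceFrame g 0 y + v 1 • sliceFrame g 1 y + v 2 • sliceFrame g 2 y)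
      (w 0 • sliceFrame g 0 y + w 1 • sliceFrame g 1 y + w 2 • sliceFrame g 2 y) =
    v 0 * w 0 + g y (sliceProj g y) (sliceProj g y) * (v 1 * w 1) +
      (1 - g y (sliceProj g y) (sliceProj g y)) * (v 2 * w 2) := by
  have hs := h.symm y hy
  have hEE := metric_sliceUnit_self (h.pos y hy) (h.ne_zero y hy)
  have hTE := metric_sliceProj_sliceUnit hs (h.sliceDet_ne hy)
  have h2E := h.metric_proj hy (sliceUnit_apply_two (g := g) y)
  have h2T := h.metric_proj hy (sliceProj_apply_two (g := g) y)
  have hu := h.unit y hy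
  simp only [sliceFrame, Matrix.cons_val_zero, Matrix.cons_val_one, Matrix.cons_val, map_add,
    map_smul, add_apply, smul_apply, smul_eq_mul, map_sub, sub_apply, hEE, hTE,
    hs (sliceUnit g y) (sliceProj g y), ← h2E, ← h2T, hu, hs (sliceUnit g y) (stdVec 2),
    hs (sliceProj g y) (stdVec 2)]
  ring

lemma normSq_pos (h : IsSliceMetric g B) {y : E3} (hy : y ∈ B) :
    0 < g y (sliceProj g y) (sliceProj g y) :=
  metric_sliceProj_self_pos (h.symm y hy) (h.pos y hy) (h.ne_zero y hy)

lemma normSq_lt_one (h : IsSliceMetric g B) {y : E3} (hy : y ∈ B) :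
    g y (sliceProj g y) (sliceProj g y) < 1 := by
  have h1 := h.pos y hy (stdVec 2 - sliceProj g y) (fun h0 => by
    have := congrArg (fun v : E3 => v 2) h0
    simp [sliceProj_apply_two] at this)
  have h2T := h.metric_proj hy (sliceProj_apply_two (g := g) y)
  simp only [map_sub, sub_apply, h.unit y hy, h.symm y hy (sliceProj g y) (stdVec 2), ← h2T] at h1
  linarith

lemma frame_independent (h : IsSliceMetric g B) {y : E3} (hy : y ∈ B) (c : E3)
    (hc : c 0 • sliceFrame g 0 y + c 1 • sliceFrame g 1 y + c 2 • sliceFrame g 2 y = 0) :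
    c = 0 := by
  have h1 := h.metric_frame hy c c
  rw [hc, map_zero] at h1
  have h2 := h.normSq_pos hy
  have h3 := h.normSq_lt_one hy
  have p0 := mul_self_nonneg (c 0)
  have p1 := mul_nonneg h2.le (mul_self_nonneg (c 1))
  have p2 := mul_nonneg (sub_nonneg.2 h3.le) (mul_self_nonneg (c 2))
  have q0 : c 0 = 0 := mul_self_eq_zero.1 (by linarith)
  have q1 : c 1 = 0 := mul_self_eq_zero.1
    ((mul_eq_zero.1 (by linarith : g y (sliceProj g y) (sliceProj g y) * (c 1 * c 1) = 0)).resolve_left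
      h2.ne')
  have q2 : c 2 = 0 := mul_self_eq_zero.1
    ((mul_eq_zero.1 (by linarith : (1 - g y (sliceProj g y) (sliceProj g y)) * (c 2 * c 2) = 0)).resolve_left
      (sub_pos.2 h3).ne')
  rw [eq_sum_stdVec c, q0, q1, q2]
  simp

end IsSliceMetric

/-- The open cube with centre zero and half side `δ`. -/
def cube (δ : ℝ) : Set E3 := {z | ∀ i, |z i| < δ}

lemma isOpen_cube (δ : ℝ) : IsOpen (cube δ) := by
  simp only [cube, Set.ofPred_forall]
  exact isOpen_iInter_of_finite fun i =>
    isOpen_lt (continuous_abs.comp (EuclideanSpace.proj i : E3 →L[ℝ] ℝ).continuous)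
      continuous_const

lemma convex_cube (δ : ℝ) : Convex ℝ (cube δ) := by
  intro x hx y hy a b ha hb hab i
  have h1 : |(a • x + b • y) i| ≤ a * |x i| + b * |y i| := by
    simp only [PiLp.add_apply, PiLp.smul_apply, smul_eq_mul]
    refine (abs_add_le _ _).trans ?_
    rw [abs_mul, abs_mul, abs_of_nonneg ha, abs_of_nonneg hb]
  refine h1.trans_lt ?_
  have hx' := hx i
  have hy' := hy i
  rcases ha.eq_or_lt with rfl | ha
  · rw [zero_add] at hab
    subst hab
    simpa using hy'
  · calc a * |x i| + b * |y i| < a * δ + b * δ :=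
          add_lt_add_of_lt_of_le (mul_lt_mul_of_pos_left hx' ha)
            (mul_le_mul_of_nonneg_left hy'.le hb)
      _ = δ := by rw [← add_mul, hab, one_mul]

lemma zero_mem_cube {δ : ℝ} (hδ : 0 < δ) : (0 : E3) ∈ cube δ := fun i => by simpa using hδ

lemma exists_cube_subset {W : Set E3} (hW : W ∈ 𝓝 (0 : E3)) : ∃ δ > 0, cube δ ⊆ W := by
  obtain ⟨ε, hε, hW⟩ := Metric.mem_nhds_iff.1 hW
  refine ⟨ε / 3, by positivity, fun z hz => hW ?_⟩
  rw [mem_ball_zero_iff, eq_sum_stdVec z]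
  have h1 : ∀ i, ‖z i • stdVec i‖ < ε / 3 := fun i => by
    rw [norm_smul]
    simpa using hz i
  calc _ ≤ ‖z 0 • stdVec 0‖ + ‖z 1 • stdVec 1‖ + ‖z 2 • stdVec 2‖ := norm_add₃_le
    _ < ε := by linarith [h1 0, h1 1, h1 2]

/-- The new coordinates straighten the commuting frame `E`, `T`, `C`. The target is a cube so that
every point can be joined inside it to the first axis within a level of the first coordinate; this
makes `|T|²` a function of one variable. -/
lemma IsSliceMetric.exists_coordinates {B : Set E3} (h : IsSliceMetric g B) {y₀ : E3} (hy₀ : y₀ ∈ B)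
    (hy2 : y₀ 2 = 0) :
    ∃ (e : OpenPartialHomeomorph E3 E3) (δ : ℝ) (r : ℝ → ℝ), 0 < δ ∧
      y₀ ∈ e.source ∧ e.source ⊆ B ∧ e y₀ = 0 ∧ e.target = cube δ ∧
      (∀ y ∈ e.source, ContDiffAt ℝ ∞ e y) ∧ (∀ y ∈ e.target, ContDiffAt ℝ ∞ e.symm y) ∧
      (∀ s, |s| < δ → ContDiffAt ℝ ∞ r s ∧ 0 < r s ∧ r s < 1) ∧
      (∀ y ∈ e.source, fderiv ℝ e y (stdVec 2) = stdVec 1 + stdVec 2) ∧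
      (∀ y ∈ e.source, e y 2 = y 2) ∧
      ∀ y ∈ e.source, ∀ v w, g y v w = fderiv ℝ e y v 0 * fderiv ℝ e y w 0 +
        r (e y 0) * (fderiv ℝ e y v 1 * fderiv ℝ e y w 1) +
        (1 - r (e y 0)) * (fderiv ℝ e y v 2 * fderiv ℝ e y w 2) := by
  obtain ⟨f, hf0, hf, hfi, hfa⟩ := exists_coordinates_of_commuting h.isOpen h.convex
    (fun i y hy => h.contDiffAt_frame i hy) (fun y hy => h.frame_independent hy)
    (fun i j y hy => h.lieBracket_frame i j hy) y₀
  obtain ⟨e₀, he₀, heB, hef, hes, -⟩ :=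
    exists_smooth_openPartialHomeomorph h.isOpen hf hy₀ (hfi y₀ hy₀)
  have h0t : (0 : E3) ∈ e₀.target := by
    rw [← hf0, ← hef]
    exact e₀.map_source he₀
  obtain ⟨δ, hδ, hδt⟩ := exists_cube_subset (e₀.open_target.mem_nhds h0t)
  let e := (e₀.symm.restrOpen (cube δ) (isOpen_cube δ)).symm
  have htar : e.target = cube δ := by
    change e₀.target ∩ cube δ = _
    exact Set.inter_eq_right.2 hδt
  have hsub : e.source ⊆ e₀.source := fun y hy => by
    have h1 : y ∈ e₀.source ∩ e₀ ⁻¹' (cube δ) := by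
      simpa [e] using hy
    exact h1.1
  have hefn : (e : E3 → E3) = f := funext hef
  have hsymm : (e.symm : E3 → E3) = e₀.symm := rfl
  have hsrc : ∀ y ∈ e.source, y ∈ B := fun y hy => heB (hsub hy)
  have hes' : ∀ y ∈ e.target, ContDiffAt ℝ ∞ e.symm y := by
    intro y hy
    rw [hsymm]
    exact hes y (hδt (htar ▸ hy))
  have hy₀e : y₀ ∈ e.source := by
    have h1 := e.map_target (x := 0) (by rw [htar]; exact zero_mem_cube hδ)
    have h2 : e.symm 0 = y₀ := by
      rw [hsymm, ← hf0, ← hef]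
      exact e₀.left_inv he₀
    rwa [h2] at h1
  let ρ : E3 → ℝ := fun y => g y (sliceProj g y) (sliceProj g y)
  have hρ : ∀ y ∈ B, ContDiffAt ℝ ∞ ρ y := fun y hy =>
    ((h.contDiffAt y hy).clm_apply (h.contDiffAt_proj hy)).clm_apply (h.contDiffAt_proj hy)
  have hst : ∀ z ∈ e.target, e.symm z ∈ B := fun z hz => hsrc _ (e.map_target hz)
  have hsd : ∀ z ∈ e.target, ∀ i, fderiv ℝ e.symm z (stdVec i) = sliceFrame g i (e.symm z) := by
    intro z hz i
    have d1 := ((hf _ (hst z hz)).differentiableAt (by simp)).hasFDerivAt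
    have d2 := ((hes' z hz).differentiableAt (by simp)).hasFDerivAt
    have d3 : HasFDerivAt (f ∘ e.symm) (ContinuousLinearMap.id ℝ E3) z := by
      refine (hasFDerivAt_id _).congr_of_eventuallyEq ?_
      filter_upwards [e.open_target.mem_nhds hz] with w hw
      rw [Function.comp_apply, ← hefn, e.right_inv hw, id]
    have d4 := DFunLike.congr_fun ((d1.comp z d2).unique d3) (stdVec i)
    have d5 : fderiv ℝ f (e.symm z) (fderiv ℝ e.symm z (stdVec i)) =
        fderiv ℝ f (e.symm z) (sliceFrame g i (e.symm z)) := by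
      rw [hfa _ (hst z hz)]
      exact d4
    exact (hfi _ (hst z hz)).injective d5
  have hline : ∀ s, |s| < δ → s • stdVec 0 ∈ e.target := by
    intro s hs
    rw [htar]
    intro i
    fin_cases i <;> simp [hs, hδ]
  refine ⟨e, δ, fun s => ρ (e.symm (s • stdVec 0)), hδ, hy₀e, hsrc, by rw [hefn, hf0], htar,
    fun y hy => by rw [hefn]; exact hf y (hsrc y hy), hes', ?_, ?_, ?_, ?_⟩
  · intro s hs
    refine ⟨?_, h.normSq_pos (hst _ (hline s hs)), h.normSq_lt_one (hst _ (hline s hs))⟩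
    have hl : ContDiffAt ℝ ∞ (fun s : ℝ => s • stdVec 0) s := contDiffAt_id.smul contDiffAt_const
    exact (hρ _ (hst _ (hline s hs))).comp s ((hes' _ (hline s hs)).comp s hl)
  · intro y hy
    have h1 : stdVec 2 = sliceFrame g 1 y + sliceFrame g 2 y := by simp [sliceFrame]
    conv_lhs => rw [h1, map_add, hefn, hfa y (hsrc y hy), hfa y (hsrc y hy)]
  · intro y hy
    -- Both `f · 2` and the old last coordinate have differential `0`, `0`, `1` on `E`, `T`, `C`,
    -- and both vanish at `y₀`. So the surface remains a coordinate plane.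
    have h1 := eq_of_fderiv_apply_eq_zero h.convex (f := fun y => f y 2 - y 2) (x := y₀) (y := y)
      (fun y hy => ?_) hy₀ (hsrc y hy) ?_
    · rw [hf0, hy2] at h1
      rw [hefn]
      simpa [sub_eq_zero] using h1
    · have d1 := (EuclideanSpace.proj 2 : E3 →L[ℝ] ℝ).hasFDerivAt.comp y
        ((hf y hy).differentiableAt (by simp)).hasFDerivAt
      exact (d1.sub (EuclideanSpace.proj 2 : E3 →L[ℝ] ℝ).hasFDerivAt).differentiableAt
    · intro z hz
      have d1 := (EuclideanSpace.proj 2 : E3 →L[ℝ] ℝ).hasFDerivAt.comp z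
        ((hf z hz).differentiableAt (by simp)).hasFDerivAt
      have d2 := d1.sub (EuclideanSpace.proj 2 : E3 →L[ℝ] ℝ).hasFDerivAt
      have d3 : fderiv ℝ (fun y => f y 2 - y 2) z = _ := d2.fderiv
      rw [d3]
      generalize y - y₀ = v
      obtain ⟨c, hc⟩ : ∃ c : E3, v = c 0 • sliceFrame g 0 z + c 1 • sliceFrame g 1 z +
          c 2 • sliceFrame g 2 z := by
        refine ⟨fderiv ℝ f z v, (hfi z hz).injective ?_⟩
        simp only [map_add, map_smul, hfa z hz]
        exact eq_sum_stdVec _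
      rw [hc]
      simp only [map_add, map_smul, sub_apply, ContinuousLinearMap.comp_apply, hfa z hz]
      simp [sliceFrame, sliceUnit_apply_two, sliceProj_apply_two]
  · intro y hy v w
    have hyB := hsrc y hy
    -- `ρ = |T|²` is constant along `T` and along `stdVec 2`, hence along `C`: it depends only on
    -- the first new coordinate.
    have hr : ρ (e.symm (e y 0 • stdVec 0)) = ρ y := by
      have hz : e y ∈ e.target := e.map_source hy
      have hz0 : |e y 0| < δ := by
        rw [htar] at hz
        exact hz 0
      have h1 := eq_of_fderiv_apply_eq_zero (convex_cube δ) (f := fun z => ρ (e.symm z))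
        (x := e y) (y := e y 0 • stdVec 0) (fun z hz => ?_) (htar ▸ hz)
        (htar ▸ hline _ hz0) ?_
      · rw [h1, e.left_inv hy]
      · rw [← htar] at hz
        exact ((hρ _ (hst z hz)).differentiableAt (by simp)).comp z
          ((hes' z hz).differentiableAt (by simp))
      · intro z hz
        rw [← htar] at hz
        have d1 := ((hρ _ (hst z hz)).differentiableAt (by simp)).hasFDerivAt.comp z
          ((hes' z hz).differentiableAt (by simp)).hasFDerivAt
        have d3 : fderiv ℝ (fun z => ρ (e.symm z)) z = _ := d1.fderiv
        have h4 : e y 0 • stdVec 0 - e y = (-e y 1) • stdVec 1 + (-e y 2) • stdVec 2 := by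
          conv_lhs => rw [eq_sum_stdVec (e y)]
          simp
          module
        have h5 := h.fderiv_normSq (hst z hz)
        have h6 := h.fderiv_normSq_stdVec_two (hst z hz)
        rw [d3, h4]
        simp only [map_add, map_smul, ContinuousLinearMap.comp_apply, hsd z hz, sliceFrame,
          Matrix.cons_val_one, Matrix.cons_val, map_sub, ρ, Matrix.cons_val_zero]
        rw [h5, h6]
        simp
    beta_reduce
    rw [hr, hefn]
    have hv : ∀ v, v = fderiv ℝ f y v 0 • sliceFrame g 0 y + fderiv ℝ f y v 1 • sliceFrame g 1 y +
        fderiv ℝ f y v 2 • sliceFrame g 2 y := by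
      intro v
      refine (hfi y hyB).injective ?_
      simp only [map_add, map_smul, hfa y hyB]
      exact eq_sum_stdVec _
    conv_lhs => rw [hv v, hv w]
    exact h.metric_frame hyB _ _

end AdaptedCoordinates
end

noncomputable section

/-! ### From the manifold to the slice metric: existence of adapted charts -/

section AdaptedChart

variable {M : Type*} [TopologicalSpace M] [ChartedSpace E3 M] [IsManifold (𝓡 3) ∞ M]
variable {Ψ Φ : OpenPartialHomeomorph M E3} {q p : M} {ξ : ∀ x : M, TangentSpace (𝓡 3) x} {S : Set M}

lemma contDiffAt_coord (i : Fin 3) (y : E3) : ContDiffAt ℝ ∞ (fun z : E3 => z i) y :=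
  (EuclideanSpace.proj i : E3 →L[ℝ] ℝ).contDiff.contDiffAt

lemma fderiv_coord (i : Fin 3) (y v : E3) : fderiv ℝ (fun z : E3 => z i) y v = v i :=
  DFunLike.congr_fun (EuclideanSpace.proj i : E3 →L[ℝ] ℝ).hasFDerivAt.fderiv v

lemma mvfderiv_chart_coord (hΨ : Ψ ∈ IsManifold.maximalAtlas (𝓡 3) ∞ M) (hq : q ∈ Ψ.source)
    (i : Fin 3) (v : TangentSpace (𝓡 3) q) :
    mvfderiv (𝓡 3) (fun x => Ψ x i) q v = mvfderiv (𝓡 3) Ψ q v i := by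
  rw [mvfderiv_comp_chart hΨ hq (h := fun z : E3 => z i) (Eventually.of_forall fun x => rfl)
    ((contDiffAt_coord i _).differentiableAt (by simp)), fderiv_coord]

/-- In one direction, test with the coordinate function itself. In the other, a function vanishing
on `S` vanishes along the coordinate line through `Ψ q` with velocity `w`, which stays in the plane.
-/
lemma mem_tangentPlane_iff (hΨ : Ψ ∈ IsManifold.maximalAtlas (𝓡 3) ∞ M) (hq : q ∈ Ψ.source)
    {i : Fin 3} (hS : ∀ᶠ x in 𝓝 q, x ∈ S ↔ Ψ x i = 0) (h0 : Ψ q i = 0)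
    (v : TangentSpace (𝓡 3) q) : v ∈ tangentPlane S q ↔ mvfderiv (𝓡 3) Ψ q v i = 0 := by
  constructor
  · intro h
    rw [← mvfderiv_chart_coord hΨ hq]
    refine h _ (contMDiffAt_comp_chart hΨ hq (contDiffAt_coord i _)) ?_
    filter_upwards [hS] with x hx using hx.1
  · intro hv f hf hf0
    rw [mvfderiv_eq_fderiv_chart hΨ hq hf]
    set w := mvfderiv (𝓡 3) Ψ q v
    have h1 := ((contDiffAt_comp_symm hΨ hq hf).differentiableAt (by simp)).hasFDerivAt
    have hline : HasDerivAt (fun t : ℝ => Ψ q + t • w) w 0 := by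
      simpa using ((hasDerivAt_id (0 : ℝ)).smul_const w).const_add (Ψ q)
    rw [show Ψ q = Ψ q + (0 : ℝ) • w by simp] at h1
    have h2 := h1.comp_hasDerivAt 0 hline
    have hc : ContinuousAt (fun t : ℝ => Ψ.symm (Ψ q + t • w)) 0 := by
      refine ContinuousAt.comp (g := Ψ.symm) ?_ hline.continuousAt
      simpa using Ψ.continuousAt_symm (Ψ.map_source hq)
    have ht : ∀ᶠ t : ℝ in 𝓝 0, Ψ q + t • w ∈ Ψ.target :=
      hline.continuousAt.eventually_mem (by simpa using Ψ.open_target.mem_nhds (Ψ.map_source hq))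
    have hq' : Ψ.symm (Ψ q + (0 : ℝ) • w) = q := by simp [Ψ.left_inv hq]
    rw [ContinuousAt, hq'] at hc
    have h3 : ((f ∘ Ψ.symm) ∘ fun t : ℝ => Ψ q + t • w) =ᶠ[𝓝 0] fun _ => 0 := by
      filter_upwards [hc.eventually hf0, hc.eventually hS, ht] with t h4 h5 h6
      refine h4 (h5.2 ?_)
      rw [Ψ.right_inv h6]
      simp [h0, hv]
    have h7 := (h3.hasDerivAt_iff.1 h2).unique (hasDerivAt_const 0 0)
    simpa using h7

lemma chart_trans_mem (hΦ : Φ ∈ IsManifold.maximalAtlas (𝓡 3) ∞ M)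
    {e : OpenPartialHomeomorph E3 E3} (he : ∀ y ∈ e.source, ContDiffAt ℝ ∞ e y)
    (hes : ∀ y ∈ e.target, ContDiffAt ℝ ∞ e.symm y) :
    Φ.trans e ∈ IsManifold.maximalAtlas (𝓡 3) ∞ M := by
  refine OpenPartialHomeomorph.mem_maximalAtlas_of_contMDiffOn _ (fun x hx => ?_) fun y hy => ?_
  · rw [OpenPartialHomeomorph.trans_source] at hx
    exact (contMDiffAt_comp_chart hΦ hx.1 (he _ hx.2)).contMDiffWithinAt
  · rw [OpenPartialHomeomorph.trans_target] at hy
    exact (ContMDiffAt.comp (I' := 𝓘(ℝ, E3)) y (contMDiffAt_symm_of_mem_maximalAtlas hΦ hy.2)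
      (hes y hy.1).contMDiffAt).contMDiffWithinAt

lemma mvfderiv_chart_trans (hΦ : Φ ∈ IsManifold.maximalAtlas (𝓡 3) ∞ M)
    {e : OpenPartialHomeomorph E3 E3} (hq : q ∈ Φ.source) (he : ContDiffAt ℝ ∞ e (Φ q))
    (v : TangentSpace (𝓡 3) q) :
    mvfderiv (𝓡 3) (Φ.trans e) q v = fderiv ℝ e (Φ q) (mvfderiv (𝓡 3) Φ q v) :=
  mvfderiv_comp_chart hΦ hq (Eventually.of_forall fun _ => rfl) (he.differentiableAt (by simp)) v

/-- Coordinates in which a vector field transverse to a surface is the last coordinate field and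
the surface is a coordinate plane. -/
lemma exists_flowBox_chart (hξ : ∀ q, SmoothFieldAt ξ q) (hS : IsEmbeddedSurface S) (hp : p ∈ S)
    (htr : ξ p ∉ tangentPlane S p) :
    ∃ Φ ∈ IsManifold.maximalAtlas (𝓡 3) ∞ M, p ∈ Φ.source ∧
      (∀ x ∈ Φ.source, x ∈ S ↔ Φ x 2 = 0) ∧
      ∀ x ∈ Φ.source, mvfderiv (𝓡 3) Φ x (ξ x) = stdVec 2 := by
  obtain ⟨φ, hφ, hpφ, hφS⟩ := hS p hp
  have hp2 : φ p 2 = 0 := (hφS p hpφ).1 hp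
  have h1 := mem_tangentPlane_iff (i := 2) hφ hpφ
    (by filter_upwards [φ.open_source.mem_nhds hpφ] with x hx using hφS x hx) hp2 (ξ p)
  obtain ⟨e, hpe, heU, he, hes, hev, he2⟩ := exists_flowBox φ.open_target (V := coordRep φ ξ)
    (fun y hy => by
      have h2 := contDiffAt_coordRep hφ (φ.map_target hy) (hξ (φ.symm y))
      rwa [φ.right_inv hy] at h2) (φ.map_source hpφ) hp2
    (by rwa [coordRep, φ.left_inv hpφ, ne_eq, ← h1])
  refine ⟨φ.trans e, chart_trans_mem hφ he hes, ?_, ?_, ?_⟩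
  · rw [OpenPartialHomeomorph.trans_source]
    exact ⟨hpφ, hpe⟩
  · intro x hx
    rw [OpenPartialHomeomorph.trans_source] at hx
    rw [hφS x hx.1, he2 _ hx.2]
    rfl
  · intro x hx
    rw [OpenPartialHomeomorph.trans_source] at hx
    rw [mvfderiv_chart_trans hφ hx.1 (he _ hx.2), ← hev _ hx.2, coordRep, φ.left_inv hx.1]

variable [RiemannianBundle (fun x : M => TangentSpace (𝓡 3) x)]
variable [IsContMDiffRiemannianBundle (𝓡 3) ∞ E3 (fun x : M => TangentSpace (𝓡 3) x)]

lemma fderiv_metricForm_symm (hΨ : Ψ ∈ IsManifold.maximalAtlas (𝓡 3) ∞ M) {y : E3}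
    (hy : y ∈ Ψ.target) (v a b : E3) :
    fderiv ℝ (metricForm Ψ) y v a b = fderiv ℝ (metricForm Ψ) y v b a := by
  have h := fun a b => fderiv_metricForm_apply hΨ hy (differentiableAt_const a)
    (differentiableAt_const b) v
  have h1 : (fun z => metricForm Ψ z a b) =ᶠ[𝓝 y] fun z => metricForm Ψ z b a := by
    filter_upwards [Ψ.open_target.mem_nhds hy] with z hz using metricForm_symm hΨ hz a b
  have h2 := h a b
  rw [h1.fderiv_eq, h b a] at h2
  simpa using h2.symm

/-- The straightened field commutes with fields of constant coefficients, so the bracket terms of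
the Killing equation disappear. -/
lemma fderiv_metricForm_of_killing (hΦ : Φ ∈ IsManifold.maximalAtlas (𝓡 3) ∞ M)
    (hξ : IsKillingField ξ)
    (hξΦ : ∀ x ∈ Φ.source, mvfderiv (𝓡 3) Φ x (ξ x) = stdVec 2) {y : E3} (hy : y ∈ Φ.target) :
    fderiv ℝ (metricForm Φ) y (stdVec 2) = 0 := by
  refine ContinuousLinearMap.ext fun a => ContinuousLinearMap.ext fun b => ?_
  have hq := Φ.map_target hy
  have hs := fun c : E3 => smoothFieldAt_fld hΦ hq (a := fun _ => c) contDiffAt_const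
  have h1 := hξ.2 (Φ.symm y) _ _ (hs a) (hs b)
  have h2 : ∀ᶠ x in 𝓝 (Φ.symm y), ξ x = fld Φ (fun _ => stdVec 2) x := by
    filter_upwards [Φ.open_source.mem_nhds hq] with x hx
    exact ((fld_eq_iff hΦ hx _ _).2 (hξΦ x hx)).symm
  have h3 : ∀ c, bracket ξ (fld Φ fun _ => c) (Φ.symm y) = 0 := by
    intro c
    rw [bracket_congr h2 (Eventually.of_forall fun _ => rfl),
      bracket_fld hΦ hq contDiffAt_const contDiffAt_const, fld_eq_iff hΦ hq, map_zero]
    simp [VectorField.lieBracket]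
  rw [derivInner_congr h2 (Eventually.of_forall fun _ => rfl) (Eventually.of_forall fun _ => rfl),
    derivInner_fld hΦ hq _ (differentiableAt_const _) (differentiableAt_const _)] at h1
  simp only [innerFun, h3, inner_zero_left, inner_zero_right, Φ.right_inv hy] at h1
  simpa using h1

/-- The vanishing shape operator is applied to the normalized normal `n = lam • C`. Replacing `g(D_v
n, w)` by means of the derivative of `g(n, w) = 0` leaves terms linear in the value of `n`, so the
positive factor `lam` cancels and its derivative is never needed. -/
lemma metricForm_geodesic (hΦ : Φ ∈ IsManifold.maximalAtlas (𝓡 3) ∞ M)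
    (hS : IsTotallyGeodesicSurface S) (hSΦ : ∀ x ∈ Φ.source, x ∈ S ↔ Φ x 2 = 0) {y : E3}
    (hy : y ∈ Φ.target) (hy2 : y 2 = 0) {v w : E3} (hv : v 2 = 0) (hw : w 2 = 0) :
    fderiv ℝ (metricForm Φ) y (stdVec 2 - sliceProj (metricForm Φ) y) v w =
      fderiv ℝ (metricForm Φ) y v (stdVec 2 - sliceProj (metricForm Φ) y) w +
        fderiv ℝ (metricForm Φ) y w (stdVec 2 - sliceProj (metricForm Φ) y) v := by
  set g := metricForm Φ with hg
  have hD : ∀ z ∈ Φ.target, sliceDet g z ≠ 0 := fun z hz =>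
    (sliceDet_pos (metricForm_symm hΦ hz) fun a ha => metricForm_pos hΦ hz ha).ne'
  have hC : ∀ z ∈ Φ.target, ContDiffAt ℝ ∞ (fun z => stdVec 2 - sliceProj g z) z := fun z hz =>
    contDiffAt_const.sub (contDiffAt_sliceProj (contDiffAt_metricForm hΦ hz) (hD z hz))
  have hCperp : ∀ z ∈ Φ.target, ∀ v : E3, v 2 = 0 → g z (stdVec 2 - sliceProj g z) v = 0 := by
    intro z hz v hv
    rw [map_sub, sub_apply, metric_sliceProj (metricForm_symm hΦ hz) (hD z hz) hv, sub_self]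
  have hCC : ∀ z ∈ Φ.target, 0 < g z (stdVec 2 - sliceProj g z) (stdVec 2 - sliceProj g z) := by
    intro z hz
    refine metricForm_pos hΦ hz fun h0 => ?_
    have := congrArg (fun v : E3 => v 2) h0
    simp [sliceProj_apply_two] at this
  set lam : E3 → ℝ := fun z =>
    (√(g z (stdVec 2 - sliceProj g z) (stdVec 2 - sliceProj g z)))⁻¹ with hlam
  have hlam0 : ∀ z ∈ Φ.target, 0 < lam z := fun z hz => inv_pos.2 (Real.sqrt_pos.2 (hCC z hz))
  set n : E3 → E3 := fun z => lam z • (stdVec 2 - sliceProj g z) with hn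
  have hnd : ContDiffAt ℝ ∞ n y := ((((contDiffAt_metricForm hΦ hy).clm_apply (hC y hy)).clm_apply
    (hC y hy)).sqrt (hCC y hy).ne' |>.inv (Real.sqrt_pos.2 (hCC y hy)).ne').smul (hC y hy)
  have hnperp : ∀ z ∈ Φ.target, ∀ v : E3, v 2 = 0 → g z (n z) v = 0 := by
    intro z hz v hv
    rw [hn]
    simp only [map_smul, smul_apply, hCperp z hz v hv, smul_zero]
  have hnn : ∀ z ∈ Φ.target, g z (n z) (n z) = 1 := by
    intro z hz
    simp only [hn, map_smul, smul_apply, smul_eq_mul, hlam]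
    rw [← mul_assoc, ← mul_inv, Real.mul_self_sqrt (hCC z hz).le, inv_mul_cancel₀ (hCC z hz).ne']
  have hq := Φ.map_target hy
  have hr := Φ.right_inv hy
  have hqS : Φ.symm y ∈ S := (hSΦ _ hq).2 (by rw [hr, hy2])
  have htp : ∀ x ∈ Φ.source, x ∈ S → ∀ u : TangentSpace (𝓡 3) x,
      u ∈ tangentPlane S x ↔ mvfderiv (𝓡 3) Φ x u 2 = 0 := fun x hx hxS u =>
    mem_tangentPlane_iff hΦ hx
      (by filter_upwards [Φ.open_source.mem_nhds hx] with z hz using hSΦ z hz)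
      ((hSΦ x hx).1 hxS) u
  have hN : SmoothFieldAt (fld Φ n) (Φ.symm y) := smoothFieldAt_fld hΦ hq (by rwa [hr])
  have h1 := hS.2 _ hqS (fld Φ n) hN (by
    filter_upwards [Φ.open_source.mem_nhds hq] with x hx hxS
    have hxt := Φ.map_source hx
    constructor
    · have h2 := innerFun_fld hΦ hx n n
      rw [← hg, hnn _ hxt, innerFun, real_inner_self_eq_norm_sq] at h2
      rw [← Real.sqrt_sq (norm_nonneg (fld Φ n x)), h2, Real.sqrt_one]
    · intro u hu
      rw [htp x hx hxS] at hu
      rw [real_inner_comm, inner_eq_metricForm hΦ hx, mvfderiv_fld hΦ hx, hnperp _ hxt _ hu])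
  have h2 : ∀ v w : E3, v 2 = 0 → g y (fderiv ℝ n y v) w + koszulForm Φ y v (n y) w = 0 := by
    intro v w hv
    have h3 := h1 (fld Φ (fun _ => v) (Φ.symm y))
      ((htp _ hq hqS _).2 (by rw [mvfderiv_fld hΦ hq, hv]))
    have h4 := inner_leviCivita hΦ hq hN (fld Φ (fun _ => v) (Φ.symm y))
      (fld Φ (fun _ => w) (Φ.symm y))
    rw [neg_eq_zero.1 h3, inner_zero_left, mvfderiv_fld hΦ hq, mvfderiv_fld hΦ hq,
      mvfderiv_fld hΦ hq, hr] at h4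
    have h5 : coordRep Φ (fld Φ n) =ᶠ[𝓝 y] n := by
      filter_upwards [Φ.open_target.mem_nhds hy] with z hz
      rw [coordRep, mvfderiv_fld hΦ (Φ.map_target hz), Φ.right_inv hz]
    rw [h5.fderiv_eq] at h4
    exact h4.symm
  have h3 := h2 v w hv
  have h4 := fderiv_metricForm_apply hΦ hy (hnd.differentiableAt (by simp))
    (differentiableAt_const w) v
  have h5 : (fun z => g z (n z) w) =ᶠ[𝓝 y] fun _ => 0 := by
    filter_upwards [Φ.open_target.mem_nhds hy] with z hz using hnperp z hz w hw
  rw [← hg, h5.fderiv_eq, fderiv_fun_const, fderiv_fun_const] at h4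
  simp only [Pi.zero_apply, zero_apply, map_zero, add_zero] at h4
  rw [koszulForm, ← hg, fderiv_metricForm_symm hΦ hy w v] at h3
  have h6 : lam y * (fderiv ℝ g y (stdVec 2 - sliceProj g y) v w -
      (fderiv ℝ g y v (stdVec 2 - sliceProj g y) w +
        fderiv ℝ g y w (stdVec 2 - sliceProj g y) v)) = 0 := by
    have h7 : n y = lam y • (stdVec 2 - sliceProj g y) := rfl
    rw [h7] at h3 h4
    simp only [map_smul, smul_apply, smul_eq_mul] at h3 h4
    linarith
  have h8 := (mul_eq_zero.1 h6).resolve_left (hlam0 y hy).ne'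
  linarith

/-- The quadratic form `x₀² + ρ x₁² + (1 - ρ) x₂²` as a bilinear form. -/
def diagForm (ρ : ℝ) (a b : E3) : ℝ := a 0 * b 0 + ρ * (a 1 * b 1) + (1 - ρ) * (a 2 * b 2)

/-- A chart in which the metric is `dx₀² + r(x₀) dx₁² + (1 - r(x₀)) dx₂²` and the field `ξ` is
`∂₁ + ∂₂`. -/
structure IsAdaptedChart (ξ : ∀ x : M, TangentSpace (𝓡 3) x) (p : M)
    (Ψ : OpenPartialHomeomorph M E3) (δ : ℝ) (r : ℝ → ℝ) : Prop where
  mem_atlas : Ψ ∈ IsManifold.maximalAtlas (𝓡 3) ∞ M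
  mem_source : p ∈ Ψ.source
  map_base : Ψ p = 0
  delta_pos : 0 < δ
  target_eq : Ψ.target = cube δ
  contDiffAt : ∀ s, |s| < δ → ContDiffAt ℝ ∞ r s
  pos : ∀ s, |s| < δ → 0 < r s
  lt_one : ∀ s, |s| < δ → r s < 1
  field_eq : ∀ q ∈ Ψ.source, mvfderiv (𝓡 3) Ψ q (ξ q) = stdVec 1 + stdVec 2
  inner_eq : ∀ q ∈ Ψ.source, ∀ v w : TangentSpace (𝓡 3) q,
    inner ℝ v w = diagForm (r (Ψ q 0)) (mvfderiv (𝓡 3) Ψ q v) (mvfderiv (𝓡 3) Ψ q w)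

/-- Transversality of `ξ` to `S` gives the flow box, invariance and unit length of `ξ` give a slice
metric, and non-orthogonality makes the tangential part of `ξ` nonzero near `p`, so that the frame
exists. -/
lemma exists_adaptedChart (hξ : IsKillingField ξ) (hunit : ∀ x, ‖ξ x‖ = 1)
    (hS : IsTotallyGeodesicSurface S) (hp : p ∈ S) (horth : ξ p ∉ (tangentPlane S p)ᗮ)
    (htang : ξ p ∉ tangentPlane S p) :
    ∃ Ψ δ r, IsAdaptedChart ξ p Ψ δ r ∧ ∀ x ∈ Ψ.source, x ∈ S ↔ Ψ x 2 = 0 := by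
  obtain ⟨Φ, hΦ, hpΦ, hΦS, hΦξ⟩ := exists_flowBox_chart hξ.1 hS.1 hp htang
  set g := metricForm Φ with hg
  have hy₀ := Φ.map_source hpΦ
  have hy₀2 : Φ p 2 = 0 := (hΦS p hpΦ).1 hp
  have hfield : ∀ y ∈ Φ.target, g y (stdVec 2) (stdVec 2) = 1 := by
    intro y hy
    have hq := Φ.map_target hy
    have h1 := inner_eq_metricForm hΦ hq (ξ (Φ.symm y)) (ξ (Φ.symm y))
    rw [real_inner_self_eq_norm_sq, hunit, hΦξ _ hq, Φ.right_inv hy] at h1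
    rw [hg, ← h1, one_pow]
  have hb : g (Φ p) (stdVec 2) (stdVec 0) ≠ 0 ∨ g (Φ p) (stdVec 2) (stdVec 1) ≠ 0 := by
    by_contra! h0
    refine horth fun u hu => ?_
    have hu2 := (mem_tangentPlane_iff hΦ hpΦ
      (by filter_upwards [Φ.open_source.mem_nhds hpΦ] with z hz using hΦS z hz) hy₀2 u).1 hu
    rw [real_inner_comm, inner_eq_metricForm hΦ hpΦ, hΦξ p hpΦ,
      eq_sum_stdVec (mvfderiv (𝓡 3) Φ p u), hu2]
    simp only [map_add, map_smul, ← hg, h0.1, h0.2, zero_smul, smul_zero, add_zero]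
  have hcb : ∀ i, ContinuousAt (fun y => g y (stdVec 2) (stdVec i)) (Φ p) := fun i =>
    (contDiffAt_metric_const (contDiffAt_metricForm hΦ hy₀) _ _).continuousAt
  have hb' : ∀ᶠ y in 𝓝 (Φ p), g y (stdVec 2) (stdVec 0) ≠ 0 ∨ g y (stdVec 2) (stdVec 1) ≠ 0 := by
    rcases hb with hb | hb
    · filter_upwards [(hcb 0).eventually_ne hb] with y hy using Or.inl hy
    · filter_upwards [(hcb 1).eventually_ne hb] with y hy using Or.inr hy
  obtain ⟨ε, hε, hB⟩ := Metric.eventually_nhds_iff_ball.1 (hb'.and (Φ.open_target.mem_nhds hy₀))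
  -- The centre lies in the plane, so the norm-decreasing projection preserves the ball.
  have hproj : ∀ y ∈ Metric.ball (Φ p) ε, slicePr y ∈ Metric.ball (Φ p) ε := by
    intro y hy
    rw [mem_ball_iff_norm] at hy ⊢
    refine lt_of_le_of_lt ?_ hy
    have h1 : slicePr y - Φ p = slicePr (y - Φ p) := by rw [map_sub, slicePr_of_apply_two hy₀2]
    rw [h1]
    exact norm_slicePr_le _
  have hslice : IsSliceMetric g (Metric.ball (Φ p) ε) := by
    refine ⟨Metric.isOpen_ball, convex_ball _ _, fun y hy => contDiffAt_metricForm hΦ (hB y hy).2,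
      fun y hy => metricForm_symm hΦ (hB y hy).2, fun y hy a ha => metricForm_pos hΦ (hB y hy).2 ha,
      hproj, fun y hy => ?_, fun y hy => hfield y (hB y hy).2, fun y hy => (hB y hy).1,
      fun y hy hy2 v w hv hw => metricForm_geodesic hΦ hS hΦS (hB y hy).2 hy2 hv hw⟩
    refine eq_of_fderiv_apply_eq_zero (convex_ball _ _)
      (fun z hz => (contDiffAt_metricForm hΦ (hB z hz).2).differentiableAt (by simp))
      (hproj y hy) hy fun z hz => ?_
    have h1 : y - slicePr y = y 2 • stdVec 2 := by rw [slicePr_apply]; abel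
    rw [h1, map_smul, fderiv_metricForm_of_killing hΦ hξ hΦξ (hB z hz).2, smul_zero]
  obtain ⟨e, δ, r, hδ, hpe, heB, hep, het, he, hes, hr, heξ, he2, heg⟩ :=
    hslice.exists_coordinates (Metric.mem_ball_self hε) hy₀2
  have hsrc : ∀ x ∈ (Φ.trans e).source, x ∈ Φ.source ∧ Φ x ∈ e.source := by
    intro x hx
    rwa [OpenPartialHomeomorph.trans_source] at hx
  refine ⟨Φ.trans e, δ, r, ⟨chart_trans_mem hΦ he hes, ?_, hep, hδ, ?_, fun s hs => (hr s hs).1,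
    fun s hs => (hr s hs).2.1, fun s hs => (hr s hs).2.2, ?_, ?_⟩, ?_⟩
  · rw [OpenPartialHomeomorph.trans_source]
    exact ⟨hpΦ, hpe⟩
  · rw [OpenPartialHomeomorph.trans_target, ← het]
    exact Set.inter_eq_left.2 fun y hy => (hB _ (heB (e.map_target hy))).2
  · intro x hx
    obtain ⟨h1, h2⟩ := hsrc x hx
    rw [mvfderiv_chart_trans hΦ h1 (he _ h2), hΦξ x h1, heξ _ h2]
  · intro x hx v w
    obtain ⟨h1, h2⟩ := hsrc x hx
    rw [mvfderiv_chart_trans hΦ h1 (he _ h2), mvfderiv_chart_trans hΦ h1 (he _ h2),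
      inner_eq_metricForm hΦ h1, ← hg, heg _ h2]
    rfl
  · intro x hx
    obtain ⟨h1, h2⟩ := hsrc x hx
    rw [hΦS x h1]
    change _ ↔ e (Φ x) 2 = 0
    rw [he2 _ h2]

end AdaptedChart
end

noncomputable section

/-! ### Christoffel symbols and coordinate planes in an adapted chart -/

section AdaptedChartCalculus

/-- The Christoffel symbols of the metric `dx₀² + r(x₀) dx₁² + (1 - r(x₀)) dx₂²` at a point where
`r` takes the value `ρ` and its derivative the value `ρ'`. -/
def chris (ρ ρ' : ℝ) (a b : E3) : E3 :=
  !₂[-(ρ' / 2) * (a 1 * b 1 - a 2 * b 2), ρ' / (2 * ρ) * (a 0 * b 1 + a 1 * b 0),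
    -(ρ' / (2 * (1 - ρ))) * (a 0 * b 2 + a 2 * b 0)]

@[simp] lemma chris_apply_zero (ρ ρ' : ℝ) (a b : E3) :
    chris ρ ρ' a b 0 = -(ρ' / 2) * (a 1 * b 1 - a 2 * b 2) := rfl

@[simp] lemma chris_apply_one (ρ ρ' : ℝ) (a b : E3) :
    chris ρ ρ' a b 1 = ρ' / (2 * ρ) * (a 0 * b 1 + a 1 * b 0) := rfl

@[simp] lemma chris_apply_two (ρ ρ' : ℝ) (a b : E3) :
    chris ρ ρ' a b 2 = -(ρ' / (2 * (1 - ρ))) * (a 0 * b 2 + a 2 * b 0) := rfl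

variable {M : Type*} [TopologicalSpace M] [ChartedSpace E3 M] [IsManifold (𝓡 3) ∞ M]
variable {Ψ : OpenPartialHomeomorph M E3} {q p : M} {ξ : ∀ x : M, TangentSpace (𝓡 3) x} {S : Set M}
variable [RiemannianBundle (fun x : M => TangentSpace (𝓡 3) x)]
variable {δ : ℝ} {r : ℝ → ℝ}

/-- Exchange two coordinates. -/
def coordSwap (i j : Fin 3) : E3 ≃ₗᵢ[ℝ] E3 :=
  LinearIsometryEquiv.piLpCongrLeft 2 ℝ ℝ (Equiv.swap i j)

lemma coordSwap_apply (i j k : Fin 3) (v : E3) : coordSwap i j v k = v (Equiv.swap i j k) := by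
  simp [coordSwap, LinearIsometryEquiv.piLpCongrLeft_apply, Equiv.piCongrLeft'_apply]

/-- Exchange two coordinates of a chart. -/
def swapChart (Ψ : OpenPartialHomeomorph M E3) (i j : Fin 3) : OpenPartialHomeomorph M E3 :=
  Ψ.trans (coordSwap i j).toHomeomorph.toOpenPartialHomeomorph

lemma swapChart_source (i j : Fin 3) : (swapChart Ψ i j).source = Ψ.source := by
  simp [swapChart]

lemma swapChart_apply (i j k : Fin 3) (x : M) : swapChart Ψ i j x k = Ψ x (Equiv.swap i j k) :=
  coordSwap_apply i j k (Ψ x)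

lemma swapChart_mem (hΨ : Ψ ∈ IsManifold.maximalAtlas (𝓡 3) ∞ M) (i j : Fin 3) :
    swapChart Ψ i j ∈ IsManifold.maximalAtlas (𝓡 3) ∞ M :=
  chart_trans_mem hΨ (fun _ _ => (coordSwap i j).contDiff.contDiffAt)
    fun _ _ => (coordSwap i j).symm.contDiff.contDiffAt

lemma mvfderiv_swapChart (hΨ : Ψ ∈ IsManifold.maximalAtlas (𝓡 3) ∞ M) (hq : q ∈ Ψ.source)
    (i j : Fin 3) (v : TangentSpace (𝓡 3) q) :
    mvfderiv (𝓡 3) (swapChart Ψ i j) q v = coordSwap i j (mvfderiv (𝓡 3) Ψ q v) := by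
  have h := mvfderiv_chart_trans hΨ (e := (coordSwap i j).toHomeomorph.toOpenPartialHomeomorph) hq
    (coordSwap i j).contDiff.contDiffAt v
  have h2 : fderiv ℝ (coordSwap i j).toHomeomorph.toOpenPartialHomeomorph (Ψ q) =
      ((coordSwap i j).toContinuousLinearEquiv : E3 →L[ℝ] E3) :=
    (coordSwap i j).toContinuousLinearEquiv.hasFDerivAt.fderiv
  rw [h2] at h
  exact h

lemma hasFDerivAt_comp_coord_zero {f : ℝ → ℝ} {y : E3} (hf : DifferentiableAt ℝ f (y 0)) :
    HasFDerivAt (fun z : E3 => f (z 0)) (deriv f (y 0) • (EuclideanSpace.proj 0 : E3 →L[ℝ] ℝ)) y :=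
  hf.hasDerivAt.comp_hasFDerivAt y (EuclideanSpace.proj 0 : E3 →L[ℝ] ℝ).hasFDerivAt

lemma isEmbeddedSurface_coordPlane (hΨ : Ψ ∈ IsManifold.maximalAtlas (𝓡 3) ∞ M) (i : Fin 3) :
    IsEmbeddedSurface {x | x ∈ Ψ.source ∧ Ψ x i = 0} := by
  intro q hq
  refine ⟨swapChart Ψ i 2, swapChart_mem hΨ i 2, by rw [swapChart_source]; exact hq.1, ?_⟩
  intro x hx
  rw [swapChart_source] at hx
  simp [swapChart_apply, hx]

lemma fderiv_eq_zero_of_coordPlane {f : E3 → ℝ} {y : E3} {i : Fin 3} (hf : DifferentiableAt ℝ f y)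
    (hy : y i = 0) (h0 : ∀ᶠ z in 𝓝 y, z i = 0 → f z = 0) {v : E3} (hv : v i = 0) :
    fderiv ℝ f y v = 0 := by
  have hline : HasDerivAt (fun t : ℝ => y + t • v) v 0 := by
    simpa using ((hasDerivAt_id (0 : ℝ)).smul_const v).const_add y
  have h1 := hf.hasFDerivAt
  have hc := hline.continuousAt
  have hz : y + (0 : ℝ) • v = y := by simp
  rw [ContinuousAt, hz] at hc
  rw [← hz] at h1
  have h2 := h1.comp_hasDerivAt 0 hline
  have h3 : (f ∘ fun t : ℝ => y + t • v) =ᶠ[𝓝 0] fun _ => 0 := by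
    filter_upwards [hc.eventually h0] with t ht
    exact ht (by simp [hy, hv])
  have h7 := (h3.hasDerivAt_iff.1 h2).unique (hasDerivAt_const 0 0)
  simpa using h7

namespace IsAdaptedChart

/-- The normal form is symmetric under exchange of `x₁` and `x₂` together with `r ↦ 1 - r`. Results
about the plane `x₂ = 0` thus transfer to `x₁ = 0`. -/
lemma swap (h : IsAdaptedChart ξ p Ψ δ r) :
    IsAdaptedChart ξ p (swapChart Ψ 1 2) δ (fun s => 1 - r s) := by
  have hs0 : Equiv.swap (1 : Fin 3) 2 0 = 0 := by decide
  have hs1 : Equiv.swap (1 : Fin 3) 2 1 = 2 := by decide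
  have hs2 : Equiv.swap (1 : Fin 3) 2 2 = 1 := by decide
  refine ⟨swapChart_mem h.mem_atlas 1 2, by rw [swapChart_source]; exact h.mem_source, ?_,
    h.delta_pos, ?_, fun s hs => contDiffAt_const.sub (h.contDiffAt s hs),
    fun s hs => by linarith [h.lt_one s hs], fun s hs => by linarith [h.pos s hs], ?_, ?_⟩
  · ext k
    rw [swapChart_apply, h.map_base]
    rfl
  · ext y
    have h1 : y ∈ (swapChart Ψ 1 2).target ↔ (coordSwap 1 2).symm y ∈ Ψ.target := by
      simp [swapChart]
    have h2 : ∀ k, (coordSwap 1 2).symm y k = y (Equiv.swap 1 2 k) := by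
      intro k
      have := coordSwap_apply 1 2 (Equiv.swap 1 2 k) ((coordSwap 1 2).symm y)
      rw [Equiv.swap_apply_self, LinearIsometryEquiv.apply_symm_apply] at this
      exact this.symm
    rw [h1, h.target_eq]
    constructor
    · intro hy i
      have := hy (Equiv.swap 1 2 i)
      rwa [h2, Equiv.swap_apply_self] at this
    · intro hy i
      rw [h2]
      exact hy _
  · intro q hq
    rw [swapChart_source] at hq
    rw [mvfderiv_swapChart h.mem_atlas hq, h.field_eq q hq]
    ext k
    rw [coordSwap_apply]
    fin_cases k <;> simp [hs0, hs1, hs2]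
  · intro q hq v w
    rw [swapChart_source] at hq
    rw [mvfderiv_swapChart h.mem_atlas hq, mvfderiv_swapChart h.mem_atlas hq, h.inner_eq q hq]
    simp only [diagForm, coordSwap_apply, swapChart_apply, hs0, hs1, hs2]
    ring

lemma abs_lt (h : IsAdaptedChart ξ p Ψ δ r) {y : E3} (hy : y ∈ Ψ.target) : |y 0| < δ := by
  rw [h.target_eq] at hy
  exact hy 0

lemma metricForm_eq (h : IsAdaptedChart ξ p Ψ δ r) {y : E3} (hy : y ∈ Ψ.target) (a b : E3) :
    metricForm Ψ y a b = diagForm (r (y 0)) a b := by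
  have hq := Ψ.map_target hy
  have h1 := innerFun_fld h.mem_atlas hq (fun _ => a) (fun _ => b)
  rw [Ψ.right_inv hy] at h1
  rw [← h1, innerFun, h.inner_eq _ hq, mvfderiv_fld h.mem_atlas hq, mvfderiv_fld h.mem_atlas hq,
    Ψ.right_inv hy]

lemma differentiableAt (h : IsAdaptedChart ξ p Ψ δ r) {s : ℝ} (hs : |s| < δ) :
    DifferentiableAt ℝ r s := (h.contDiffAt s hs).differentiableAt (by simp)

variable [IsContMDiffRiemannianBundle (𝓡 3) ∞ E3 (fun x : M => TangentSpace (𝓡 3) x)]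

lemma fderiv_metricForm_eq (h : IsAdaptedChart ξ p Ψ δ r) {y : E3} (hy : y ∈ Ψ.target)
    (v a b : E3) :
    fderiv ℝ (metricForm Ψ) y v a b = deriv r (y 0) * v 0 * (a 1 * b 1 - a 2 * b 2) := by
  have h1 := fderiv_metricForm_apply h.mem_atlas hy (differentiableAt_const a)
    (differentiableAt_const b) v
  have h2 : (fun z => metricForm Ψ z a b) =ᶠ[𝓝 y] fun z => diagForm (r (z 0)) a b := by
    filter_upwards [Ψ.open_target.mem_nhds hy] with z hz using h.metricForm_eq hz a b
  have h3 := hasFDerivAt_comp_coord_zero (h.differentiableAt (h.abs_lt hy))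
  have h4 : HasFDerivAt (fun z => diagForm (r (z 0)) a b) _ y :=
    ((hasFDerivAt_const (a 0 * b 0) y).add (h3.mul_const (a 1 * b 1))).add
      ((h3.const_sub 1).mul_const (a 2 * b 2))
  rw [h2.fderiv_eq, h4.fderiv] at h1
  simp at h1
  rw [← h1]
  ring

/-- The Levi-Civita derivative in an adapted chart. -/
lemma leviCivita_eq (h : IsAdaptedChart ξ p Ψ δ r) (hq : q ∈ Ψ.source)
    {Y : ∀ x : M, TangentSpace (𝓡 3) x} (hY : SmoothFieldAt Y q) (v : TangentSpace (𝓡 3) q) :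
    mvfderiv (𝓡 3) Ψ q (leviCivita Y q v) =
      fderiv ℝ (coordRep Ψ Y) (Ψ q) (mvfderiv (𝓡 3) Ψ q v) +
        chris (r (Ψ q 0)) (deriv r (Ψ q 0)) (mvfderiv (𝓡 3) Ψ q v) (mvfderiv (𝓡 3) Ψ q (Y q)) := by
  have hy := Ψ.map_source hq
  have hs := h.abs_lt hy
  have h0 := (h.pos _ hs).ne'
  have h1 : 1 - r (Ψ q 0) ≠ 0 := (sub_pos.2 (h.lt_one _ hs)).ne'
  rw [← fld_eq_iff h.mem_atlas hq (fun _ => fderiv ℝ (coordRep Ψ Y) (Ψ q) (mvfderiv (𝓡 3) Ψ q v) +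
    chris (r (Ψ q 0)) (deriv r (Ψ q 0)) (mvfderiv (𝓡 3) Ψ q v) (mvfderiv (𝓡 3) Ψ q (Y q)))]
  refine ext_inner_right ℝ fun z => ?_
  rw [inner_leviCivita h.mem_atlas hq hY, h.inner_eq q hq, mvfderiv_fld h.mem_atlas hq,
    h.metricForm_eq hy, koszulForm, h.fderiv_metricForm_eq hy, h.fderiv_metricForm_eq hy,
    h.fderiv_metricForm_eq hy]
  simp only [diagForm, PiLp.add_apply, chris_apply_zero, chris_apply_one, chris_apply_two]
  field_simp
  ring

lemma leviCivita_eq_zero_iff (h : IsAdaptedChart ξ p Ψ δ r) (hq : q ∈ Ψ.source)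
    {Y : ∀ x : M, TangentSpace (𝓡 3) x} (hY : SmoothFieldAt Y q) (v : TangentSpace (𝓡 3) q) :
    leviCivita Y q v = 0 ↔
      fderiv ℝ (coordRep Ψ Y) (Ψ q) (mvfderiv (𝓡 3) Ψ q v) +
        chris (r (Ψ q 0)) (deriv r (Ψ q 0)) (mvfderiv (𝓡 3) Ψ q v)
          (mvfderiv (𝓡 3) Ψ q (Y q)) = 0 := by
  rw [← h.leviCivita_eq hq hY, ← (mvfderiv (𝓡 3) Ψ q).map_zero]
  exact (mvfderiv_chart_injective h.mem_atlas hq).eq_iff.symm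

lemma mem_tangentPlane_coordPlane (h : IsAdaptedChart ξ p Ψ δ r) {i : Fin 3} (hq : q ∈ Ψ.source)
    (hqi : Ψ q i = 0) (v : TangentSpace (𝓡 3) q) :
    v ∈ tangentPlane {x | x ∈ Ψ.source ∧ Ψ x i = 0} q ↔ mvfderiv (𝓡 3) Ψ q v i = 0 := by
  refine mem_tangentPlane_iff h.mem_atlas hq ?_ hqi v
  filter_upwards [Ψ.open_source.mem_nhds hq] with x hx
  simp [hx]

lemma coordRep_chart (_ : IsAdaptedChart ξ p Ψ δ r) (hq : q ∈ Ψ.source)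
    (Y : ∀ x : M, TangentSpace (𝓡 3) x) : coordRep Ψ Y (Ψ q) = mvfderiv (𝓡 3) Ψ q (Y q) := by
  rw [coordRep, Ψ.left_inv hq]

/-- The coefficients of a unit normal field of a coordinate plane. -/
lemma normal_coordPlane (h : IsAdaptedChart ξ p Ψ δ r) {i : Fin 3} (hq : q ∈ Ψ.source)
    (hqi : Ψ q i = 0) {N : ∀ x : M, TangentSpace (𝓡 3) x}
    (hN1 : ‖N q‖ = 1) (hN : N q ∈ (tangentPlane {x | x ∈ Ψ.source ∧ Ψ x i = 0} q)ᗮ) :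
    (∀ j, j ≠ i → coordRep Ψ N (Ψ q) j = 0) ∧
      diagForm (r (Ψ q 0)) (coordRep Ψ N (Ψ q)) (coordRep Ψ N (Ψ q)) = 1 := by
  have hs := h.abs_lt (Ψ.map_source hq)
  have h0 := (h.pos _ hs).ne'
  have h1 : 1 - r (Ψ q 0) ≠ 0 := (sub_pos.2 (h.lt_one _ hs)).ne'
  rw [h.coordRep_chart hq, ← h.inner_eq q hq, real_inner_self_eq_norm_sq, hN1]
  refine ⟨fun j hj => ?_, one_pow 2⟩
  have h2 := hN (fld Ψ (fun _ => stdVec j) q) ((h.mem_tangentPlane_coordPlane hq hqi _).2 (by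
    rw [mvfderiv_fld h.mem_atlas hq]
    simp [hj.symm]))
  rw [h.inner_eq q hq, mvfderiv_fld h.mem_atlas hq, diagForm] at h2
  fin_cases j <;> simpa [h0, h1] using h2

/-- A normal field is controlled only on the surface, so only its derivatives along tangent vectors
are known. Here `b` stands for its coordinates and `b'` for their derivative along `v`; the
hypotheses of `key` are that only the `i`-th coordinate survives and the derivative of the unit
length condition. -/
lemma isTotallyGeodesicSurface_coordPlane (h : IsAdaptedChart ξ p Ψ δ r) {i : Fin 3}
    (key : ∀ y ∈ Ψ.target, y i = 0 → ∀ b b' v : E3, (∀ j, j ≠ i → b j = 0) →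
      (∀ j, j ≠ i → b' j = 0) → diagForm (r (y 0)) b b = 1 → v i = 0 →
      deriv r (y 0) * v 0 * (b 1 * b 1 - b 2 * b 2) + 2 * diagForm (r (y 0)) b b' = 0 →
      b' + chris (r (y 0)) (deriv r (y 0)) v b = 0) :
    IsTotallyGeodesicSurface {x | x ∈ Ψ.source ∧ Ψ x i = 0} := by
  refine ⟨isEmbeddedSurface_coordPlane h.mem_atlas i, fun q hq N hNs hN v hv => ?_⟩
  obtain ⟨hq, hqi⟩ := hq
  rw [h.mem_tangentPlane_coordPlane hq hqi] at hv
  rw [neg_eq_zero, h.leviCivita_eq_zero_iff hq hNs, ← h.coordRep_chart hq]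
  have hy := Ψ.map_source hq
  have hbs := contDiffAt_coordRep h.mem_atlas hq hNs
  have hbd := hbs.differentiableAt (by simp)
  have hev : ∀ᶠ y in 𝓝 (Ψ q), y i = 0 → (∀ j, j ≠ i → coordRep Ψ N y j = 0) ∧
      diagForm (r (y 0)) (coordRep Ψ N y) (coordRep Ψ N y) = 1 := by
    have hc := Ψ.continuousAt_symm hy
    rw [ContinuousAt, Ψ.left_inv hq] at hc
    filter_upwards [Ψ.open_target.mem_nhds hy, hc.eventually hN] with y hyt hyN hyi
    have hq' := Ψ.map_target hyt
    have h3 : Ψ (Ψ.symm y) i = 0 := by rwa [Ψ.right_inv hyt]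
    have h4 := hyN ⟨hq', h3⟩
    have h5 := h.normal_coordPlane hq' h3 h4.1 h4.2
    rwa [Ψ.right_inv hyt] at h5
  set b := coordRep Ψ N
  set w := mvfderiv (𝓡 3) Ψ q v
  have hcomp : ∀ j, HasFDerivAt (fun z => b z j)
      ((EuclideanSpace.proj j : E3 →L[ℝ] ℝ).comp (fderiv ℝ b (Ψ q))) (Ψ q) := fun j =>
    (EuclideanSpace.proj j : E3 →L[ℝ] ℝ).hasFDerivAt.comp (Ψ q) hbd.hasFDerivAt
  refine key (Ψ q) hy hqi _ _ _ (hev.self_of_nhds hqi).1 ?_ (hev.self_of_nhds hqi).2 hv ?_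
  · intro j hj
    have h6 := fderiv_eq_zero_of_coordPlane (hcomp j).differentiableAt hqi
      (by filter_upwards [hev] with y hy hyi using (hy hyi).1 j hj) hv
    rw [(hcomp j).fderiv] at h6
    exact h6
  · have h3 := hasFDerivAt_comp_coord_zero (h.differentiableAt (h.abs_lt hy))
    have h4 : HasFDerivAt (fun z => diagForm (r (z 0)) (b z) (b z) - 1) _ (Ψ q) :=
      ((((hcomp 0).mul (hcomp 0)).add (h3.mul ((hcomp 1).mul (hcomp 1)))).add
        ((h3.const_sub 1).mul ((hcomp 2).mul (hcomp 2)))).sub_const 1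
    have h6 := fderiv_eq_zero_of_coordPlane h4.differentiableAt hqi
      (by filter_upwards [hev] with y hy hyi using sub_eq_zero.2 (hy hyi).2) hv
    rw [h4.fderiv] at h6
    simp at h6
    rw [diagForm, ← h6]
    ring

/-- The surface orthogonal to the first one. -/
lemma isTotallyGeodesicSurface_coordPlane_one (h : IsAdaptedChart ξ p Ψ δ r) :
    IsTotallyGeodesicSurface {x | x ∈ Ψ.source ∧ Ψ x 1 = 0} := by
  refine h.isTotallyGeodesicSurface_coordPlane fun y hy hyi b b' v hb hb' hbb hv hd => ?_
  have hs := h.abs_lt hy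
  have h0 := (h.pos _ hs).ne'
  have b0 := hb 0 (by decide)
  have b2 := hb 2 (by decide)
  have b0' := hb' 0 (by decide)
  have b2' := hb' 2 (by decide)
  simp only [diagForm, b0, b2, b0', b2', mul_zero, add_zero, zero_add, sub_zero] at hbb hd
  have hb1 : b 1 ≠ 0 := by
    rintro h1
    simp [h1] at hbb
  ext k
  fin_cases k
  · simp [b0', b2, hv]
  · simp [b0, hv]
    field_simp
    have h5 : b 1 * (b' 1 * 2 * r (y 0) + deriv r (y 0) * v 0 * b 1) = 0 := by linarith
    have h6 := (mul_eq_zero.1 h5).resolve_left hb1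
    linarith
  · simp [b2', b0, b2]

/-- All Christoffel symbols are multiples of `r'` and vanish on `x₀ = 0`. -/
lemma isTotallyGeodesicSurface_coordPlane_zero (h : IsAdaptedChart ξ p Ψ δ r)
    (hr : deriv r 0 = 0) : IsTotallyGeodesicSurface {x | x ∈ Ψ.source ∧ Ψ x 0 = 0} := by
  refine h.isTotallyGeodesicSurface_coordPlane fun y hy hyi b b' v hb hb' hbb hv hd => ?_
  have b1 := hb 1 (by decide)
  have b2 := hb 2 (by decide)
  have b1' := hb' 1 (by decide)
  have b2' := hb' 2 (by decide)
  simp only [diagForm, b1, b2, b1', b2', mul_zero, add_zero, hyi, hr, zero_mul, zero_add] at hbb hd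
  have hb0 : b 0 ≠ 0 := by
    rintro h1
    simp [h1] at hbb
  have b0' : b' 0 = 0 := by
    have : b 0 * b' 0 = 0 := by linarith
    exact (mul_eq_zero.1 this).resolve_left hb0
  ext k
  fin_cases k <;> simp [b0', b1', b2', hyi, hr]

end IsAdaptedChart

end AdaptedChartCalculus
end

noncomputable section

/-! ### Parametrized totally geodesic surfaces with parallel normal -/

section NormalPatch

variable {M : Type*} [TopologicalSpace M] [ChartedSpace E3 M] [IsManifold (𝓡 3) ∞ M]
variable {Ψ : OpenPartialHomeomorph M E3} {q p : M} {ξ : ∀ x : M, TangentSpace (𝓡 3) x} {S : Set M}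
variable [RiemannianBundle (fun x : M => TangentSpace (𝓡 3) x)]
variable {δ : ℝ} {r : ℝ → ℝ}

/-- A parametrization `G` of the surface `S` near `q` in an adapted chart together with a parallel
unit normal `β`. The map `G` is defined on a ball of `E3` but has rank two. -/
structure IsNormalPatch (Ψ : OpenPartialHomeomorph M E3) (r : ℝ → ℝ) (S : Set M) (q : M)
    (z₀ : E3) (ε : ℝ) (G β : E3 → E3) : Prop where
  eps_pos : 0 < ε
  map_center : G z₀ = Ψ q
  mem_target : ∀ z ∈ Metric.ball z₀ ε, G z ∈ Ψ.target
  contDiffAt_map : ∀ z ∈ Metric.ball z₀ ε, ContDiffAt ℝ ∞ G z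
  contDiffAt_normal : ∀ z ∈ Metric.ball z₀ ε, ContDiffAt ℝ ∞ β z
  parallel : ∀ z ∈ Metric.ball z₀ ε, ∀ v, fderiv ℝ β z v =
    -chris (r (G z 0)) (deriv r (G z 0)) (fderiv ℝ G z v) (β z)
  orthogonal : ∀ z ∈ Metric.ball z₀ ε, ∀ v, diagForm (r (G z 0)) (β z) (fderiv ℝ G z v) = 0
  unit : ∀ z ∈ Metric.ball z₀ ε, diagForm (r (G z 0)) (β z) (β z) = 1
  surj : ∀ z ∈ Metric.ball z₀ ε, ∀ w, diagForm (r (G z 0)) (β z) w = 0 →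
    ∃ v, fderiv ℝ G z v = w
  mem_surface : ∀ z ∈ Metric.ball z₀ ε, Ψ.symm (G z) ∈ S
  cover : ∀ᶠ x in 𝓝 q, x ∈ S → ∃ z ∈ Metric.ball z₀ ε, G z = Ψ x
  tangent : ∀ v : TangentSpace (𝓡 3) q,
    v ∈ tangentPlane S q ↔ diagForm (r (Ψ q 0)) (β z₀) (mvfderiv (𝓡 3) Ψ q v) = 0

lemma fderiv_symm_comp_fderiv {e : OpenPartialHomeomorph E3 E3} {y : E3} (hy : y ∈ e.source)
    (he : DifferentiableAt ℝ e y) (hes : DifferentiableAt ℝ e.symm (e y)) (v : E3) :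
    fderiv ℝ e.symm (e y) (fderiv ℝ e y v) = v := by
  have h1 := hes.hasFDerivAt.comp y he.hasFDerivAt
  have h2 : HasFDerivAt (e.symm ∘ e) (ContinuousLinearMap.id ℝ E3) y := by
    refine (hasFDerivAt_id _).congr_of_eventuallyEq ?_
    filter_upwards [e.open_source.mem_nhds hy] with z hz using e.left_inv hz
  exact DFunLike.congr_fun (h1.unique h2) v

/-- The gradient, with respect to `diagForm ρ`, of the linear form `ℓ`. -/
def diagDual (ρ : ℝ) (l : E3 →L[ℝ] ℝ) : E3 :=
  l (stdVec 0) • stdVec 0 + (l (stdVec 1) / ρ) • stdVec 1 + (l (stdVec 2) / (1 - ρ)) • stdVec 2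

lemma diagForm_diagDual {ρ : ℝ} (h0 : ρ ≠ 0) (h1 : 1 - ρ ≠ 0) (l : E3 →L[ℝ] ℝ) (v : E3) :
    diagForm ρ (diagDual ρ l) v = l v := by
  conv_rhs => rw [eq_sum_stdVec v]
  simp [diagForm, diagDual]
  field_simp

lemma diagForm_smul_left (ρ c : ℝ) (a b : E3) : diagForm ρ (c • a) b = c * diagForm ρ a b := by
  simp [diagForm]
  ring

lemma diagForm_smul_right (ρ c : ℝ) (a b : E3) : diagForm ρ a (c • b) = c * diagForm ρ a b := by
  simp [diagForm]
  ring

lemma diagForm_self_pos {ρ : ℝ} (h0 : 0 < ρ) (h1 : ρ < 1) {a : E3} (ha : a ≠ 0) :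
    0 < diagForm ρ a a := by
  have p0 := mul_self_nonneg (a 0)
  have p1 := mul_nonneg h0.le (mul_self_nonneg (a 1))
  have p2 := mul_nonneg (sub_pos.2 h1).le (mul_self_nonneg (a 2))
  rcases (add_nonneg (add_nonneg p0 p1) p2).eq_or_lt with h | h
  · exfalso
    apply ha
    have q0 : a 0 = 0 := mul_self_eq_zero.1 (by linarith)
    have q1 : a 1 = 0 := mul_self_eq_zero.1
      ((mul_eq_zero.1 (by linarith : ρ * (a 1 * a 1) = 0)).resolve_left h0.ne')
    have q2 : a 2 = 0 := mul_self_eq_zero.1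
      ((mul_eq_zero.1 (by linarith : (1 - ρ) * (a 2 * a 2) = 0)).resolve_left (sub_pos.2 h1).ne')
    rw [eq_sum_stdVec a, q0, q1, q2]
    simp
  · exact h

namespace IsAdaptedChart

variable [IsContMDiffRiemannianBundle (𝓡 3) ∞ E3 (fun x : M => TangentSpace (𝓡 3) x)]

/-- With `φ` a chart flattening `S`, the parametrization is `Ψ ∘ φ⁻¹` preceded by the projection to
the plane. The normal is the normalized gradient of the last coordinate of `φ`; it is defined on an
open set, so the vanishing of the shape operator applies to it and says that it is parallel along
`S`. -/
lemma exists_normalPatch (h : IsAdaptedChart ξ p Ψ δ r) (hS : IsTotallyGeodesicSurface S)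
    (hq : q ∈ Ψ.source) (hqS : q ∈ S) : ∃ z₀ ε G β, IsNormalPatch Ψ r S q z₀ ε G β := by
  obtain ⟨φ, hφ, hqφ, hφS⟩ := hS.1 q hqS
  have hΨ := h.mem_atlas
  let F : OpenPartialHomeomorph E3 E3 := φ.symm.trans Ψ
  have hFs : ∀ z, z ∈ F.source ↔ z ∈ φ.target ∧ φ.symm z ∈ Ψ.source := fun z => by
    simp [F]
  have hFt : ∀ y, y ∈ F.target ↔ y ∈ Ψ.target ∧ Ψ.symm y ∈ φ.source := fun y => by
    simp [F]
  have hFd : ∀ z ∈ F.source, ContDiffAt ℝ ∞ F z := by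
    intro z hz
    rw [hFs] at hz
    have h1 := contDiffAt_comp_symm hφ (φ.map_target hz.1)
      (contMDiffAt_of_mem_maximalAtlas hΨ hz.2)
    rwa [φ.right_inv hz.1] at h1
  have hFsd : ∀ y ∈ F.target, ContDiffAt ℝ ∞ F.symm y := by
    intro y hy
    rw [hFt] at hy
    have h1 := contDiffAt_comp_symm hΨ (Ψ.map_target hy.1)
      (contMDiffAt_of_mem_maximalAtlas hφ hy.2)
    rwa [Ψ.right_inv hy.1] at h1
  have hr0 : ∀ y ∈ F.target, 0 < r (y 0) := fun y hy => h.pos _ (h.abs_lt ((hFt y).1 hy).1)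
  have hr1 : ∀ y ∈ F.target, r (y 0) < 1 := fun y hy => h.lt_one _ (h.abs_lt ((hFt y).1 hy).1)
  -- The differential of the defining function of `S`, expressed in the chart `Ψ`; `m` is its
  -- gradient.
  let l : E3 → E3 →L[ℝ] ℝ := fun y => (EuclideanSpace.proj 2 : E3 →L[ℝ] ℝ).comp (fderiv ℝ F.symm y)
  have hlv : ∀ y v, l y v = fderiv ℝ F.symm y v 2 := fun y v => rfl
  let m : E3 → E3 := fun y => diagDual (r (y 0)) (l y)
  have hls : ∀ y ∈ F.target, ∀ v, ContDiffAt ℝ ∞ (fun y => l y v) y := by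
    intro y hy v
    have h1 : ContDiffAt ℝ ∞ (fderiv ℝ F.symm) y := (hFsd y hy).fderiv_right (by simp)
    exact (EuclideanSpace.proj 2 : E3 →L[ℝ] ℝ).contDiff.contDiffAt.comp y
      (h1.clm_apply contDiffAt_const)
  have hrs : ∀ y ∈ F.target, ContDiffAt ℝ ∞ (fun y : E3 => r (y 0)) y := fun y hy =>
    (h.contDiffAt _ (h.abs_lt ((hFt y).1 hy).1)).comp y (contDiffAt_coord 0 y)
  have hms : ∀ y ∈ F.target, ContDiffAt ℝ ∞ m y := fun y hy =>
    (((hls y hy _).smul contDiffAt_const).add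
      (((hls y hy _).div (hrs y hy) (hr0 y hy).ne').smul contDiffAt_const)).add
      (((hls y hy _).div (contDiffAt_const.sub (hrs y hy)) (sub_pos.2 (hr1 y hy)).ne').smul
        contDiffAt_const)
  have hmv : ∀ y ∈ F.target, ∀ v, diagForm (r (y 0)) (m y) v = fderiv ℝ F.symm y v 2 :=
    fun y hy v => diagForm_diagDual (hr0 y hy).ne' (sub_pos.2 (hr1 y hy)).ne' _ _
  have hleft : ∀ z ∈ F.source, ∀ v, fderiv ℝ F.symm (F z) (fderiv ℝ F z v) = v := fun z hz =>
    fderiv_symm_comp_fderiv hz ((hFd z hz).differentiableAt (by simp))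
      ((hFsd _ (F.map_source hz)).differentiableAt (by simp))
  have hright : ∀ y ∈ F.target, ∀ v, fderiv ℝ F (F.symm y) (fderiv ℝ F.symm y v) = v :=
    fun y hy => fderiv_symm_comp_fderiv (e := F.symm) hy
      ((hFsd y hy).differentiableAt (by simp))
      ((hFd _ (F.map_target hy)).differentiableAt (by simp))
  have hm0 : ∀ y ∈ F.target, 0 < diagForm (r (y 0)) (m y) (m y) := by
    intro y hy
    refine diagForm_self_pos (hr0 y hy) (hr1 y hy) fun h0 => ?_
    have h1 := hmv y hy (fderiv ℝ F (F.symm y) (stdVec 2))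
    have h2 := hleft _ (F.map_target hy) (stdVec 2)
    rw [F.right_inv hy] at h2
    rw [h2, h0] at h1
    simp [diagForm] at h1
  let lam : E3 → ℝ := fun y => (√(diagForm (r (y 0)) (m y) (m y)))⁻¹
  have hlam0 : ∀ y ∈ F.target, lam y ≠ 0 := fun y hy =>
    (inv_pos.2 (Real.sqrt_pos.2 (hm0 y hy))).ne'
  let n : E3 → E3 := fun y => lam y • m y
  have hns : ∀ y ∈ F.target, ContDiffAt ℝ ∞ n y := by
    intro y hy
    have hc : ∀ i, ContDiffAt ℝ ∞ (fun y => m y i) y := fun i =>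
      (contDiffAt_coord i (m y)).comp y (hms y hy)
    have hd : ContDiffAt ℝ ∞ (fun y => diagForm (r (y 0)) (m y) (m y)) y :=
      (((hc 0).mul (hc 0)).add ((hrs y hy).mul ((hc 1).mul (hc 1)))).add
        ((contDiffAt_const.sub (hrs y hy)).mul ((hc 2).mul (hc 2)))
    exact ((hd.sqrt (hm0 y hy).ne').inv (Real.sqrt_pos.2 (hm0 y hy)).ne').smul (hms y hy)
  have hnn : ∀ y ∈ F.target, diagForm (r (y 0)) (n y) (n y) = 1 := by
    intro y hy
    simp only [n, diagForm_smul_left, diagForm_smul_right, lam]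
    rw [← mul_assoc, ← mul_inv, Real.mul_self_sqrt (hm0 y hy).le, inv_mul_cancel₀ (hm0 y hy).ne']
  have hnv : ∀ y ∈ F.target, ∀ v, diagForm (r (y 0)) (n y) v = 0 ↔ fderiv ℝ F.symm y v 2 = 0 := by
    intro y hy v
    rw [← hmv y hy]
    simp only [n, diagForm_smul_left]
    simp [hlam0 y hy]
  have htp : ∀ x ∈ Ψ.source, x ∈ φ.source → x ∈ S → ∀ v : TangentSpace (𝓡 3) x,
      v ∈ tangentPlane S x ↔ diagForm (r (Ψ x 0)) (n (Ψ x)) (mvfderiv (𝓡 3) Ψ x v) = 0 := by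
    intro x hx hxφ hxS v
    have hy : Ψ x ∈ F.target := (hFt _).2 ⟨Ψ.map_source hx, by rwa [Ψ.left_inv hx]⟩
    rw [hnv _ hy, mem_tangentPlane_iff (i := 2) hφ hxφ
      (by filter_upwards [φ.open_source.mem_nhds hxφ] with z hz using hφS z hz)
      ((hφS x hxφ).1 hxS), mvfderiv_comp_chart hΨ hx (h := F.symm) ?_
      ((hFsd _ hy).differentiableAt (by simp))]
    filter_upwards [Ψ.open_source.mem_nhds hx] with z hz
    change φ z = φ (Ψ.symm (Ψ z))
    rw [Ψ.left_inv hz]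
  have hpar : ∀ y ∈ F.target, Ψ.symm y ∈ S → ∀ v, diagForm (r (y 0)) (n y) v = 0 →
      fderiv ℝ n y v + chris (r (y 0)) (deriv r (y 0)) v (n y) = 0 := by
    intro y hy hyS v hv
    obtain ⟨hyt, hyφ⟩ := (hFt y).1 hy
    have hx := Ψ.map_target hyt
    have hr := Ψ.right_inv hyt
    have hN : SmoothFieldAt (fld Ψ n) (Ψ.symm y) :=
      smoothFieldAt_fld hΨ hx (by rw [hr]; exact hns y hy)
    have h1 := hS.2 _ hyS (fld Ψ n) hN (by
      filter_upwards [Ψ.open_source.mem_nhds hx, φ.open_source.mem_nhds hyφ] with x hx hxφ hxS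
      have hxt : Ψ x ∈ F.target := (hFt _).2 ⟨Ψ.map_source hx, by rwa [Ψ.left_inv hx]⟩
      constructor
      · have h2 := h.inner_eq x hx (fld Ψ n x) (fld Ψ n x)
        rw [mvfderiv_fld hΨ hx, hnn _ hxt, real_inner_self_eq_norm_sq] at h2
        rw [← Real.sqrt_sq (norm_nonneg (fld Ψ n x)), h2, Real.sqrt_one]
      · intro u hu
        rw [htp x hx hxφ hxS] at hu
        rw [real_inner_comm, h.inner_eq x hx, mvfderiv_fld hΨ hx, hu]) (fld Ψ (fun _ => v) _)
      ((htp _ hx hyφ hyS _).2 (by rw [mvfderiv_fld hΨ hx, hr, hv]))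
    rw [neg_eq_zero, h.leviCivita_eq_zero_iff hx hN, mvfderiv_fld hΨ hx, mvfderiv_fld hΨ hx,
      hr] at h1
    have h5 : coordRep Ψ (fld Ψ n) =ᶠ[𝓝 y] n := by
      filter_upwards [Ψ.open_target.mem_nhds hyt] with z hz
      rw [coordRep, mvfderiv_fld hΨ (Ψ.map_target hz), Ψ.right_inv hz]
    rwa [h5.fderiv_eq] at h1
  have hz₀ : φ q ∈ F.source := (hFs _).2 ⟨φ.map_source hqφ, by rwa [φ.left_inv hqφ]⟩
  have hz₀2 : φ q 2 = 0 := (hφS q hqφ).1 hqS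
  have hFz₀ : F (φ q) = Ψ q := by
    change Ψ (φ.symm (φ q)) = _
    rw [φ.left_inv hqφ]
  obtain ⟨ε, hε, hball⟩ := Metric.mem_nhds_iff.1 (F.open_source.mem_nhds hz₀)
  have hPm : ∀ z ∈ Metric.ball (φ q) ε, slicePr z ∈ F.source := by
    intro z hz
    apply hball
    rw [mem_ball_iff_norm] at hz ⊢
    refine lt_of_le_of_lt ?_ hz
    have h1 : slicePr z - φ q = slicePr (z - φ q) := by rw [map_sub, slicePr_of_apply_two hz₀2]
    rw [h1]
    exact norm_slicePr_le _
  have hGd : ∀ z ∈ Metric.ball (φ q) ε, ∀ v, fderiv ℝ (fun z => F (slicePr z)) z v =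
      fderiv ℝ F (slicePr z) (slicePr v) := by
    intro z hz v
    have h1 := ((hFd _ (hPm z hz)).differentiableAt (by simp)).hasFDerivAt.comp z
      slicePr.hasFDerivAt
    exact DFunLike.congr_fun h1.fderiv v
  have hGS : ∀ z ∈ Metric.ball (φ q) ε, Ψ.symm (F (slicePr z)) ∈ S := by
    intro z hz
    obtain ⟨h1, h2⟩ := (hFs _).1 (hPm z hz)
    have h3 : Ψ.symm (F (slicePr z)) = φ.symm (slicePr z) := Ψ.left_inv h2
    rw [h3, hφS _ (φ.map_target h1), φ.right_inv h1, slicePr_apply_two]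
  have horth : ∀ z ∈ Metric.ball (φ q) ε, ∀ v, diagForm (r (F (slicePr z) 0)) (n (F (slicePr z)))
      (fderiv ℝ (fun z => F (slicePr z)) z v) = 0 := by
    intro z hz v
    rw [hnv _ (F.map_source (hPm z hz)), hGd z hz, hleft _ (hPm z hz), slicePr_apply_two]
  refine ⟨φ q, ε, fun z => F (slicePr z), fun z => n (F (slicePr z)), hε, ?_, ?_, ?_, ?_, ?_, horth,
    fun z hz => hnn _ (F.map_source (hPm z hz)), ?_, hGS, ?_, ?_⟩
  · beta_reduce
    rw [slicePr_of_apply_two hz₀2, hFz₀]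
  · exact fun z hz => ((hFt _).1 (F.map_source (hPm z hz))).1
  · exact fun z hz => (hFd _ (hPm z hz)).comp z slicePr.contDiff.contDiffAt
  · exact fun z hz => ContDiffAt.comp (g := n) (f := fun z => F (slicePr z)) z
      (hns _ (F.map_source (hPm z hz))) ((hFd _ (hPm z hz)).comp z slicePr.contDiff.contDiffAt)
  · intro z hz v
    have h1 : HasFDerivAt (fun z => F (slicePr z)) _ z :=
      (((hFd _ (hPm z hz)).comp z slicePr.contDiff.contDiffAt).differentiableAt
        (by simp)).hasFDerivAt
    have h2 := (((hns _ (F.map_source (hPm z hz))).differentiableAt (by simp)).hasFDerivAt).comp z h1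
    have h3 : fderiv ℝ (fun z => n (F (slicePr z))) z = _ := h2.fderiv
    rw [h3]
    exact eq_neg_of_add_eq_zero_left
      (hpar _ (F.map_source (hPm z hz)) (hGS z hz) _ (horth z hz v))
  · intro z hz w hw
    rw [hnv _ (F.map_source (hPm z hz))] at hw
    refine ⟨fderiv ℝ F.symm (F (slicePr z)) w, ?_⟩
    rw [hGd z hz, slicePr_of_apply_two hw]
    have h1 := hright _ (F.map_source (hPm z hz)) w
    rwa [F.left_inv (hPm z hz)] at h1
  · have hc := φ.continuousAt hqφ
    filter_upwards [φ.open_source.mem_nhds hqφ, hc.eventually (Metric.ball_mem_nhds _ hε)]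
      with x hx hxb hxS
    have h2 := (hφS x hx).1 hxS
    refine ⟨φ x, hxb, ?_⟩
    rw [slicePr_of_apply_two h2]
    change Ψ (φ.symm (φ x)) = _
    rw [φ.left_inv hx]
  · intro v
    beta_reduce
    rw [slicePr_of_apply_two hz₀2, hFz₀]
    exact htp q hq hqφ hqS v

end IsAdaptedChart

end NormalPatch
end

noncomputable section

/-! ### Curvature of the normal form -/

section ChristoffelDerivative

lemma hasFDerivAt_coord_comp {f : E3 → E3} {y : E3} (hf : DifferentiableAt ℝ f y) (i : Fin 3) :
    HasFDerivAt (fun z => f z i) ((EuclideanSpace.proj i : E3 →L[ℝ] ℝ).comp (fderiv ℝ f y)) y :=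
  (EuclideanSpace.proj i : E3 →L[ℝ] ℝ).hasFDerivAt.comp y hf.hasFDerivAt

lemma fderiv_coord_comp {f : E3 → E3} {y : E3} (hf : DifferentiableAt ℝ f y) (i : Fin 3) (v : E3) :
    fderiv ℝ (fun z => f z i) y v = fderiv ℝ f y v i :=
  DFunLike.congr_fun (hasFDerivAt_coord_comp hf i).fderiv v

/-- The derivative of `chris` with respect to the base point. -/
def chrisDeriv (ρ ρ' ρ'' σ : ℝ) (a b : E3) : E3 :=
  !₂[-(ρ'' / 2 * σ) * (a 1 * b 1 - a 2 * b 2),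
    (ρ'' / (2 * ρ) - ρ' ^ 2 / (2 * ρ ^ 2)) * σ * (a 0 * b 1 + a 1 * b 0),
    -(ρ'' / (2 * (1 - ρ)) + ρ' ^ 2 / (2 * (1 - ρ) ^ 2)) * σ * (a 0 * b 2 + a 2 * b 0)]

@[simp] lemma chrisDeriv_apply_zero (ρ ρ' ρ'' σ : ℝ) (a b : E3) :
    chrisDeriv ρ ρ' ρ'' σ a b 0 = -(ρ'' / 2 * σ) * (a 1 * b 1 - a 2 * b 2) := rfl

@[simp] lemma chrisDeriv_apply_one (ρ ρ' ρ'' σ : ℝ) (a b : E3) :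
    chrisDeriv ρ ρ' ρ'' σ a b 1 =
      (ρ'' / (2 * ρ) - ρ' ^ 2 / (2 * ρ ^ 2)) * σ * (a 0 * b 1 + a 1 * b 0) := rfl

@[simp] lemma chrisDeriv_apply_two (ρ ρ' ρ'' σ : ℝ) (a b : E3) :
    chrisDeriv ρ ρ' ρ'' σ a b 2 =
      -(ρ'' / (2 * (1 - ρ)) + ρ' ^ 2 / (2 * (1 - ρ) ^ 2)) * σ * (a 0 * b 2 + a 2 * b 0) := rfl

/-- The curvature of the metric `dx₀² + r(x₀) dx₁² + (1 - r(x₀)) dx₂²`. -/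
def curvVec (ρ ρ' ρ'' : ℝ) (a b c : E3) : E3 :=
  !₂[(-(ρ'' / 2) + ρ' ^ 2 / (4 * ρ)) * (a 0 * b 1 - a 1 * b 0) * c 1 +
      (ρ'' / 2 + ρ' ^ 2 / (4 * (1 - ρ))) * (a 0 * b 2 - a 2 * b 0) * c 2,
    -(-(ρ'' / (2 * ρ)) + ρ' ^ 2 / (4 * ρ ^ 2)) * (a 0 * b 1 - a 1 * b 0) * c 0 +
      ρ' ^ 2 / (4 * ρ) * (a 1 * b 2 - a 2 * b 1) * c 2,
    -(ρ'' / (2 * (1 - ρ)) + ρ' ^ 2 / (4 * (1 - ρ) ^ 2)) * (a 0 * b 2 - a 2 * b 0) * c 0 -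
      ρ' ^ 2 / (4 * (1 - ρ)) * (a 1 * b 2 - a 2 * b 1) * c 1]

@[simp] lemma curvVec_apply_zero (ρ ρ' ρ'' : ℝ) (a b c : E3) : curvVec ρ ρ' ρ'' a b c 0 =
    (-(ρ'' / 2) + ρ' ^ 2 / (4 * ρ)) * (a 0 * b 1 - a 1 * b 0) * c 1 +
      (ρ'' / 2 + ρ' ^ 2 / (4 * (1 - ρ))) * (a 0 * b 2 - a 2 * b 0) * c 2 := rfl

@[simp] lemma curvVec_apply_one (ρ ρ' ρ'' : ℝ) (a b c : E3) : curvVec ρ ρ' ρ'' a b c 1 =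
    -(-(ρ'' / (2 * ρ)) + ρ' ^ 2 / (4 * ρ ^ 2)) * (a 0 * b 1 - a 1 * b 0) * c 0 +
      ρ' ^ 2 / (4 * ρ) * (a 1 * b 2 - a 2 * b 1) * c 2 := rfl

@[simp] lemma curvVec_apply_two (ρ ρ' ρ'' : ℝ) (a b c : E3) : curvVec ρ ρ' ρ'' a b c 2 =
    -(ρ'' / (2 * (1 - ρ)) + ρ' ^ 2 / (4 * (1 - ρ) ^ 2)) * (a 0 * b 2 - a 2 * b 0) * c 0 -
      ρ' ^ 2 / (4 * (1 - ρ)) * (a 1 * b 2 - a 2 * b 1) * c 1 := rfl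

/-- The left-hand side is the coordinate formula `∂Γ - ∂Γ + ΓΓ - ΓΓ` for the curvature. -/
lemma curvVec_eq {ρ : ℝ} (h0 : ρ ≠ 0) (h1 : 1 - ρ ≠ 0) (ρ' ρ'' : ℝ) (a b c : E3) :
    chrisDeriv ρ ρ' ρ'' (a 0) b c - chrisDeriv ρ ρ' ρ'' (b 0) a c + chris ρ ρ' a (chris ρ ρ' b c)
      - chris ρ ρ' b (chris ρ ρ' a c) = curvVec ρ ρ' ρ'' a b c := by
  ext k
  fin_cases k
  · simp
    field_simp
    ring
  · simp
    field_simp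
    ring
  · simp
    field_simp
    ring

lemma chris_neg_right (ρ ρ' : ℝ) (a b : E3) : chris ρ ρ' a (-b) = -chris ρ ρ' a b := by
  ext k
  fin_cases k <;> simp <;> ring

lemma contDiffAt_deriv {r : ℝ → ℝ} {s : ℝ} (hr : ContDiffAt ℝ ∞ r s) :
    ContDiffAt ℝ ∞ (deriv r) s := by
  have h : ContDiffAt ℝ ∞ (fderiv ℝ r) s := hr.fderiv_right (by simp)
  exact h.clm_apply contDiffAt_const

variable {r : ℝ → ℝ}

lemma contDiffAt_chris {n : ℕ∞ω} (hn : n ≤ ∞) {z : E3} {f : E3 → ℝ} {a b : E3 → E3}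
    (hr : ContDiffAt ℝ ∞ r (f z))
    (h0 : r (f z) ≠ 0) (h1 : 1 - r (f z) ≠ 0) (hf : ContDiffAt ℝ n f z)
    (ha : ContDiffAt ℝ n a z) (hb : ContDiffAt ℝ n b z) :
    ContDiffAt ℝ n (fun z => chris (r (f z)) (deriv r (f z)) (a z) (b z)) z := by
  have hρ : ContDiffAt ℝ n (fun z => r (f z)) z := (hr.of_le hn).comp z hf
  have hρ' : ContDiffAt ℝ n (fun z => deriv r (f z)) z := ((contDiffAt_deriv hr).of_le hn).comp z hf
  have hac := contDiffAt_euclidean.1 ha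
  have hbc := contDiffAt_euclidean.1 hb
  rw [contDiffAt_euclidean]
  intro k
  fin_cases k
  · exact (hρ'.div_const 2).neg.mul (((hac 1).mul (hbc 1)).sub ((hac 2).mul (hbc 2)))
  · exact (hρ'.div (contDiffAt_const.mul hρ) (mul_ne_zero two_ne_zero h0)).mul
      (((hac 0).mul (hbc 1)).add ((hac 1).mul (hbc 0)))
  · exact (hρ'.div (contDiffAt_const.mul (contDiffAt_const.sub hρ))
      (mul_ne_zero two_ne_zero h1)).neg.mul
      (((hac 0).mul (hbc 2)).add ((hac 2).mul (hbc 0)))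

lemma fderiv_chris {z : E3} {f : E3 → ℝ} {a b : E3 → E3} (hr : ContDiffAt ℝ ∞ r (f z))
    (h0 : r (f z) ≠ 0) (h1 : 1 - r (f z) ≠ 0) (hf : ContDiffAt ℝ 1 f z)
    (ha : ContDiffAt ℝ 1 a z) (hb : ContDiffAt ℝ 1 b z) (v : E3) :
    fderiv ℝ (fun z => chris (r (f z)) (deriv r (f z)) (a z) (b z)) z v =
      chrisDeriv (r (f z)) (deriv r (f z)) (deriv (deriv r) (f z)) (fderiv ℝ f z v) (a z) (b z) +
        chris (r (f z)) (deriv r (f z)) (fderiv ℝ a z v) (b z) +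
        chris (r (f z)) (deriv r (f z)) (a z) (fderiv ℝ b z v) := by
  have hd : DifferentiableAt ℝ (fun z => chris (r (f z)) (deriv r (f z)) (a z) (b z)) z :=
    (contDiffAt_chris (n := 1) (by simp) hr h0 h1 hf ha hb).differentiableAt one_ne_zero
  have hρ := (hr.differentiableAt (by simp)).hasDerivAt.comp_hasFDerivAt z
    (hf.differentiableAt one_ne_zero).hasFDerivAt
  have hρ' := ((contDiffAt_deriv hr).differentiableAt (by simp)).hasDerivAt.comp_hasFDerivAt z
    (hf.differentiableAt one_ne_zero).hasFDerivAt
  have hac := hasFDerivAt_coord_comp (ha.differentiableAt one_ne_zero)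
  have hbc := hasFDerivAt_coord_comp (hb.differentiableAt one_ne_zero)
  ext k
  rw [← fderiv_coord_comp hd]
  fin_cases k
  · have h := (hρ'.mul_const 2⁻¹).neg.mul (((hac 1).mul (hbc 1)).sub ((hac 2).mul (hbc 2)))
    have h2 : (fun z => chris (r (f z)) (deriv r (f z)) (a z) (b z) 0) = fun z =>
        -(deriv r (f z) * 2⁻¹) * (a z 1 * b z 1 - a z 2 * b z 2) := by
      ext z
      rw [chris_apply_zero, div_eq_mul_inv]
    simp only [Fin.zero_eta]
    rw [h2]
    refine (DFunLike.congr_fun (HasFDerivAt.fderiv h) v).trans ?_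
    simp
    ring
  · have h := (hρ'.mul ((hasDerivAt_inv (mul_ne_zero two_ne_zero h0)).comp_hasFDerivAt z
      (hρ.const_mul 2))).mul (((hac 0).mul (hbc 1)).add ((hac 1).mul (hbc 0)))
    have h2 : (fun z => chris (r (f z)) (deriv r (f z)) (a z) (b z) 1) = fun z =>
        (deriv r (f z) * (2 * r (f z))⁻¹) * (a z 0 * b z 1 + a z 1 * b z 0) := by
      ext z
      rw [chris_apply_one, div_eq_mul_inv]
    simp only [Fin.mk_one]
    rw [h2]
    refine (DFunLike.congr_fun (HasFDerivAt.fderiv h) v).trans ?_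
    simp
    field_simp
    ring
  · have h := (hρ'.mul ((hasDerivAt_inv (mul_ne_zero two_ne_zero h1)).comp_hasFDerivAt z
      ((hρ.const_sub 1).const_mul 2))).neg.mul (((hac 0).mul (hbc 2)).add ((hac 2).mul (hbc 0)))
    have h2 : (fun z => chris (r (f z)) (deriv r (f z)) (a z) (b z) 2) = fun z =>
        -(deriv r (f z) * (2 * (1 - r (f z)))⁻¹) * (a z 0 * b z 2 + a z 2 * b z 0) := by
      ext z
      rw [chris_apply_two, div_eq_mul_inv]
    simp only [Fin.reduceFinMk]
    rw [h2]
    refine (DFunLike.congr_fun (HasFDerivAt.fderiv h) v).trans ?_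
    simp
    field_simp
    ring

end ChristoffelDerivative

/-- This vanishes identically if and only if the metric `ds² + r(s) dx₁² + (1 - r(s)) dx₂²` has
constant curvature. -/
def bending (r : ℝ → ℝ) (s : ℝ) : ℝ :=
  2 * r s * deriv (deriv r) s * (1 - r s) - deriv r s ^ 2 * (1 - 2 * r s)

/-! ### The curvature condition on the normal of a totally geodesic surface -/

section

variable {M : Type*} [TopologicalSpace M] [ChartedSpace E3 M] [IsManifold (𝓡 3) ∞ M]
variable {Ψ : OpenPartialHomeomorph M E3} {q p : M} {ξ : ∀ x : M, TangentSpace (𝓡 3) x} {S : Set M}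
variable [RiemannianBundle (fun x : M => TangentSpace (𝓡 3) x)]
variable {δ : ℝ} {r : ℝ → ℝ} {z₀ : E3} {ε : ℝ} {G β : E3 → E3}

namespace IsNormalPatch

lemma contDiffAt_r (P : IsNormalPatch Ψ r S q z₀ ε G β) (h : IsAdaptedChart ξ p Ψ δ r)
    {z : E3} (hz : z ∈ Metric.ball z₀ ε) : ContDiffAt ℝ ∞ r (G z 0) :=
  h.contDiffAt _ (h.abs_lt (P.mem_target z hz))

lemma r_pos (P : IsNormalPatch Ψ r S q z₀ ε G β) (h : IsAdaptedChart ξ p Ψ δ r)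
    {z : E3} (hz : z ∈ Metric.ball z₀ ε) : 0 < r (G z 0) :=
  h.pos _ (h.abs_lt (P.mem_target z hz))

lemma one_sub_r_pos (P : IsNormalPatch Ψ r S q z₀ ε G β) (h : IsAdaptedChart ξ p Ψ δ r)
    {z : E3} (hz : z ∈ Metric.ball z₀ ε) : 0 < 1 - r (G z 0) :=
  sub_pos.2 (h.lt_one _ (h.abs_lt (P.mem_target z hz)))

lemma center_mem (P : IsNormalPatch Ψ r S q z₀ ε G β) : z₀ ∈ Metric.ball z₀ ε :=
  Metric.mem_ball_self P.eps_pos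

lemma contDiffAt_coord_map (P : IsNormalPatch Ψ r S q z₀ ε G β) {z : E3}
    (hz : z ∈ Metric.ball z₀ ε) (i : Fin 3) : ContDiffAt ℝ ∞ (fun z => G z i) z :=
  contDiffAt_euclidean.1 (P.contDiffAt_map z hz) i

lemma fderiv_coord_map (P : IsNormalPatch Ψ r S q z₀ ε G β) {z : E3}
    (hz : z ∈ Metric.ball z₀ ε) (i : Fin 3) (v : E3) :
    fderiv ℝ (fun z => G z i) z v = fderiv ℝ G z v i :=
  fderiv_coord_comp ((P.contDiffAt_map z hz).differentiableAt (by simp)) i v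

lemma contDiffAt_fderiv_map (P : IsNormalPatch Ψ r S q z₀ ε G β) {z : E3}
    (hz : z ∈ Metric.ball z₀ ε) (v : E3) : ContDiffAt ℝ ∞ (fun z => fderiv ℝ G z v) z := by
  have h : ContDiffAt ℝ ∞ (fderiv ℝ G) z := (P.contDiffAt_map z hz).fderiv_right (by simp)
  exact h.clm_apply contDiffAt_const

lemma fderiv_fderiv_comm {f : E3 → E3} {z : E3} (hf : ContDiffAt ℝ ∞ f z) (v w : E3) :
    fderiv ℝ (fun z => fderiv ℝ f z v) z w = fderiv ℝ (fun z => fderiv ℝ f z w) z v := by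
  have h : ContDiffAt ℝ ∞ (fderiv ℝ f) z := hf.fderiv_right (by simp)
  have hd := h.differentiableAt (by simp)
  have hs := hf.isSymmSndFDerivAt
    (by rw [minSmoothness_of_isRCLikeNormedField]; exact WithTop.coe_le_coe.2 (le_top : (2 : ℕ∞) ≤ ⊤))
  rw [fderiv_clm_apply hd (differentiableAt_const v), fderiv_clm_apply hd (differentiableAt_const w)]
  simpa using hs w v

/-- The integrability condition of the equation for a parallel normal: equality of the mixed second
derivatives of `β` becomes `R(X, Y)N = 0` for all tangent `X`, `Y`. -/
lemma curvVec_normal (P : IsNormalPatch Ψ r S q z₀ ε G β) (h : IsAdaptedChart ξ p Ψ δ r)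
    {z : E3} (hz : z ∈ Metric.ball z₀ ε) (v w : E3) :
    curvVec (r (G z 0)) (deriv r (G z 0)) (deriv (deriv r) (G z 0)) (fderiv ℝ G z v)
      (fderiv ℝ G z w) (β z) = 0 := by
  have h0 := (P.r_pos h hz).ne'
  have h1 := (P.one_sub_r_pos h hz).ne'
  have key : ∀ v w : E3, fderiv ℝ (fun z => fderiv ℝ β z w) z v =
      -(chrisDeriv (r (G z 0)) (deriv r (G z 0)) (deriv (deriv r) (G z 0)) (fderiv ℝ G z v 0)
          (fderiv ℝ G z w) (β z) +
        chris (r (G z 0)) (deriv r (G z 0)) (fderiv ℝ (fun z => fderiv ℝ G z w) z v) (β z) -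
        chris (r (G z 0)) (deriv r (G z 0)) (fderiv ℝ G z w)
          (chris (r (G z 0)) (deriv r (G z 0)) (fderiv ℝ G z v) (β z))) := by
    intro v w
    have h2 : (fun z => fderiv ℝ β z w) =ᶠ[𝓝 z] fun z =>
        -chris (r (G z 0)) (deriv r (G z 0)) (fderiv ℝ G z w) (β z) := by
      filter_upwards [Metric.isOpen_ball.mem_nhds hz] with y hy using P.parallel y hy w
    rw [h2.fderiv_eq, fderiv_fun_neg, neg_apply, fderiv_chris (P.contDiffAt_r h hz) h0 h1
      ((P.contDiffAt_coord_map hz 0).of_le (by simp))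
      ((P.contDiffAt_fderiv_map hz w).of_le (by simp))
      ((P.contDiffAt_normal z hz).of_le (by simp)), P.parallel z hz v, chris_neg_right,
      P.fderiv_coord_map hz, ← sub_eq_add_neg]
  have h3 := fderiv_fderiv_comm (P.contDiffAt_normal z hz) w v
  rw [key v w, key w v, fderiv_fderiv_comm (P.contDiffAt_map z hz) w v] at h3
  rw [← curvVec_eq h0 h1]
  rw [← sub_eq_zero] at h3
  rw [← neg_eq_zero, ← h3]
  abel

/-- The curvatures of the coordinate planes satisfy `K₀₁ - K₁₂ = -bending / (4r²(1 - r))` and `K₀₂ -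
K₁₂ = bending / (4r(1 - r)²)`. Where `bending` is nonzero they are pairwise distinct, and `R(X, Y)N
= 0` on the plane orthogonal to `N` forces `N` to be an eigendirection, that is, a coordinate
direction. -/
lemma mul_eq_zero_of_bending_ne (P : IsNormalPatch Ψ r S q z₀ ε G β) (h : IsAdaptedChart ξ p Ψ δ r)
    {z : E3} (hz : z ∈ Metric.ball z₀ ε) (hA : bending r (G z 0) ≠ 0) :
    β z 0 * β z 1 = 0 ∧ β z 0 * β z 2 = 0 ∧ β z 1 * β z 2 = 0 := by
  have h0 := (P.r_pos h hz).ne'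
  have h1 := (P.one_sub_r_pos h hz).ne'
  have hR : ∀ a b : E3, diagForm (r (G z 0)) (β z) a = 0 → diagForm (r (G z 0)) (β z) b = 0 →
      curvVec (r (G z 0)) (deriv r (G z 0)) (deriv (deriv r) (G z 0)) a b (β z) = 0 := by
    intro a b ha hb
    obtain ⟨v, rfl⟩ := P.surj z hz a ha
    obtain ⟨w, rfl⟩ := P.surj z hz b hb
    exact P.curvVec_normal h hz v w
  have hne : ∃ k, β z k ≠ 0 := by
    by_contra! h2
    have h3 := P.unit z hz
    simp [diagForm, h2] at h3
  set ρ := r (G z 0)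
  set ρ' := deriv r (G z 0)
  set ρ'' := deriv (deriv r) (G z 0)
  -- The conormal. The vectors `u0`, `u1`, `u2` below span its kernel, and the cross product of two
  -- of them is `n k` times the conormal; `k` is chosen with `β z k ≠ 0`.
  set n : Fin 3 → ℝ := ![β z 0, ρ * β z 1, (1 - ρ) * β z 2] with hn
  have hA' : 2 * ρ * ρ'' * (1 - ρ) - ρ' ^ 2 * (1 - 2 * ρ) ≠ 0 := hA
  let u0 : E3 := !₂[0, n 2, -n 1]
  let u1 : E3 := !₂[-n 2, 0, n 0]
  let u2 : E3 := !₂[n 1, -n 0, 0]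
  have e0 : diagForm ρ (β z) u0 = 0 := by simp [diagForm, u0, n]; ring
  have e1 : diagForm ρ (β z) u1 = 0 := by simp [diagForm, u1, n]; ring
  have e2 : diagForm ρ (β z) u2 = 0 := by simp [diagForm, u2, n]; ring
  have main : ∀ t : ℝ, t ≠ 0 → ∀ a b : E3, diagForm ρ (β z) a = 0 → diagForm ρ (β z) b = 0 →
      a 1 * b 2 - a 2 * b 1 = t * n 0 → a 0 * b 2 - a 2 * b 0 = -(t * n 1) →
      a 0 * b 1 - a 1 * b 0 = t * n 2 →
      β z 0 * β z 1 = 0 ∧ β z 0 * β z 2 = 0 ∧ β z 1 * β z 2 = 0 := by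
    intro t ht a b ha hb h12 h02 h01
    have hc := hR a b ha hb
    have c0 := congrArg (fun v : E3 => v 0) hc
    have c1 := congrArg (fun v : E3 => v 1) hc
    have c2 := congrArg (fun v : E3 => v 2) hc
    simp only [curvVec_apply_zero, curvVec_apply_one, curvVec_apply_two, h12, h02, h01, n,
      Matrix.cons_val_zero, Matrix.cons_val_one, Matrix.cons_val, PiLp.zero_apply] at c0 c1 c2
    field_simp at c0 c1 c2
    refine ⟨?_, ?_, ?_⟩
    · have : (t * (2 * ρ * ρ'' * (1 - ρ) - ρ' ^ 2 * (1 - 2 * ρ))) * (β z 0 * β z 1) = 0 := by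
        linear_combination c2 / 2
      exact (mul_eq_zero.1 this).resolve_left (mul_ne_zero ht hA')
    · have : (t * (2 * ρ * ρ'' * (1 - ρ) - ρ' ^ 2 * (1 - 2 * ρ))) * (β z 0 * β z 2) = 0 := by
        linear_combination c1 / 2
      exact (mul_eq_zero.1 this).resolve_left (mul_ne_zero ht hA')
    · have : (t * (2 * ρ * ρ'' * (1 - ρ) - ρ' ^ 2 * (1 - 2 * ρ))) * (β z 1 * β z 2) = 0 := by
        linear_combination -c0 / 2
      exact (mul_eq_zero.1 this).resolve_left (mul_ne_zero ht hA')
  obtain ⟨k, hk⟩ := hne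
  fin_cases k
  · exact main (n 0) hk u1 u2 e1 e2 (by simp [u1, u2, n]) (by simp [u1, u2, n])
      (by simp [u1, u2, n]; ring)
  · exact main (n 1) (mul_ne_zero h0 hk) u2 u0 e2 e0 (by simp [u0, u2, n]; ring)
      (by simp [u0, u2, n]) (by simp [u0, u2, n])
  · exact main (n 2) (mul_ne_zero h1 hk) u0 u1 e0 e1 (by simp [u0, u1, n])
      (by simp [u0, u1, n]; ring) (by simp [u0, u1, n])

end IsNormalPatch

end
end

noncomputable section

/-! ### Values of a function near a nondegenerate critical point -/

section OneVariable

/-- To the right of a critical point with positive second derivative `f` is strictly increasing, so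
every value slightly above `f 0` is taken at a point with `f' ≠ 0`. -/
lemma eventually_exists_of_deriv_pos {f f' : ℝ → ℝ} {c : ℝ} (hf : ∀ᶠ t in 𝓝 (0 : ℝ), HasDerivAt f (f' t) t)
    (h0 : f' 0 = 0) (hc : HasDerivAt f' c 0) (hpos : 0 < c) {P : ℝ → Prop}
    (hP : ∀ᶠ t in 𝓝 (0 : ℝ), f' t ≠ 0 → P (f t)) : ∀ᶠ s in 𝓝[>] (f 0), P s := by
  have h1 : ∀ᶠ t in 𝓝[>] (0 : ℝ), 0 < f' t := by
    have h2 := hasDerivAt_iff_tendsto_slope.1 hc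
    have h3 := (h2.mono_left (nhdsWithin_mono 0 (fun t (ht : 0 < t) => ht.ne' : Set.Ioi (0 : ℝ) ⊆ {0}ᶜ))).eventually
      (lt_mem_nhds hpos)
    filter_upwards [h3, self_mem_nhdsWithin] with t ht ht0
    rw [slope_def_field, h0, sub_zero, sub_zero] at ht
    have := mul_pos ht (ht0 : 0 < t)
    rwa [div_mul_cancel₀ _ (ht0 : 0 < t).ne'] at this
  obtain ⟨u, hu, hu1⟩ := mem_nhdsGT_iff_exists_Ioo_subset.1 h1
  obtain ⟨ε, hε, hb⟩ := Metric.eventually_nhds_iff_ball.1 (hf.and hP)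
  have hu0 : 0 < u := hu
  set m := min (u / 2) (ε / 2)
  have hm : 0 < m := by positivity
  have hmu : m < u := (min_le_left _ _).trans_lt (by linarith)
  have hmε : m < ε := (min_le_right _ _).trans_lt (by linarith)
  have hball : ∀ t ∈ Set.Icc 0 m, t ∈ Metric.ball (0 : ℝ) ε := fun t ht => by
    rw [mem_ball_zero_iff, Real.norm_eq_abs, abs_of_nonneg ht.1]
    exact ht.2.trans_lt hmε
  have hcont : ContinuousOn f (Set.Icc 0 m) := fun t ht =>
    (hb t (hball t ht)).1.continuousAt.continuousWithinAt
  have hmono : StrictMonoOn f (Set.Icc 0 m) := by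
    refine strictMonoOn_of_deriv_pos (convex_Icc _ _) hcont fun t ht => ?_
    rw [interior_Icc] at ht
    rw [(hb t (hball t ⟨ht.1.le, ht.2.le⟩)).1.deriv]
    exact hu1 ⟨ht.1, ht.2.trans hmu⟩
  have hlt : f 0 < f m := hmono ⟨le_rfl, hm.le⟩ ⟨hm.le, le_rfl⟩ hm
  filter_upwards [Ioo_mem_nhdsGT hlt] with s hs
  obtain ⟨t, ht, rfl⟩ := intermediate_value_Ioo hm.le hcont hs
  exact (hb t (hball t ⟨ht.1.le, ht.2.le⟩)).2 (hu1 ⟨ht.1, ht.2.trans hmu⟩ : 0 < f' t).ne'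

lemma eventually_exists_of_deriv_neg {f f' : ℝ → ℝ} {c : ℝ} (hf : ∀ᶠ t in 𝓝 (0 : ℝ), HasDerivAt f (f' t) t)
    (h0 : f' 0 = 0) (hc : HasDerivAt f' c 0) (hneg : c < 0) {P : ℝ → Prop}
    (hP : ∀ᶠ t in 𝓝 (0 : ℝ), f' t ≠ 0 → P (f t)) : ∀ᶠ s in 𝓝[<] (f 0), P s := by
  have h1 := eventually_exists_of_deriv_pos (f := fun t => -f t) (f' := fun t => -f' t) (c := -c)
    (hf.mono fun t ht => ht.neg) (by simp [h0]) hc.neg (by linarith) (P := fun s => P (-s))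
    (hP.mono fun t ht h => by
      rw [neg_neg]
      exact ht (neg_ne_zero.1 h))
  have h2 : Tendsto (fun s : ℝ => -s) (𝓝[<] (f 0)) (𝓝[>] (-f 0)) := tendsto_neg_nhdsLT
  filter_upwards [h2.eventually h1] with s hs
  rwa [neg_neg] at hs

end OneVariable

/-! ### Rigidity of totally geodesic surfaces in an adapted chart -/

section

variable {M : Type*} [TopologicalSpace M] [ChartedSpace E3 M] [IsManifold (𝓡 3) ∞ M]
variable {Ψ : OpenPartialHomeomorph M E3} {q p : M} {ξ : ∀ x : M, TangentSpace (𝓡 3) x} {S : Set M}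
variable [RiemannianBundle (fun x : M => TangentSpace (𝓡 3) x)]
variable {δ : ℝ} {r : ℝ → ℝ} {z₀ : E3} {ε : ℝ} {G β : E3 → E3}

namespace IsNormalPatch

lemma contDiffAt_coord_normal (P : IsNormalPatch Ψ r S q z₀ ε G β) {z : E3}
    (hz : z ∈ Metric.ball z₀ ε) (i : Fin 3) : ContDiffAt ℝ ∞ (fun z => β z i) z :=
  contDiffAt_euclidean.1 (P.contDiffAt_normal z hz) i

lemma exists_fderiv_ne_zero (P : IsNormalPatch Ψ r S q z₀ ε G β) (h : IsAdaptedChart ξ p Ψ δ r)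
    {z : E3} (hz : z ∈ Metric.ball z₀ ε) (hβ : ¬ (β z 1 = 0 ∧ β z 2 = 0)) :
    ∃ v, fderiv ℝ G z v 0 = 1 := by
  have h0 := (P.r_pos h hz).ne'
  have h1 := (P.one_sub_r_pos h hz).ne'
  by_cases h2 : β z 1 = 0
  · have h3 : β z 2 ≠ 0 := fun h3 => hβ ⟨h2, h3⟩
    obtain ⟨v, hv⟩ := P.surj z hz (stdVec 0 - (β z 0 / ((1 - r (G z 0)) * β z 2)) • stdVec 2) (by
      simp [diagForm]
      field_simp
      ring)
    exact ⟨v, by rw [hv]; simp⟩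
  · obtain ⟨v, hv⟩ := P.surj z hz (stdVec 0 - (β z 0 / (r (G z 0) * β z 1)) • stdVec 1) (by
      simp [diagForm]
      field_simp
      ring)
    exact ⟨v, by rw [hv]; simp⟩

/-- If the normal is not along `∂₀`, then `x₀` is a submersion on the surface. So a property of `r`
that holds at values of `x₀` arbitrarily close to the centre is met on the surface arbitrarily close
to the centre. -/
lemma map_nhds_coord_zero (P : IsNormalPatch Ψ r S q z₀ ε G β) (h : IsAdaptedChart ξ p Ψ δ r)
    {z : E3} (hz : z ∈ Metric.ball z₀ ε) (hβ : ¬ (β z 1 = 0 ∧ β z 2 = 0)) :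
    Filter.map (fun z => G z 0) (𝓝 z) = 𝓝 (G z 0) := by
  obtain ⟨v, hv⟩ := P.exists_fderiv_ne_zero h hz hβ
  refine ((P.contDiffAt_coord_map hz 0).hasStrictFDerivAt (by simp)).map_nhds_eq_of_surj ?_
  rw [LinearMap.range_eq_top]
  intro t
  refine ⟨t • v, ?_⟩
  simp [P.fderiv_coord_map hz, hv]

/-- If the metric does not have constant curvature near `q`, the normal of a totally geodesic
surface which is not proportional to the first coordinate field is proportional to a coordinate
field. -/
lemma mul_eq_zero_of_frequently (P : IsNormalPatch Ψ r S q z₀ ε G β)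
    (h : IsAdaptedChart ξ p Ψ δ r) (hA : ∃ᶠ s in 𝓝 (Ψ q 0), bending r s ≠ 0)
    (hβ : ¬ (β z₀ 1 = 0 ∧ β z₀ 2 = 0)) :
    β z₀ 0 * β z₀ 1 = 0 ∧ β z₀ 0 * β z₀ 2 = 0 ∧ β z₀ 1 * β z₀ 2 = 0 := by
  have hz := P.center_mem
  rw [← P.map_center, ← P.map_nhds_coord_zero h hz hβ, frequently_map] at hA
  have h1 : ∃ᶠ z in 𝓝 z₀, β z 0 * β z 1 = 0 ∧ β z 0 * β z 2 = 0 ∧ β z 1 * β z 2 = 0 :=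
    (hA.and_eventually (Metric.isOpen_ball.mem_nhds hz)).mono
      fun z hz => P.mul_eq_zero_of_bending_ne h hz.2 hz.1
  have hc := fun i => (P.contDiffAt_coord_normal hz i).continuousAt
  have key : ∀ i j : Fin 3, (∃ᶠ z in 𝓝 z₀, β z i * β z j = 0) → β z₀ i * β z₀ j = 0 := by
    intro i j hf
    by_contra hne
    exact hf (((hc i).mul (hc j)).eventually_ne hne)
  exact ⟨key 0 1 (h1.mono fun z hz => hz.1), key 0 2 (h1.mono fun z hz => hz.2.1),
    key 1 2 (h1.mono fun z hz => hz.2.2)⟩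

/-- Otherwise the normal, having a nonzero `∂₀` component, would be along `∂₀`, and `dx₀` would
vanish on the surface. -/
lemma bending_eq_zero_of_fderiv_ne (P : IsNormalPatch Ψ r S q z₀ ε G β)
    (h : IsAdaptedChart ξ p Ψ δ r) {z : E3} (hz : z ∈ Metric.ball z₀ ε) (h0 : β z 0 ≠ 0) {v : E3}
    (hv : fderiv ℝ G z v 0 ≠ 0) : bending r (G z 0) = 0 := by
  by_contra hA
  obtain ⟨h1, h2, -⟩ := P.mul_eq_zero_of_bending_ne h hz hA
  have h3 := P.orthogonal z hz v
  rw [diagForm, (mul_eq_zero.1 h1).resolve_left h0, (mul_eq_zero.1 h2).resolve_left h0] at h3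
  simp only [zero_mul, mul_zero, add_zero] at h3
  exact hv ((mul_eq_zero.1 h3).resolve_left h0)

/-- If the normal is proportional to the first coordinate field, the metric has constant
curvature, unless `r` has a critical point. -/
lemma eventually_bending_eq_zero (P : IsNormalPatch Ψ r S q z₀ ε G β)
    (h : IsAdaptedChart ξ p Ψ δ r) (hβ : β z₀ 1 = 0 ∧ β z₀ 2 = 0) (hr : deriv r (Ψ q 0) ≠ 0) :
    ∀ᶠ s in 𝓝 (Ψ q 0), bending r s = 0 := by
  have hz := P.center_mem
  have hrd := P.contDiffAt_r h hz
  rw [← P.map_center] at hr ⊢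
  have h0 : β z₀ 0 ≠ 0 := by
    intro h0
    have h1 := P.unit z₀ hz
    simp [diagForm, h0, hβ] at h1
  have hρ0 := (P.r_pos h hz).ne'
  have hρ1 := (P.one_sub_r_pos h hz).ne'
  set ρ' := deriv r (G z₀ 0)
  have hev : ∀ᶠ z in 𝓝 z₀, z ∈ Metric.ball z₀ ε ∧ β z 0 ≠ 0 :=
    (Metric.isOpen_ball.eventually_mem hz).and
      ((P.contDiffAt_coord_normal hz 0).continuousAt.eventually_ne h0)
  -- Differentiate `⟨N, ∂_v G⟩ = 0` along `v` and insert that `N` is parallel. The result is the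
  -- second fundamental form of the level set of `x₀`, which has opposite signs on `∂₁` and `∂₂`.
  have second : ∀ v, fderiv ℝ G z₀ v 0 = 0 → fderiv ℝ (fun z => fderiv ℝ G z v) z₀ v 0 =
      ρ' / 2 * (fderiv ℝ G z₀ v 1 ^ 2 - fderiv ℝ G z₀ v 2 ^ 2) := by
    intro v hv
    have hβd := hasFDerivAt_coord_comp ((P.contDiffAt_normal z₀ hz).differentiableAt (by simp))
    have hGd := hasFDerivAt_coord_comp ((P.contDiffAt_fderiv_map hz v).differentiableAt (by simp))
    have hρd := (hrd.differentiableAt (by simp)).hasDerivAt.comp_hasFDerivAt z₀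
      (hasFDerivAt_coord_comp ((P.contDiffAt_map z₀ hz).differentiableAt (by simp)) 0)
    have h4 : HasFDerivAt (fun z => diagForm (r (G z 0)) (β z) (fderiv ℝ G z v)) _ z₀ :=
      (((hβd 0).mul (hGd 0)).add (hρd.mul ((hβd 1).mul (hGd 1)))).add
        ((hρd.const_sub 1).mul ((hβd 2).mul (hGd 2)))
    have h5 : (fun z => diagForm (r (G z 0)) (β z) (fderiv ℝ G z v)) =ᶠ[𝓝 z₀] fun _ => 0 := by
      filter_upwards [hev] with z hz using P.orthogonal z hz.1 v
    have h6 := DFunLike.congr_fun (h4.fderiv.symm.trans h5.fderiv_eq) v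
    simp [P.parallel z₀ hz v, hv, hβ.1, hβ.2] at h6
    have h7 : β z₀ 0 * (fderiv ℝ (fun z => fderiv ℝ G z v) z₀ v 0 -
        ρ' / 2 * (fderiv ℝ G z₀ v 1 ^ 2 - fderiv ℝ G z₀ v 2 ^ 2)) = 0 := by
      rw [← h6]
      field_simp
      ring
    linarith [(mul_eq_zero.1 h7).resolve_left h0]
  have line : ∀ v : E3, HasDerivAt (fun t : ℝ => z₀ + t • v) v 0 ∧
      ∀ᶠ t : ℝ in 𝓝 0, z₀ + t • v ∈ Metric.ball z₀ ε ∧ β (z₀ + t • v) 0 ≠ 0 := by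
    intro v
    have h1 : HasDerivAt (fun t : ℝ => z₀ + t • v) v 0 := by
      simpa using ((hasDerivAt_id (0 : ℝ)).smul_const v).const_add z₀
    refine ⟨h1, ?_⟩
    have h2 := h1.continuousAt
    rw [ContinuousAt, zero_smul, add_zero] at h2
    exact h2.eventually hev
  have curve : ∀ v : E3,
      (∀ᶠ t : ℝ in 𝓝 0, HasDerivAt (fun t : ℝ => G (z₀ + t • v) 0)
        (fderiv ℝ G (z₀ + t • v) v 0) t) ∧
      HasDerivAt (fun t : ℝ => fderiv ℝ G (z₀ + t • v) v 0)
        (fderiv ℝ (fun z => fderiv ℝ G z v) z₀ v 0) 0 ∧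
      ∀ᶠ t : ℝ in 𝓝 0, fderiv ℝ G (z₀ + t • v) v 0 ≠ 0 → bending r (G (z₀ + t • v) 0) = 0 := by
    intro v
    obtain ⟨h1, h2⟩ := line v
    refine ⟨?_, ?_, ?_⟩
    · filter_upwards [h2] with t ht
      have h3 : HasDerivAt (fun t : ℝ => z₀ + t • v) v t := by
        simpa using ((hasDerivAt_id t).smul_const v).const_add z₀
      exact (hasFDerivAt_coord_comp ((P.contDiffAt_map _ ht.1).differentiableAt
        (by simp)) 0).comp_hasDerivAt t h3
    · have h3 := hasFDerivAt_coord_comp ((P.contDiffAt_fderiv_map hz v).differentiableAt (by simp)) 0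
      have h4 : z₀ = z₀ + (0 : ℝ) • v := by simp
      rw [h4] at h3
      have h5 := h3.comp_hasDerivAt (0 : ℝ) h1
      rw [← h4] at h5
      exact h5
    · filter_upwards [h2] with t ht hne using P.bending_eq_zero_of_fderiv_ne h ht.1 ht.2 hne
  obtain ⟨v1, hv1⟩ := P.surj z₀ hz (stdVec 1) (by simp [diagForm, hβ.1])
  obtain ⟨v2, hv2⟩ := P.surj z₀ hz (stdVec 2) (by simp [diagForm, hβ.2])
  have s1 := second v1 (by rw [hv1]; simp)
  have s2 := second v2 (by rw [hv2]; simp)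
  rw [hv1] at s1
  rw [hv2] at s2
  simp at s1 s2
  obtain ⟨a1, b1, c1⟩ := curve v1
  obtain ⟨a2, b2, c2⟩ := curve v2
  have z1 : fderiv ℝ G (z₀ + (0 : ℝ) • v1) v1 0 = 0 := by rw [zero_smul, add_zero, hv1]; simp
  have z2 : fderiv ℝ G (z₀ + (0 : ℝ) • v2) v2 0 = 0 := by rw [zero_smul, add_zero, hv2]; simp
  -- Along one of the curves `x₀` has a strict minimum, along the other a strict maximum; which is
  -- which depends on the sign of `r'`.
  have both : (∀ᶠ s in 𝓝[>] (G z₀ 0), bending r s = 0) ∧ ∀ᶠ s in 𝓝[<] (G z₀ 0), bending r s = 0 := by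
    rcases lt_or_gt_of_ne hr with hneg | hpos
    · have p1 := eventually_exists_of_deriv_pos (P := fun s => bending r s = 0) a2 z2 b2 (by rw [s2]; linarith) c2
      have p2 := eventually_exists_of_deriv_neg (P := fun s => bending r s = 0) a1 z1 b1 (by rw [s1]; linarith) c1
      rw [zero_smul, add_zero] at p1 p2
      exact ⟨p1, p2⟩
    · have p1 := eventually_exists_of_deriv_pos (P := fun s => bending r s = 0) a1 z1 b1 (by rw [s1]; linarith) c1
      have p2 := eventually_exists_of_deriv_neg (P := fun s => bending r s = 0) a2 z2 b2 (by rw [s2]; linarith) c2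
      rw [zero_smul, add_zero] at p1 p2
      exact ⟨p1, p2⟩
  have hne : ∀ᶠ s in 𝓝[≠] (G z₀ 0), bending r s = 0 := by
    rw [← Set.Iio_union_Ioi, nhdsWithin_union, eventually_sup]
    exact ⟨both.2, both.1⟩
  have hcA : ContinuousAt (bending r) (G z₀ 0) := by
    have c0 := hrd.continuousAt
    have c1 := (contDiffAt_deriv hrd).continuousAt
    have c2 := (contDiffAt_deriv (contDiffAt_deriv hrd)).continuousAt
    unfold bending
    fun_prop
  have hat : bending r (G z₀ 0) = 0 := by
    by_contra hA
    have h1 := (hcA.eventually_ne hA).filter_mono (nhdsWithin_le_nhds (s := {G z₀ 0}ᶜ))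
    obtain ⟨s, hs1, hs2⟩ := (h1.and hne).exists
    exact hs1 hs2
  rw [eventually_nhdsWithin_iff] at hne
  filter_upwards [hne] with s hs
  by_cases hs0 : s = G z₀ 0
  · rw [hs0, hat]
  · exact hs hs0

/-- Uniqueness of the totally geodesic surface with given tangent plane. Along a ray from `z₀` the
pair `(β₀, β₁)` solves a homogeneous linear differential equation, so Grönwall's inequality keeps it
zero. -/
lemma normal_eq_zero_on_ball (P : IsNormalPatch Ψ r S q z₀ ε G β) (h : IsAdaptedChart ξ p Ψ δ r)
    (h0 : β z₀ 0 = 0) (h1 : β z₀ 1 = 0) {z : E3} (hz : z ∈ Metric.ball z₀ ε) :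
    β z 0 = 0 ∧ β z 1 = 0 := by
  set v := z - z₀
  have hmem : ∀ t ∈ Set.Icc (0 : ℝ) 1, z₀ + t • v ∈ Metric.ball z₀ ε := fun t ht =>
    (convex_ball z₀ ε).add_smul_sub_mem P.center_mem hz ht
  have hline : ∀ t, HasDerivAt (fun t : ℝ => z₀ + t • v) v t := fun t => by
    simpa using ((hasDerivAt_id t).smul_const v).const_add z₀
  let w : ℝ → E3 := fun t => fderiv ℝ G (z₀ + t • v) v
  let ρ : ℝ → ℝ := fun t => r (G (z₀ + t • v) 0)
  let ρ' : ℝ → ℝ := fun t => deriv r (G (z₀ + t • v) 0)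
  -- The equation for `β₀` contains `w₂ β₂`; orthogonality of `β` and `w` expresses this product
  -- through `β₀` and `β₁`, which yields `A` and `B`.
  let A : ℝ → ℝ := fun t => ρ' t / 2 * (w t 0 / (1 - ρ t))
  let B : ℝ → ℝ := fun t => ρ' t / 2 * (w t 1 / (1 - ρ t))
  let C : ℝ → ℝ := fun t => -(ρ' t / (2 * ρ t)) * w t 1
  let D : ℝ → ℝ := fun t => -(ρ' t / (2 * ρ t)) * w t 0
  let f : ℝ → ℝ × ℝ := fun t => (β (z₀ + t • v) 0, β (z₀ + t • v) 1)
  let f' : ℝ → ℝ × ℝ := fun t => (A t * (f t).1 + B t * (f t).2, C t * (f t).1 + D t * (f t).2)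
  have hd : ∀ t ∈ Set.Icc (0 : ℝ) 1, HasDerivAt f (f' t) t := by
    intro t ht
    have hm := hmem t ht
    have e0 := (P.r_pos h hm).ne'
    have e1 := (P.one_sub_r_pos h hm).ne'
    have hb := fun i => (hasFDerivAt_coord_comp ((P.contDiffAt_normal _ hm).differentiableAt
      (by simp)) i).comp_hasDerivAt t (hline t)
    have ho := P.orthogonal _ hm v
    have hb' := (hb 0).prodMk (hb 1)
    refine hb'.congr_deriv ?_
    ext
    · simp only [ContinuousLinearMap.comp_apply, P.parallel _ hm v, f', f, A, B, ρ, ρ', w]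
      simp only [diagForm] at ho
      simp
      field_simp
      linear_combination (-deriv r (G (z₀ + t • v) 0)) * ho
    · simp only [ContinuousLinearMap.comp_apply, P.parallel _ hm v, f', f, C, D, ρ, ρ', w]
      simp
      ring
  have hcont : ContinuousOn (fun t => |A t| + |B t| + |C t| + |D t|) (Set.Icc 0 1) := by
    intro t ht
    have hm := hmem t ht
    have e0 := (P.r_pos h hm).ne'
    have e1 := (P.one_sub_r_pos h hm).ne'
    have cl := (hline t).continuousAt
    have cw : ContinuousAt w t := ContinuousAt.comp (f := fun t : ℝ => z₀ + t • v)
      (g := fun z => fderiv ℝ G z v) (P.contDiffAt_fderiv_map hm v).continuousAt cl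
    have cw' : ∀ i, ContinuousAt (fun t => w t i) t := fun i =>
      (EuclideanSpace.proj i : E3 →L[ℝ] ℝ).continuous.continuousAt.comp cw
    have cg : ContinuousAt (fun t : ℝ => G (z₀ + t • v) 0) t :=
      ContinuousAt.comp (f := fun t : ℝ => z₀ + t • v) (g := fun z => G z 0)
        (P.contDiffAt_coord_map hm 0).continuousAt cl
    have cρ : ContinuousAt ρ t := ContinuousAt.comp (g := r) (P.contDiffAt_r h hm).continuousAt cg
    have cρ' : ContinuousAt ρ' t := ContinuousAt.comp (g := deriv r)
      (contDiffAt_deriv (P.contDiffAt_r h hm)).continuousAt cg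
    have cA : ContinuousAt A t := (cρ'.div_const 2).mul ((cw' 0).div (continuousAt_const.sub cρ) e1)
    have cB : ContinuousAt B t := (cρ'.div_const 2).mul ((cw' 1).div (continuousAt_const.sub cρ) e1)
    have ck : ContinuousAt (fun t => -(ρ' t / (2 * ρ t))) t :=
      (cρ'.div (continuousAt_const.mul cρ) (mul_ne_zero two_ne_zero e0)).neg
    exact (((cA.abs.add cB.abs).add (ck.mul (cw' 1)).abs).add
      (ck.mul (cw' 0)).abs).continuousWithinAt
  obtain ⟨K, hK⟩ := isCompact_Icc.exists_bound_of_continuousOn hcont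
  have hbound : ∀ t ∈ Set.Ico (0 : ℝ) 1, ‖f' t‖ ≤ K * ‖f t‖ := by
    intro t ht
    have h2 := hK t ⟨ht.1, ht.2.le⟩
    rw [Real.norm_eq_abs, abs_of_nonneg (by positivity)] at h2
    have n1 : |(f t).1| ≤ ‖f t‖ := norm_fst_le (f t)
    have n2 : |(f t).2| ≤ ‖f t‖ := norm_snd_le (f t)
    have n0 := norm_nonneg (f t)
    have gen : ∀ a b : ℝ, |a| + |b| ≤ K → |a * (f t).1 + b * (f t).2| ≤ K * ‖f t‖ := by
      intro a b hab
      calc |a * (f t).1 + b * (f t).2| ≤ |a| * |(f t).1| + |b| * |(f t).2| := by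
            rw [← abs_mul, ← abs_mul]
            exact abs_add_le _ _
        _ ≤ |a| * ‖f t‖ + |b| * ‖f t‖ := by gcongr
        _ = (|a| + |b|) * ‖f t‖ := by ring
        _ ≤ K * ‖f t‖ := by gcongr
    rw [Prod.norm_def]
    refine max_le (gen _ _ ?_) (gen _ _ ?_)
    · linarith [abs_nonneg (C t), abs_nonneg (D t)]
    · linarith [abs_nonneg (A t), abs_nonneg (B t)]
  have hfin := eq_zero_of_abs_deriv_le_mul_abs_self_of_eq_zero_right (f := f) (f' := f') (K := K)
    (fun t ht => (hd t ht).continuousAt.continuousWithinAt)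
    (fun t ht => (hd t ⟨ht.1, ht.2.le⟩).hasDerivWithinAt)
    (by simp [f, h0, h1]) hbound 1 (by simp)
  have e : z₀ + (1 : ℝ) • v = z := by simp [v]
  simp only [f, e, Prod.mk_eq_zero] at hfin
  exact hfin

/-- A totally geodesic surface tangent at one point to the plane where the last coordinate is
constant coincides with this plane. -/
lemma eventually_mem_iff (P : IsNormalPatch Ψ r S q z₀ ε G β) (h : IsAdaptedChart ξ p Ψ δ r)
    (hq : q ∈ Ψ.source) (hq2 : Ψ q 2 = 0) (h0 : β z₀ 0 = 0) (h1 : β z₀ 1 = 0) :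
    ∀ᶠ x in 𝓝 q, x ∈ S ↔ Ψ x 2 = 0 := by
  have hz := P.center_mem
  -- The normal is along `∂₂` everywhere, so `x₂` is constant on the patch.
  have hG2 : ∀ z ∈ Metric.ball z₀ ε, G z 2 = 0 := by
    intro z hzb
    rw [← hq2, ← P.map_center]
    refine eq_of_fderiv_apply_eq_zero (convex_ball z₀ ε) (f := fun z => G z 2)
      (fun y hy => (P.contDiffAt_coord_map hy 2).differentiableAt (by simp)) hz hzb fun y hy => ?_
    obtain ⟨b0, b1⟩ := P.normal_eq_zero_on_ball h h0 h1 hy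
    have h2 := P.orthogonal y hy (z - z₀)
    have h3 := P.unit y hy
    rw [P.fderiv_coord_map hy]
    simp only [diagForm, b0, b1, zero_mul, mul_zero, zero_add] at h2 h3
    have h4 : β y 2 ≠ 0 := by
      intro h4
      simp [h4] at h3
    exact (mul_eq_zero.1 ((mul_eq_zero.1 h2).resolve_left (P.one_sub_r_pos h hy).ne')).resolve_left h4
  -- The coordinates `(x₀, x₁)` are open on the patch, so the patch fills a neighbourhood in the
  -- plane; this gives the inclusion of the plane in `S`.
  have hsurj : Filter.map (fun z => (G z 0, G z 1)) (𝓝 z₀) = 𝓝 (G z₀ 0, G z₀ 1) := by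
    have hs := ((P.contDiffAt_coord_map hz 0).prodMk
      (P.contDiffAt_coord_map hz 1)).hasStrictFDerivAt (by simp)
    refine hs.map_nhds_eq_of_surj ?_
    rw [LinearMap.range_eq_top]
    rintro ⟨a, b⟩
    obtain ⟨v, hv⟩ := P.surj z₀ hz (a • stdVec 0 + b • stdVec 1) (by simp [diagForm, h0, h1])
    refine ⟨v, ?_⟩
    have hd : HasFDerivAt (fun z => (G z 0, G z 1)) _ z₀ :=
      (hasFDerivAt_coord_comp ((P.contDiffAt_map z₀ hz).differentiableAt (by simp)) 0).prodMk
        (hasFDerivAt_coord_comp ((P.contDiffAt_map z₀ hz).differentiableAt (by simp)) 1)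
    change fderiv ℝ (fun z => (G z 0, G z 1)) z₀ v = _
    rw [hd.fderiv]
    simp [hv]
  have himg : (fun z => (G z 0, G z 1)) '' Metric.ball z₀ ε ∈ 𝓝 (Ψ q 0, Ψ q 1) := by
    rw [← P.map_center, ← hsurj]
    exact image_mem_map (Metric.isOpen_ball.mem_nhds hz)
  have hcΨ : ContinuousAt (fun x => (Ψ x 0, Ψ x 1)) q := by
    have hc := Ψ.continuousAt hq
    exact ((EuclideanSpace.proj 0 : E3 →L[ℝ] ℝ).continuous.continuousAt.comp hc).prodMk
      ((EuclideanSpace.proj 1 : E3 →L[ℝ] ℝ).continuous.continuousAt.comp hc)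
  filter_upwards [P.cover, hcΨ.eventually_mem himg, Ψ.open_source.mem_nhds hq] with x hx himgx hxs
  constructor
  · intro hxS
    obtain ⟨z, hz, hzx⟩ := hx hxS
    rw [← hzx, hG2 z hz]
  · intro hx2
    obtain ⟨z, hz, hzx⟩ := himgx
    have h5 : G z = Ψ x := by
      ext k
      fin_cases k
      · exact (Prod.mk.inj hzx).1
      · exact (Prod.mk.inj hzx).2
      · exact (hG2 z hz).trans hx2.symm
    have h6 := P.mem_surface z hz
    rwa [h5, Ψ.left_inv hxs] at h6

end IsNormalPatch

end
end

noncomputable section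

/-! ### Sectional curvature in an adapted chart -/

section Curvature

lemma chris_add_right (ρ ρ' : ℝ) (a b c : E3) :
    chris ρ ρ' a (b + c) = chris ρ ρ' a b + chris ρ ρ' a c := by
  ext k
  fin_cases k
  · simp
    ring
  · simp
    ring
  · simp
    ring

lemma chris_sub_left (ρ ρ' : ℝ) (a b c : E3) :
    chris ρ ρ' (a - b) c = chris ρ ρ' a c - chris ρ ρ' b c := by
  ext k
  fin_cases k
  · simp
    ring
  · simp
    ring
  · simp
    ring

variable {M : Type*} [TopologicalSpace M] [ChartedSpace E3 M] [IsManifold (𝓡 3) ∞ M]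
variable {Ψ : OpenPartialHomeomorph M E3} {q p : M} {ξ : ∀ x : M, TangentSpace (𝓡 3) x}

lemma eventually_smoothFieldAt_extendVec (v : TangentSpace (𝓡 3) q) :
    ∀ᶠ x in 𝓝 q, SmoothFieldAt (extendVec v) x := by
  obtain ⟨s, hs, h⟩ := FiberBundle.exists_contMDiffOn_extend (𝓡 3) E3 (k := ∞) v
  filter_upwards [eventually_mem_nhds_iff.2 hs] with x hx using h.contMDiffAt hx

lemma SmoothFieldAt.congr {X Y : ∀ x : M, TangentSpace (𝓡 3) x} (hX : SmoothFieldAt X q)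
    (h : ∀ᶠ x in 𝓝 q, Y x = X x) : SmoothFieldAt Y q := by
  refine ContMDiffAt.congr_of_eventuallyEq hX ?_
  filter_upwards [h] with x hx
  rw [hx]

variable [RiemannianBundle (fun x : M => TangentSpace (𝓡 3) x)]
lemma gram_det_ne_zero {v w : TangentSpace (𝓡 3) q} (hvw : LinearIndependent ℝ ![v, w]) :
    inner ℝ v v * inner ℝ w w - (inner ℝ v w) ^ 2 ≠ (0 : ℝ) := by
  intro h0
  rw [LinearIndependent.pair_iff] at hvw
  have h1 : (inner ℝ w w : ℝ) • v + (-inner ℝ v w : ℝ) • w = 0 := by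
    rw [← inner_self_eq_zero (𝕜 := ℝ)]
    simp only [inner_add_left, inner_add_right, real_inner_smul_left, real_inner_smul_right,
      real_inner_comm v w]
    linear_combination (inner ℝ w w : ℝ) * h0
  have h2 := (hvw _ _ h1).1
  rw [inner_self_eq_zero] at h2
  have h3 := hvw 0 1 (by simp [h2])
  exact one_ne_zero h3.2

variable [IsContMDiffRiemannianBundle (𝓡 3) ∞ E3 (fun x : M => TangentSpace (𝓡 3) x)]
variable {δ : ℝ} {r : ℝ → ℝ}

namespace IsAdaptedChart

lemma eventually_nabla_eq (h : IsAdaptedChart ξ p Ψ δ r) (hq : q ∈ Ψ.source)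
    (X : ∀ x : M, TangentSpace (𝓡 3) x) {Y : ∀ x : M, TangentSpace (𝓡 3) x}
    (hY : ∀ᶠ x in 𝓝 q, SmoothFieldAt Y x) :
    ∀ᶠ x in 𝓝 q, nabla X Y x = fld Ψ (fun y => fderiv ℝ (coordRep Ψ Y) y (coordRep Ψ X y) +
      chris (r (y 0)) (deriv r (y 0)) (coordRep Ψ X y) (coordRep Ψ Y y)) x := by
  filter_upwards [Ψ.open_source.mem_nhds hq, hY] with x hx hYx
  refine ((fld_eq_iff h.mem_atlas hx _ _).2 ?_).symm
  rw [nabla, h.leviCivita_eq hx hYx, h.coordRep_chart hx, h.coordRep_chart hx]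

lemma contDiffAt_nabla (h : IsAdaptedChart ξ p Ψ δ r) (hq : q ∈ Ψ.source)
    {X Y : ∀ x : M, TangentSpace (𝓡 3) x} (hX : SmoothFieldAt X q) (hY : SmoothFieldAt Y q) :
    ContDiffAt ℝ ∞ (fun y => fderiv ℝ (coordRep Ψ Y) y (coordRep Ψ X y)) (Ψ q) ∧
    ContDiffAt ℝ ∞ (fun y : E3 =>
      chris (r (y 0)) (deriv r (y 0)) (coordRep Ψ X y) (coordRep Ψ Y y)) (Ψ q) := by
  have ha := contDiffAt_coordRep h.mem_atlas hq hX
  have hb := contDiffAt_coordRep h.mem_atlas hq hY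
  have hs := h.abs_lt (Ψ.map_source hq)
  have hb' : ContDiffAt ℝ ∞ (fderiv ℝ (coordRep Ψ Y)) (Ψ q) := hb.fderiv_right (by simp)
  exact ⟨hb'.clm_apply ha, contDiffAt_chris (f := fun y : E3 => y 0) le_rfl (h.contDiffAt _ hs)
    (h.pos _ hs).ne' (sub_pos.2 (h.lt_one _ hs)).ne' (contDiffAt_coord 0 _) ha hb⟩

lemma nabla_nabla_eq (h : IsAdaptedChart ξ p Ψ δ r) (hq : q ∈ Ψ.source)
    {X Y Z : ∀ x : M, TangentSpace (𝓡 3) x} (hY : SmoothFieldAt Y q)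
    (hZ : ∀ᶠ x in 𝓝 q, SmoothFieldAt Z x) :
    mvfderiv (𝓡 3) Ψ q (nabla X (nabla Y Z) q) =
      fderiv ℝ (fderiv ℝ (coordRep Ψ Z)) (Ψ q) (coordRep Ψ X (Ψ q)) (coordRep Ψ Y (Ψ q)) +
      fderiv ℝ (coordRep Ψ Z) (Ψ q) (fderiv ℝ (coordRep Ψ Y) (Ψ q) (coordRep Ψ X (Ψ q))) +
      chrisDeriv (r (Ψ q 0)) (deriv r (Ψ q 0)) (deriv (deriv r) (Ψ q 0)) (coordRep Ψ X (Ψ q) 0)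
        (coordRep Ψ Y (Ψ q)) (coordRep Ψ Z (Ψ q)) +
      chris (r (Ψ q 0)) (deriv r (Ψ q 0)) (fderiv ℝ (coordRep Ψ Y) (Ψ q) (coordRep Ψ X (Ψ q)))
        (coordRep Ψ Z (Ψ q)) +
      chris (r (Ψ q 0)) (deriv r (Ψ q 0)) (coordRep Ψ Y (Ψ q))
        (fderiv ℝ (coordRep Ψ Z) (Ψ q) (coordRep Ψ X (Ψ q))) +
      chris (r (Ψ q 0)) (deriv r (Ψ q 0)) (coordRep Ψ X (Ψ q))
        (fderiv ℝ (coordRep Ψ Z) (Ψ q) (coordRep Ψ Y (Ψ q))) +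
      chris (r (Ψ q 0)) (deriv r (Ψ q 0)) (coordRep Ψ X (Ψ q))
        (chris (r (Ψ q 0)) (deriv r (Ψ q 0)) (coordRep Ψ Y (Ψ q)) (coordRep Ψ Z (Ψ q))) := by
  have hZq := hZ.self_of_nhds
  have hb := contDiffAt_coordRep h.mem_atlas hq hY
  have hc := contDiffAt_coordRep h.mem_atlas hq hZq
  have hs := h.abs_lt (Ψ.map_source hq)
  have hev := h.eventually_nabla_eq hq Y hZ
  obtain ⟨hn1, hn2⟩ := h.contDiffAt_nabla hq hY hZq
  have hsm : SmoothFieldAt (nabla Y Z) q :=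
    (smoothFieldAt_fld h.mem_atlas hq (hn1.add hn2)).congr hev
  have hrep : coordRep Ψ (nabla Y Z) =ᶠ[𝓝 (Ψ q)] fun y =>
      fderiv ℝ (coordRep Ψ Z) y (coordRep Ψ Y y) +
        chris (r (y 0)) (deriv r (y 0)) (coordRep Ψ Y y) (coordRep Ψ Z y) := by
    have hcs := Ψ.continuousAt_symm (Ψ.map_source hq)
    rw [ContinuousAt, Ψ.left_inv hq] at hcs
    filter_upwards [hcs.eventually hev, Ψ.open_target.mem_nhds (Ψ.map_source hq)] with y hy hyt
    rw [coordRep, hy, mvfderiv_fld h.mem_atlas (Ψ.map_target hyt), Ψ.right_inv hyt]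
  have hc' : ContDiffAt ℝ ∞ (fderiv ℝ (coordRep Ψ Z)) (Ψ q) := hc.fderiv_right (by simp)
  rw [nabla, h.leviCivita_eq hq hsm, ← h.coordRep_chart hq, ← h.coordRep_chart hq, hrep.fderiv_eq,
    hrep.eq_of_nhds, fderiv_fun_add (hn1.differentiableAt (by simp))
      (hn2.differentiableAt (by simp)), add_apply,
    fderiv_clm_apply (hc'.differentiableAt (by simp)) (hb.differentiableAt (by simp)),
    fderiv_chris (f := fun y : E3 => y 0) (h.contDiffAt _ hs)
    (h.pos _ hs).ne' (sub_pos.2 (h.lt_one _ hs)).ne' ((contDiffAt_coord 0 _).of_le (by simp))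
    (hb.of_le (by simp)) (hc.of_le (by simp)), chris_add_right, fderiv_coord]
  simp only [add_apply, ContinuousLinearMap.comp_apply, ContinuousLinearMap.flip_apply]
  abel

/-- The curvature in an adapted chart. -/
lemma curvature_eq (h : IsAdaptedChart ξ p Ψ δ r) (hq : q ∈ Ψ.source)
    {X Y Z : ∀ x : M, TangentSpace (𝓡 3) x} (hX : SmoothFieldAt X q) (hY : SmoothFieldAt Y q)
    (hZ : ∀ᶠ x in 𝓝 q, SmoothFieldAt Z x) :
    mvfderiv (𝓡 3) Ψ q (curvature X Y Z q) =
      curvVec (r (Ψ q 0)) (deriv r (Ψ q 0)) (deriv (deriv r) (Ψ q 0)) (mvfderiv (𝓡 3) Ψ q (X q))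
        (mvfderiv (𝓡 3) Ψ q (Y q)) (mvfderiv (𝓡 3) Ψ q (Z q)) := by
  have hs := h.abs_lt (Ψ.map_source hq)
  have hZq := hZ.self_of_nhds
  have hbr : mvfderiv (𝓡 3) Ψ q (bracket X Y q) =
      fderiv ℝ (coordRep Ψ Y) (Ψ q) (coordRep Ψ X (Ψ q)) -
        fderiv ℝ (coordRep Ψ X) (Ψ q) (coordRep Ψ Y (Ψ q)) := by
    rw [bracket_congr (fld_coordRep_eventuallyEq h.mem_atlas hq X)
      (fld_coordRep_eventuallyEq h.mem_atlas hq Y), bracket_fld h.mem_atlas hq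
      ((contDiffAt_coordRep h.mem_atlas hq hX).of_le (by simp))
      ((contDiffAt_coordRep h.mem_atlas hq hY).of_le (by simp)), mvfderiv_fld h.mem_atlas hq,
      VectorField.lieBracket_eq]
  have hsymm := (contDiffAt_coordRep h.mem_atlas hq hZq).isSymmSndFDerivAt
    (by rw [minSmoothness_of_isRCLikeNormedField]; exact WithTop.coe_le_coe.2 (le_top : (2 : ℕ∞) ≤ ⊤))
    (coordRep Ψ X (Ψ q)) (coordRep Ψ Y (Ψ q))
  rw [curvature, map_sub, map_sub, h.nabla_nabla_eq hq hY hZ, h.nabla_nabla_eq hq hX hZ, nabla,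
    h.leviCivita_eq hq hZq, hbr, chris_sub_left, hsymm, ← h.coordRep_chart hq,
    ← h.coordRep_chart hq, ← h.coordRep_chart hq,
    ← curvVec_eq (h.pos _ hs).ne' (sub_pos.2 (h.lt_one _ hs)).ne', map_sub]
  abel

/-- Solving `bending = 0` for `r''` makes the curvatures of all three coordinate planes equal to
that of the `x₁x₂`-plane, which involves `r'` only. -/
lemma sectionalCurvature_eq (h : IsAdaptedChart ξ p Ψ δ r) (hq : q ∈ Ψ.source)
    (hb : bending r (Ψ q 0) = 0) {v w : TangentSpace (𝓡 3) q}
    (hvw : LinearIndependent ℝ ![v, w]) :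
    sectionalCurvature v w = deriv r (Ψ q 0) ^ 2 / (4 * r (Ψ q 0) * (1 - r (Ψ q 0))) := by
  have hs := h.abs_lt (Ψ.map_source hq)
  have h0 := (h.pos _ hs).ne'
  have h1 := (sub_pos.2 (h.lt_one _ hs)).ne'
  rw [sectionalCurvature, div_eq_iff (gram_det_ne_zero hvw), h.inner_eq q hq,
    h.curvature_eq hq (smoothFieldAt_extendVec v) (smoothFieldAt_extendVec w)
      (eventually_smoothFieldAt_extendVec w), extendVec_apply, extendVec_apply, h.inner_eq q hq,
    h.inner_eq q hq, h.inner_eq q hq]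
  have hb' : deriv (deriv r) (Ψ q 0) = deriv r (Ψ q 0) ^ 2 * (1 - 2 * r (Ψ q 0)) /
      (2 * r (Ψ q 0) * (1 - r (Ψ q 0))) := by
    rw [eq_div_iff (mul_ne_zero (mul_ne_zero two_ne_zero h0) h1)]
    unfold bending at hb
    linear_combination hb
  rw [hb']
  simp only [diagForm, curvVec_apply_zero, curvVec_apply_one, curvVec_apply_two]
  field_simp
  ring

/-- The derivative of `r'² / (4r(1 - r))` is a multiple of `r' * bending r`. -/
lemma eventually_curvature_const (h : IsAdaptedChart ξ p Ψ δ r)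
    (hb : ∀ᶠ s in 𝓝 0, bending r s = 0) :
    ∀ᶠ s in 𝓝 0, bending r s = 0 ∧ |s| < δ ∧ deriv r s ^ 2 / (4 * r s * (1 - r s)) =
      deriv r 0 ^ 2 / (4 * r 0 * (1 - r 0)) := by
  have hδ : ∀ᶠ s : ℝ in 𝓝 0, |s| < δ := by
    have : Metric.ball (0 : ℝ) δ ∈ 𝓝 0 := Metric.ball_mem_nhds _ h.delta_pos
    filter_upwards [this] with s hs
    simpa using hs
  obtain ⟨ε, hε, hball⟩ := Metric.eventually_nhds_iff_ball.1 (hb.and hδ)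
  filter_upwards [Metric.ball_mem_nhds _ hε] with s hs
  refine ⟨(hball s hs).1, (hball s hs).2, ?_⟩
  have hder : ∀ t ∈ Metric.ball (0 : ℝ) ε,
      HasDerivAt (fun s => deriv r s ^ 2 / (4 * r s * (1 - r s))) 0 t := by
    intro t ht
    obtain ⟨hbt, htδ⟩ := hball t ht
    have h0 := (h.pos _ htδ).ne'
    have h1 := (sub_pos.2 (h.lt_one _ htδ)).ne'
    have d0 := (h.differentiableAt htδ).hasDerivAt
    have d1 := ((contDiffAt_deriv (h.contDiffAt t htδ)).differentiableAt (by simp)).hasDerivAt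
    have hne : 4 * r t * (1 - r t) ≠ 0 := by positivity
    refine ((d1.pow 2).div ((d0.const_mul 4).mul (d0.const_sub 1)) hne).congr_deriv ?_
    rw [div_eq_zero_iff]
    left
    unfold bending at hbt
    simp
    linear_combination 4 * deriv r t * hbt
  refine eq_of_fderiv_apply_eq_zero (convex_ball 0 ε)
    (f := fun s => deriv r s ^ 2 / (4 * r s * (1 - r s)))
    (fun t ht => (hder t ht).differentiableAt) (Metric.mem_ball_self hε) hs fun t ht => ?_
  rw [(hder t ht).hasFDerivAt.fderiv]
  simp

lemma hasConstantCurvatureNear (h : IsAdaptedChart ξ p Ψ δ r)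
    (hb : ∀ᶠ s in 𝓝 0, bending r s = 0) :
    HasConstantCurvatureNear p (deriv r 0 ^ 2 / (4 * r 0 * (1 - r 0))) := by
  have hc : Tendsto (fun x => Ψ x 0) (𝓝 p) (𝓝 0) := by
    have h1 : ContinuousAt (fun x => Ψ x 0) p :=
      (EuclideanSpace.proj 0 : E3 →L[ℝ] ℝ).continuous.continuousAt.comp (Ψ.continuousAt h.mem_source)
    have h2 : Ψ p 0 = 0 := by rw [h.map_base]; rfl
    rwa [ContinuousAt, h2] at h1
  filter_upwards [hc.eventually (h.eventually_curvature_const hb),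
    Ψ.open_source.mem_nhds h.mem_source] with q hq hqs v w hvw
  rw [h.sectionalCurvature_eq hqs hq.1 hvw, hq.2.2]

end IsAdaptedChart

end Curvature
end

noncomputable section

/-! ### Local isometries with Euclidean space and the round sphere -/

section LocalIsometries

variable {M : Type*} [TopologicalSpace M] [ChartedSpace E3 M] [IsManifold (𝓡 3) ∞ M]
variable {Ψ : OpenPartialHomeomorph M E3} {q p : M} {ξ : ∀ x : M, TangentSpace (𝓡 3) x}
variable [RiemannianBundle (fun x : M => TangentSpace (𝓡 3) x)]
variable {δ : ℝ} {r : ℝ → ℝ}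

/-- The linear map with diagonal matrix `(1, a, b)`. -/
def diagMap (a b : ℝ) : E3 →L[ℝ] E3 :=
  ContinuousLinearMap.smulRight (EuclideanSpace.proj 0 : E3 →L[ℝ] ℝ) (stdVec 0) +
    ContinuousLinearMap.smulRight (EuclideanSpace.proj 1 : E3 →L[ℝ] ℝ) (a • stdVec 1) +
    ContinuousLinearMap.smulRight (EuclideanSpace.proj 2 : E3 →L[ℝ] ℝ) (b • stdVec 2)

lemma diagMap_apply (a b : ℝ) (v : E3) :
    diagMap a b v = v 0 • stdVec 0 + v 1 • (a • stdVec 1) + v 2 • (b • stdVec 2) := rfl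

lemma inner_diagMap (a b : ℝ) (v w : E3) : inner ℝ (diagMap a b v) (diagMap a b w) =
    v 0 * w 0 + a ^ 2 * (v 1 * w 1) + b ^ 2 * (v 2 * w 2) := by
  simp only [diagMap_apply, PiLp.inner_apply, Fin.sum_univ_three]
  simp
  ring

lemma isOpen_slab (ε : ℝ) : IsOpen {y : E3 | |y 0| < ε} :=
  isOpen_lt (continuous_abs.comp (EuclideanSpace.proj 0 : E3 →L[ℝ] ℝ).continuous) continuous_const

/-- A parametrization of the unit sphere of `E4` by tori. -/
def sphereTorus (α : ℝ → ℝ) (k : ℝ) (y : E3) : E4 :=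
  !₂[Real.cos (α (y 0)) * Real.cos (k * y 2), Real.cos (α (y 0)) * Real.sin (k * y 2),
    Real.sin (α (y 0)) * Real.cos (k * y 1), Real.sin (α (y 0)) * Real.sin (k * y 1)]

lemma contDiff_sphereTorus {α : ℝ → ℝ} (hα : ContDiff ℝ ∞ α) (k : ℝ) :
    ContDiff ℝ ∞ (sphereTorus α k) := by
  have hy : ∀ i, ContDiff ℝ ∞ (fun y : E3 => y i) := fun i =>
    (EuclideanSpace.proj i : E3 →L[ℝ] ℝ).contDiff
  have hs := hα.comp (hy 0)
  rw [contDiff_euclidean]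
  intro i
  fin_cases i
  · exact hs.cos.mul (contDiff_const.mul (hy 2)).cos
  · exact hs.cos.mul (contDiff_const.mul (hy 2)).sin
  · exact hs.sin.mul (contDiff_const.mul (hy 1)).cos
  · exact hs.sin.mul (contDiff_const.mul (hy 1)).sin

lemma sphereTorus_mem (α : ℝ → ℝ) (k : ℝ) (y : E3) : sphereTorus α k y ∈ Metric.sphere (0 : E4) 1 := by
  rw [mem_sphere_zero_iff_norm, EuclideanSpace.norm_eq, Real.sqrt_eq_one, Fin.sum_univ_four]
  simp only [sphereTorus, Real.norm_eq_abs, sq_abs]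
  simp
  have h1 := Real.sin_sq_add_cos_sq (k * y 1)
  have h2 := Real.sin_sq_add_cos_sq (k * y 2)
  have h3 := Real.sin_sq_add_cos_sq (α (y 0))
  linear_combination Real.cos (α (y 0)) ^ 2 * h2 + Real.sin (α (y 0)) ^ 2 * h1 + h3

lemma inner_fderiv_sphereTorus {α : ℝ → ℝ} (hα : ContDiff ℝ ∞ α) (k : ℝ) (y v w : E3) :
    inner ℝ (fderiv ℝ (sphereTorus α k) y v) (fderiv ℝ (sphereTorus α k) y w) =
      deriv α (y 0) ^ 2 * (v 0 * w 0) + k ^ 2 * Real.sin (α (y 0)) ^ 2 * (v 1 * w 1) +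
        k ^ 2 * Real.cos (α (y 0)) ^ 2 * (v 2 * w 2) := by
  have hy : ∀ i, HasFDerivAt (fun y : E3 => y i) (EuclideanSpace.proj i : E3 →L[ℝ] ℝ) y := fun i =>
    (EuclideanSpace.proj i : E3 →L[ℝ] ℝ).hasFDerivAt
  have hs : HasFDerivAt (fun y : E3 => α (y 0)) _ y :=
    hasFDerivAt_comp_coord_zero (hα.differentiable (by simp)).differentiableAt
  have hd : DifferentiableAt ℝ (sphereTorus α k) y :=
    (contDiff_sphereTorus hα k).contDiffAt.differentiableAt (by simp)
  have hc : ∀ i v, fderiv ℝ (sphereTorus α k) y v i = fderiv ℝ (fun z => sphereTorus α k z i) y v := by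
    intro i v
    exact (DFunLike.congr_fun ((EuclideanSpace.proj i : E4 →L[ℝ] ℝ).hasFDerivAt.comp y
      hd.hasFDerivAt).fderiv v).symm
  have e0 : ∀ v, fderiv ℝ (fun z => sphereTorus α k z 0) y v = _ := fun v =>
    DFunLike.congr_fun (hs.cos.mul ((hy 2).const_mul k).cos).fderiv v
  have e1 : ∀ v, fderiv ℝ (fun z => sphereTorus α k z 1) y v = _ := fun v =>
    DFunLike.congr_fun (hs.cos.mul ((hy 2).const_mul k).sin).fderiv v
  have e2 : ∀ v, fderiv ℝ (fun z => sphereTorus α k z 2) y v = _ := fun v =>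
    DFunLike.congr_fun (hs.sin.mul ((hy 1).const_mul k).cos).fderiv v
  have e3 : ∀ v, fderiv ℝ (fun z => sphereTorus α k z 3) y v = _ := fun v =>
    DFunLike.congr_fun (hs.sin.mul ((hy 1).const_mul k).sin).fderiv v
  simp only [PiLp.inner_apply, Fin.sum_univ_four, hc, e0, e1, e2, e3]
  simp
  have h1 := Real.sin_sq_add_cos_sq (k * y 1)
  have h2 := Real.sin_sq_add_cos_sq (k * y 2)
  have h3 := Real.sin_sq_add_cos_sq (α (y 0))
  linear_combination (deriv α (y 0) ^ 2 * Real.sin (α (y 0)) ^ 2 * (v 0 * w 0) +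
    k ^ 2 * Real.cos (α (y 0)) ^ 2 * (v 2 * w 2)) * h2 +
    (deriv α (y 0) ^ 2 * Real.cos (α (y 0)) ^ 2 * (v 0 * w 0) +
    k ^ 2 * Real.sin (α (y 0)) ^ 2 * (v 1 * w 1)) * h1 + deriv α (y 0) ^ 2 * (v 0 * w 0) * h3

/-- The angle function of a metric of constant curvature, cut off away from zero. -/
lemma exists_angle {ε : ℝ} (hε : 0 < ε) (hr : ∀ s, |s| < ε → ContDiffAt ℝ ∞ r s)
    (h0 : ∀ s, |s| < ε → 0 < r s) (h1 : ∀ s, |s| < ε → r s < 1) :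
    ∃ α : ℝ → ℝ, ContDiff ℝ ∞ α ∧ ∃ η, 0 < η ∧ η ≤ ε ∧ ∀ s, |s| < η →
      Real.sin (α s) ^ 2 = r s ∧ Real.cos (α s) ^ 2 = 1 - r s ∧
      deriv α s ^ 2 = deriv r s ^ 2 / (4 * r s * (1 - r s)) := by
  let χ : ContDiffBump (0 : ℝ) := ⟨ε / 4, ε / 2, by linarith, by linarith⟩
  -- From `sin² a = r` it follows that `a'² = r'² / (4r(1 - r))`, the sectional curvature. The
  -- cut-off `χ` serves to make the angle globally smooth.
  let a : ℝ → ℝ := fun s => Real.arcsin (√(r s))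
  have hs1 : ∀ s, |s| < ε → √(r s) ≠ 1 := fun s hs h => by
    rw [Real.sqrt_eq_one] at h
    linarith [h1 s hs]
  have hs2 : ∀ s, √(r s) ≠ -1 := fun s h => by linarith [Real.sqrt_nonneg (r s)]
  have ha : ∀ s, |s| < ε → ContDiffAt ℝ ∞ a s := fun s hs =>
    ContDiffAt.comp (g := Real.arcsin) (f := fun s => √(r s)) s
      (Real.contDiffAt_arcsin (hs2 s) (hs1 s hs)) ((hr s hs).sqrt (h0 s hs).ne')
  refine ⟨fun s => χ s * a s, ?_, ε / 4, by linarith, by linarith, fun s hs => ?_⟩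
  · rw [contDiff_iff_contDiffAt]
    intro s
    by_cases hs : |s| < ε
    · exact χ.contDiff.contDiffAt.mul (ha s hs)
    · have h2 : (fun s => χ s * a s) =ᶠ[𝓝 s] fun _ => 0 := by
        have h3 : ∀ᶠ t in 𝓝 s, ε / 2 < |t| :=
          continuous_abs.continuousAt.eventually (lt_mem_nhds (by linarith))
        filter_upwards [h3] with t ht
        rw [χ.zero_of_le_dist (by rw [Real.dist_eq, sub_zero]; exact ht.le), zero_mul]
      exact contDiffAt_const.congr_of_eventuallyEq h2
  · have hsε : |s| < ε := by linarith
    have h2 : (fun s => χ s * a s) =ᶠ[𝓝 s] a := by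
      have h3 : ∀ᶠ t in 𝓝 s, |t| < ε / 4 := continuous_abs.continuousAt.eventually (gt_mem_nhds hs)
      filter_upwards [h3] with t ht
      rw [χ.one_of_mem_closedBall (by rw [Metric.mem_closedBall, Real.dist_eq, sub_zero]; exact ht.le),
        one_mul]
    have p0 := h0 s hsε
    have p1 := sub_pos.2 (h1 s hsε)
    have hle : √(r s) ≤ 1 := Real.sqrt_le_one.2 (h1 s hsε).le
    have hsq := Real.sq_sqrt p0.le
    beta_reduce
    rw [show χ s * a s = a s from h2.eq_of_nhds, h2.deriv_eq]
    refine ⟨?_, ?_, ?_⟩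
    · rw [Real.sin_arcsin (by linarith [Real.sqrt_nonneg (r s)]) hle, hsq]
    · rw [Real.cos_arcsin, hsq, Real.sq_sqrt p1.le]
    · have d := HasDerivAt.comp (h₂ := Real.arcsin) (h := fun s => √(r s)) s
        (Real.hasDerivAt_arcsin (hs2 s) (hs1 s hsε))
        (((hr s hsε).differentiableAt (by simp)).hasDerivAt.sqrt p0.ne')
      have d' : HasDerivAt a _ s := d
      rw [d'.deriv, mul_pow, div_pow, div_pow, mul_pow, hsq, one_pow, Real.sq_sqrt p1.le]
      field_simp
      ring

variable [IsContMDiffRiemannianBundle (𝓡 3) ∞ E3 (fun x : M => TangentSpace (𝓡 3) x)]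

namespace IsAdaptedChart

lemma exists_slab (h : IsAdaptedChart ξ p Ψ δ r)
    (hb : ∀ᶠ s in 𝓝 0, bending r s = 0) :
    ∃ ε, 0 < ε ∧ ε ≤ δ ∧ ∀ s, |s| < ε → deriv r s ^ 2 / (4 * r s * (1 - r s)) =
      deriv r 0 ^ 2 / (4 * r 0 * (1 - r 0)) := by
  obtain ⟨ε, hε, hball⟩ := Metric.eventually_nhds_iff_ball.1 (h.eventually_curvature_const hb)
  exact ⟨min ε δ, lt_min hε h.delta_pos, min_le_right _ _, fun s hs =>
    (hball s (by simpa using hs.trans_le (min_le_left _ _))).2.2⟩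

/-- Zero curvature means `r' = 0`, so the metric has constant diagonal coefficients and a rescaling
of the coordinates by `√r` and `√(1 - r)` is an isometry. -/
lemma isLocallyIsometricToEuclidean (h : IsAdaptedChart ξ p Ψ δ r)
    (hb : ∀ᶠ s in 𝓝 0, bending r s = 0) (hr : deriv r 0 = 0) : IsLocallyIsometricToEuclidean p := by
  obtain ⟨ε, hε, hεδ, hc⟩ := h.exists_slab hb
  have hr' : ∀ s, |s| < ε → deriv r s = 0 := by
    intro s hs
    have h1 := hc s hs
    have h2 := h.pos s (hs.trans_le hεδ)
    have h3 := sub_pos.2 (h.lt_one s (hs.trans_le hεδ))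
    rw [hr] at h1
    simpa [h2.ne', h3.ne'] using h1
  have hconst : ∀ s, |s| < ε → r s = r 0 := by
    intro s hs
    refine eq_of_fderiv_apply_eq_zero (convex_ball (0 : ℝ) ε) (f := r)
      (fun t ht => h.differentiableAt ((by simpa using ht : |t| < ε).trans_le hεδ))
      (Metric.mem_ball_self hε) (by simpa using hs) fun t ht => ?_
    have h1 := hr' t (by simpa using ht)
    have h2 := (h.differentiableAt ((by simpa using ht : |t| < ε).trans_le hεδ)).hasDerivAt
    rw [h2.hasFDerivAt.fderiv, h1]
    simp
  have h0 := h.pos 0 (by simpa using h.delta_pos)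
  have h1 := sub_pos.2 (h.lt_one 0 (by simpa using h.delta_pos))
  set L := diagMap (√(r 0)) (√(1 - r 0))
  have hL : ∀ v w, inner ℝ (L v) (L w) = diagForm (r 0) v w := by
    intro v w
    rw [inner_diagMap, Real.sq_sqrt h0.le, Real.sq_sqrt h1.le]
    rfl
  have hinv : (fderiv ℝ L 0).IsInvertible := by
    rw [L.fderiv]
    refine isInvertible_of_injective fun v hv => ?_
    by_contra hne
    have h2 := diagForm_self_pos h0 (sub_pos.1 h1) hne
    rw [← hL, hv, inner_zero_left] at h2
    exact lt_irrefl _ h2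
  obtain ⟨e, he0, heB, hef, hes, -⟩ := exists_smooth_openPartialHomeomorph (isOpen_slab ε)
    (fun y _ => L.contDiff.contDiffAt) (x := 0) (by simpa using hε) hinv
  have hefn : (e : E3 → E3) = L := funext hef
  have he : ∀ y ∈ e.source, ContDiffAt ℝ ∞ e y := fun y _ => by
    rw [hefn]
    exact L.contDiff.contDiffAt
  have hmem := chart_trans_mem h.mem_atlas he hes
  refine ⟨Ψ.trans e, ?_, contMDiffOn_of_mem_maximalAtlas hmem,
    contMDiffOn_symm_of_mem_maximalAtlas hmem, fun q hq v w => ?_⟩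
  · rw [OpenPartialHomeomorph.trans_source]
    refine ⟨h.mem_source, ?_⟩
    rw [Set.mem_preimage, h.map_base]
    exact he0
  · rw [OpenPartialHomeomorph.trans_source] at hq
    rw [mvfderiv_chart_trans h.mem_atlas hq.1 (he _ hq.2),
      mvfderiv_chart_trans h.mem_atlas hq.1 (he _ hq.2), hefn, L.fderiv, hL, h.inner_eq q hq.1,
      hconst _ (heB hq.2)]

/-- With `sin² α = r`, `α'² = c` and frequency `√c`, the torus parametrization pulls the metric of
the unit sphere back to `c` times the metric of `M`. -/
lemma isLocallyIsometricToSphere (h : IsAdaptedChart ξ p Ψ δ r)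
    (hb : ∀ᶠ s in 𝓝 0, bending r s = 0) {c : ℝ} (hc0 : 0 < c)
    (hc : deriv r 0 ^ 2 / (4 * r 0 * (1 - r 0)) = c) : IsLocallyIsometricToSphere p (1 / √c) := by
  have : Fact (Module.finrank ℝ E4 = 3 + 1) := ⟨by simp⟩
  obtain ⟨ε, hε, hεδ, hcs⟩ := h.exists_slab hb
  obtain ⟨α, hα, η, hη, hηε, hαs⟩ := exists_angle hε
    (fun s hs => h.contDiffAt s (hs.trans_le hεδ)) (fun s hs => h.pos s (hs.trans_le hεδ))
    (fun s hs => h.lt_one s (hs.trans_le hεδ))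
  have hinner : ∀ y : E3, |y 0| < η → ∀ v w, inner ℝ (fderiv ℝ (sphereTorus α (√c)) y v)
      (fderiv ℝ (sphereTorus α (√c)) y w) = c * diagForm (r (y 0)) v w := by
    intro y hy v w
    obtain ⟨h1, h2, h3⟩ := hαs _ hy
    rw [inner_fderiv_sphereTorus hα, h1, h2, h3, hcs _ (hy.trans_le hηε), hc, Real.sq_sqrt hc0.le,
      diagForm]
    ring
  let f : E3 → S3 := Set.codRestrict (sphereTorus α (√c)) _ (sphereTorus_mem α (√c))
  have hf : ContMDiff 𝓘(ℝ, E3) (𝓡 3) ∞ f :=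
    ContMDiff.codRestrict_sphere (contDiff_sphereTorus hα (√c)).contMDiff (sphereTorus_mem α (√c))
  -- A chart of the sphere turns `f` into a map between open sets of `E3`, to which the inverse
  -- function theorem applies. Its derivative is injective because the pulled back metric is
  -- positive definite.
  let σ : OpenPartialHomeomorph S3 E3 := chartAt E3 (f 0)
  have hσ : σ ∈ IsManifold.maximalAtlas (𝓡 3) ∞ S3 := IsManifold.chart_mem_maximalAtlas (f 0)
  let B : Set E3 := {y : E3 | |y 0| < η} ∩ f ⁻¹' σ.source
  have hB : IsOpen B := (isOpen_slab η).inter (σ.open_source.preimage hf.continuous)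
  have hFd : ∀ y ∈ B, ContDiffAt ℝ ∞ (σ ∘ f) y := by
    intro y hy
    rw [← contMDiffAt_iff_contDiffAt]
    exact ContMDiffAt.comp y (contMDiffAt_of_mem_maximalAtlas hσ hy.2) hf.contMDiffAt
  have h0B : (0 : E3) ∈ B := ⟨by simpa using hη, mem_chart_source E3 (f 0)⟩
  have hinv : (fderiv ℝ (σ ∘ f) 0).IsInvertible := by
    refine isInvertible_of_injective fun v hv => ?_
    have h1 := contDiffAt_comp_symm hσ h0B.2 (f := fun y : S3 => (y : E4))
      contMDiff_coe_sphere.contMDiffAt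
    have h2 := (h1.differentiableAt (by simp)).hasFDerivAt.comp (0 : E3)
      ((hFd 0 h0B).differentiableAt (by simp)).hasFDerivAt
    have h3 : sphereTorus α (√c) =ᶠ[𝓝 0] ((fun y : S3 => (y : E4)) ∘ σ.symm) ∘ (σ ∘ f) := by
      filter_upwards [hB.mem_nhds h0B] with y hy
      simp only [Function.comp_apply]
      rw [σ.left_inv hy.2]
      rfl
    have h4 : fderiv ℝ (sphereTorus α (√c)) 0 v = 0 := by
      rw [h3.fderiv_eq, h2.fderiv, ContinuousLinearMap.comp_apply, hv, map_zero]
    have h5 := hinner 0 h0B.1 v v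
    rw [h4, inner_zero_left] at h5
    by_contra hne
    have h6 := diagForm_self_pos (h.pos _ (h0B.1.trans_le (hηε.trans hεδ)))
      (h.lt_one _ (h0B.1.trans_le (hηε.trans hεδ))) hne
    exact (mul_pos hc0 h6).ne h5
  obtain ⟨e, he0, heB, hef, hes, -⟩ := exists_smooth_openPartialHomeomorph hB hFd h0B hinv
  have hefn : (e : E3 → E3) = σ ∘ f := funext hef
  have he : ∀ y ∈ e.source, ContDiffAt ℝ ∞ e y := fun y hy => by
    rw [hefn]
    exact hFd y (heB hy)
  have hmem := chart_trans_mem h.mem_atlas he hes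
  let Φ : OpenPartialHomeomorph M S3 := (Ψ.trans e).trans σ.symm
  have hsrc : ∀ q ∈ Φ.source, q ∈ (Ψ.trans e).source ∧ (Ψ.trans e) q ∈ σ.target ∧
      q ∈ Ψ.source ∧ Ψ q ∈ e.source := by
    intro q hq
    have h1 : q ∈ (Ψ.trans e).source ∧ (Ψ.trans e) q ∈ σ.target := by
      simpa [Φ, OpenPartialHomeomorph.trans_source] using hq
    have h2 := h1.1
    rw [OpenPartialHomeomorph.trans_source] at h2
    exact ⟨h1.1, h1.2, h2.1, h2.2⟩
  have hΦ : ∀ q ∈ Φ.source, Φ q = f (Ψ q) := by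
    intro q hq
    obtain ⟨-, -, -, h4⟩ := hsrc q hq
    change σ.symm (e (Ψ q)) = _
    rw [hef]
    exact σ.left_inv (heB h4).2
  have hΦs : ∀ q ∈ Φ.source, ContMDiffAt (𝓡 3) (𝓡 3) ∞ Φ q := by
    intro q hq
    obtain ⟨h1, h2, -, -⟩ := hsrc q hq
    exact ContMDiffAt.comp (I' := 𝓡 3) (g := σ.symm) (f := Ψ.trans e) q
      (contMDiffAt_symm_of_mem_maximalAtlas hσ h2) (contMDiffAt_of_mem_maximalAtlas hmem h1)
  refine ⟨Φ, ?_, fun q hq => (hΦs q hq).contMDiffWithinAt, ?_, ?_⟩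
  · have h1 : Ψ p ∈ e.source := by rw [h.map_base]; exact he0
    have h2 : e (Ψ p) ∈ σ.target := by
      rw [hef]
      exact σ.map_source (heB h1).2
    simpa [Φ, OpenPartialHomeomorph.trans_source, h.mem_source] using ⟨h1, h2⟩
  · intro y hy
    have h1 : y ∈ σ.source ∧ σ y ∈ (Ψ.trans e).target := by
      simpa [Φ, OpenPartialHomeomorph.trans_target] using hy
    exact (ContMDiffAt.comp (I' := 𝓡 3) (g := (Ψ.trans e).symm) (f := σ) y
      (contMDiffAt_symm_of_mem_maximalAtlas hmem h1.2)
      (contMDiffAt_of_mem_maximalAtlas hσ h1.1)).contMDiffWithinAt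
  · intro q hq v w
    obtain ⟨-, -, h3, h4⟩ := hsrc q hq
    have key : ∀ v : TangentSpace (𝓡 3) q,
        mvfderiv (𝓡 3) (fun y : S3 => (y : E4)) (Φ q) (mfderiv (𝓡 3) (𝓡 3) Φ q v) =
          fderiv ℝ (sphereTorus α (√c)) (Ψ q) (mvfderiv (𝓡 3) Ψ q v) := by
      intro v
      have h5 := mfderiv_comp_apply (I := 𝓡 3) (I' := 𝓡 3) (I'' := 𝓘(ℝ, E4))
        (g := fun y : S3 => (y : E4)) (f := Φ) q
        ((contMDiff_coe_sphere (m := ∞)).contMDiffAt.mdifferentiableAt (by simp))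
        ((hΦs q hq).mdifferentiableAt (by simp)) v
      rw [← mvfderiv_comp_chart h.mem_atlas h3 (f := (fun y : S3 => (y : E4)) ∘ Φ)
        (h := sphereTorus α (√c)) ?_
        ((contDiff_sphereTorus hα (√c)).contDiffAt.differentiableAt (by simp))]
      · exact h5.symm
      · filter_upwards [Φ.open_source.mem_nhds hq] with x hx
        rw [Function.comp_apply, hΦ x hx]
        rfl
    rw [key, key, hinner _ (heB h4).1, h.inner_eq q h3, div_pow, one_pow, Real.sq_sqrt hc0.le]
    field_simp

end IsAdaptedChart

end LocalIsometries
end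

noncomputable section

/-! ### Existence and uniqueness of the function `τ` -/

section Twist

variable {M : Type*} [TopologicalSpace M] [ChartedSpace E3 M] [IsManifold (𝓡 3) ∞ M]
variable [RiemannianBundle (fun x : M => TangentSpace (𝓡 3) x)] {q : M}

lemma crossProd_repr (e : OrthonormalBasis (Fin 3) ℝ (TangentSpace (𝓡 3) q))
    (v w : TangentSpace (𝓡 3) q) :
    (e.repr (crossProd e v w)).ofLp = (e.repr v).ofLp ⨯₃ (e.repr w).ofLp := by
  rw [crossProd, LinearIsometryEquiv.apply_symm_apply]

/-- A skew endomorphism which annihilates the unit vector `x` is a multiple of `v ↦ v × x`. -/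
lemma exists_eq_smul_crossProd (e : OrthonormalBasis (Fin 3) ℝ (TangentSpace (𝓡 3) q))
    {A : TangentSpace (𝓡 3) q → TangentSpace (𝓡 3) q}
    (hA : ∀ v w, inner ℝ (A v) w = -inner ℝ v (A w)) {x : TangentSpace (𝓡 3) q} (hx : ‖x‖ = 1)
    (hAx : A x = 0) : ∃ τ : ℝ, ∀ v, A v = τ • crossProd e v x := by
  set m : Fin 3 → Fin 3 → ℝ := fun i j => e.repr (A (e i)) j with hm
  have hm' : ∀ i j, m i j = -m j i := by
    intro i j
    simp only [hm, e.repr_apply_apply]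
    rw [real_inner_comm, hA]
  have hv : ∀ v i, e.repr (A v) i =
      -(m i 0 * e.repr v 0 + m i 1 * e.repr v 1 + m i 2 * e.repr v 2) := by
    intro v i
    rw [e.repr_apply_apply, ← neg_neg (inner ℝ (e i) (A v)), ← hA, ← e.repr.inner_map_map]
    simp only [PiLp.inner_apply, Fin.sum_univ_three, hm]
    simp
    ring
  have hxx : e.repr x 0 ^ 2 + e.repr x 1 ^ 2 + e.repr x 2 ^ 2 = 1 := by
    have h1 := e.repr.norm_map x
    rw [hx, EuclideanSpace.norm_eq, Real.sqrt_eq_one, Fin.sum_univ_three] at h1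
    simpa using h1
  have h00 := hm' 0 0
  have h11 := hm' 1 1
  have h22 := hm' 2 2
  have h01 := hm' 1 0
  have h02 := hm' 2 0
  have h12 := hm' 2 1
  have hx0 := hv x 0
  have hx1 := hv x 1
  have hx2 := hv x 2
  rw [hAx, map_zero] at hx0 hx1 hx2
  simp only [PiLp.zero_apply] at hx0 hx1 hx2
  have z0 : m 0 0 = 0 := by linarith
  have z1 : m 1 1 = 0 := by linarith
  have z2 : m 2 2 = 0 := by linarith
  rw [z0] at hx0
  rw [h01, z1] at hx1
  rw [h02, h12, z2] at hx2
  -- The axial vector `(m 1 2, -m 0 2, m 0 1)` of the skew matrix is parallel to the unit vector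
  -- `x`, because the matrix annihilates `x`; `s` is their inner product.
  obtain ⟨s, hs⟩ : ∃ s, s = m 1 2 * e.repr x 0 - m 0 2 * e.repr x 1 + m 0 1 * e.repr x 2 :=
    ⟨_, rfl⟩
  have a0 : m 1 2 = s * e.repr x 0 := by
    linear_combination -(e.repr x 0) * hs - m 1 2 * hxx - e.repr x 1 * hx2 + e.repr x 2 * hx1
  have a1 : m 0 2 = -(s * e.repr x 1) := by
    linear_combination e.repr x 1 * hs - m 0 2 * hxx + e.repr x 0 * (-hx2) + e.repr x 2 * hx0
  have a2 : m 0 1 = s * e.repr x 2 := by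
    linear_combination -(e.repr x 2) * hs - m 0 1 * hxx - e.repr x 0 * hx1 + e.repr x 1 * hx0
  refine ⟨-s, fun v => e.repr.injective ?_⟩
  rw [map_smul]
  have hc := crossProd_repr e v x
  rw [cross_apply] at hc
  ext i
  rw [hv, PiLp.smul_apply, hc]
  fin_cases i
  · simp [z0, a1, a2]
    ring
  · simp [h01, z1, a0, a2]
    ring
  · simp [h02, h12, z2, a0, a1]
    ring

lemma eq_zero_of_crossProd_eq_zero (e : OrthonormalBasis (Fin 3) ℝ (TangentSpace (𝓡 3) q))
    {x : TangentSpace (𝓡 3) q} (h : ∀ v, crossProd e v x = 0) : x = 0 := by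
  have h0 := crossProd_repr e (e 0) x
  have h1 := crossProd_repr e (e 1) x
  rw [h, map_zero, cross_apply] at h0 h1
  have h01 := congr_fun h0 1
  have h02 := congr_fun h0 2
  have h12 := congr_fun h1 2
  simp [OrthonormalBasis.repr_self] at h01 h02 h12
  apply e.repr.injective
  rw [map_zero]
  ext i
  fin_cases i <;> simp [*]

/-- The function `τ` is determined by `∇ξ`. -/
lemma IsTau.unique {ξ : ∀ x : M, TangentSpace (𝓡 3) x}
    {e : OrthonormalBasis (Fin 3) ℝ (TangentSpace (𝓡 3) q)} {s t : ℝ} (hs : IsTau ξ e s)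
    (ht : IsTau ξ e t) (hξ : ξ q ≠ 0) : s = t := by
  by_contra hne
  refine hξ (eq_zero_of_crossProd_eq_zero e fun v => ?_)
  have h1 := (hs v).symm.trans (ht v)
  rw [← sub_eq_zero, ← sub_smul, smul_eq_zero] at h1
  exact h1.resolve_left (sub_ne_zero.2 hne)

end Twist

/-! ### Consequences of the adapted chart and the main theorem -/

section MainTheorem

variable {M : Type*} [TopologicalSpace M] [ChartedSpace E3 M] [IsManifold (𝓡 3) ∞ M]
variable {Ψ : OpenPartialHomeomorph M E3} {q p : M} {ξ : ∀ x : M, TangentSpace (𝓡 3) x}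
variable [RiemannianBundle (fun x : M => TangentSpace (𝓡 3) x)]
variable [IsContMDiffRiemannianBundle (𝓡 3) ∞ E3 (fun x : M => TangentSpace (𝓡 3) x)]
variable {δ : ℝ} {r : ℝ → ℝ} {S : Set M}

namespace IsAdaptedChart

lemma leviCivita_field (h : IsAdaptedChart ξ p Ψ δ r) (hξ : SmoothFieldAt ξ p)
    (v : TangentSpace (𝓡 3) p) : mvfderiv (𝓡 3) Ψ p (leviCivita ξ p v) =
      chris (r 0) (deriv r 0) (mvfderiv (𝓡 3) Ψ p v) (stdVec 1 + stdVec 2) := by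
  have h1 : coordRep Ψ ξ =ᶠ[𝓝 (Ψ p)] fun _ => stdVec 1 + stdVec 2 := by
    filter_upwards [Ψ.open_target.mem_nhds (Ψ.map_source h.mem_source)] with y hy
    exact h.field_eq _ (Ψ.map_target hy)
  rw [h.leviCivita_eq h.mem_source hξ, h1.fderiv_eq, h.field_eq p h.mem_source, h.map_base]
  simp

/-- `∇ξ` is skew and annihilates `ξ`, hence is a multiple of `v ↦ v × ξ`. It is nonzero exactly when
`r'(0) ≠ 0`, since `∇_{∂₀} ξ = r'/(2r) ∂₁ - r'/(2(1 - r)) ∂₂`. -/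
lemma exists_isTau (h : IsAdaptedChart ξ p Ψ δ r) (hξ : SmoothFieldAt ξ p) (hunit : ‖ξ p‖ = 1)
    (e : OrthonormalBasis (Fin 3) ℝ (TangentSpace (𝓡 3) p)) :
    ∃ τ, IsTau ξ e τ ∧ (∀ t, IsTau ξ e t → t = τ) ∧ (τ = 0 ↔ deriv r 0 = 0) := by
  have p0 := h.pos 0 (by simpa using h.delta_pos)
  have p1 := sub_pos.2 (h.lt_one 0 (by simpa using h.delta_pos))
  have hne : ξ p ≠ 0 := fun h0 => by simp [h0] at hunit
  have hinj := mvfderiv_chart_injective h.mem_atlas h.mem_source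
  have hi := h.inner_eq p h.mem_source
  rw [h.map_base] at hi
  obtain ⟨τ, hτ⟩ := exists_eq_smul_crossProd e (A := leviCivita ξ p) (x := ξ p)
    (fun v w => by
      rw [hi, hi, h.leviCivita_field hξ, h.leviCivita_field hξ]
      simp [diagForm]
      field_simp
      ring) hunit
    (hinj (by
      rw [h.leviCivita_field hξ, h.field_eq p h.mem_source, map_zero]
      ext i
      fin_cases i <;> simp [chris]))
  refine ⟨τ, hτ, fun t ht => ht.unique hτ hne, fun h0 => ?_, fun h0 => ?_⟩
  · have h1 := h.leviCivita_field hξ (fld Ψ (fun _ => stdVec 0) p)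
    rw [hτ, h0, zero_smul, map_zero, mvfderiv_fld h.mem_atlas h.mem_source] at h1
    have h2 := congr_arg (fun z : E3 => z 1) h1
    simpa [p0.ne'] using h2.symm
  · refine IsTau.unique hτ (fun v => hinj ?_) hne
    rw [h.leviCivita_field hξ, h0, zero_smul, map_zero]
    ext i
    fin_cases i <;> simp [chris]

/-- The relation satisfied by the conormal of a surface tangent to the field. -/
lemma field_mem_iff (h : IsAdaptedChart ξ p Ψ δ r) {z₀ : E3} {ε : ℝ} {G β : E3 → E3}
    (P : IsNormalPatch Ψ r S p z₀ ε G β) :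
    ξ p ∈ tangentPlane S p ↔ r 0 * β z₀ 1 + (1 - r 0) * β z₀ 2 = 0 := by
  rw [P.tangent, h.field_eq p h.mem_source, h.map_base]
  simp [diagForm]

/-- Every coordinate plane contains `∂₁` or `∂₂`, and `ξ = ∂₁ + ∂₂` is orthogonal to neither. -/
lemma field_notMem_orthogonal (h : IsAdaptedChart ξ p Ψ δ r) {i : Fin 3}
    (hS : ∀ v, v ∈ tangentPlane S p ↔ mvfderiv (𝓡 3) Ψ p v i = 0) : ξ p ∉ (tangentPlane S p)ᗮ := by
  have p0 := h.pos 0 (by simpa using h.delta_pos)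
  have p1 := sub_pos.2 (h.lt_one 0 (by simpa using h.delta_pos))
  intro h0
  have hex : ∀ i : Fin 3, ∃ j, j ≠ i ∧ j ≠ 0 := by decide
  obtain ⟨j, hj, hj0⟩ := hex i
  have h1 := (Submodule.mem_orthogonal _ _).1 h0 (fld Ψ (fun _ => stdVec j) p)
    ((hS _).2 (by rw [mvfderiv_fld h.mem_atlas h.mem_source]; simp [hj.symm]))
  rw [h.inner_eq p h.mem_source, mvfderiv_fld h.mem_atlas h.mem_source,
    h.field_eq p h.mem_source, h.map_base] at h1
  fin_cases j
  · exact hj0 rfl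
  · simp [diagForm] at h1
    exact p0.ne' h1
  · simp [diagForm] at h1
    exact p1.ne' h1

lemma orthogonal_le (h : IsAdaptedChart ξ p Ψ δ r) (hq : q ∈ Ψ.source) {S T : Set M}
    (hS : ∀ v, v ∈ tangentPlane S q ↔ mvfderiv (𝓡 3) Ψ q v 2 = 0)
    (hT : ∀ v, v ∈ tangentPlane T q ↔ mvfderiv (𝓡 3) Ψ q v 1 = 0) :
    (tangentPlane S q)ᗮ ≤ tangentPlane T q := by
  intro u hu
  have h1 := (Submodule.mem_orthogonal _ _).1 hu (fld Ψ (fun _ => stdVec 1) q)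
    ((hS _).2 (by rw [mvfderiv_fld h.mem_atlas hq]; simp))
  rw [h.inner_eq q hq, mvfderiv_fld h.mem_atlas hq] at h1
  have p0 := h.pos _ (h.abs_lt (Ψ.map_source hq))
  rw [hT]
  simpa [diagForm, p0.ne'] using h1

lemma eventually_mem_iff (h : IsAdaptedChart ξ p Ψ δ r) (hS : IsTotallyGeodesicSurface S)
    (hp : p ∈ S) (hT : ∀ v, mvfderiv (𝓡 3) Ψ p v 2 = 0 → v ∈ tangentPlane S p) :
    ∀ᶠ x in 𝓝 p, x ∈ S ↔ Ψ x 2 = 0 := by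
  obtain ⟨z₀, ε, G, β, P⟩ := h.exists_normalPatch hS h.mem_source hp
  have p0 := h.pos 0 (by simpa using h.delta_pos)
  have h0 := (P.tangent _).1 (hT (fld Ψ (fun _ => stdVec 0) p)
    (by rw [mvfderiv_fld h.mem_atlas h.mem_source]; simp))
  have h1 := (P.tangent _).1 (hT (fld Ψ (fun _ => stdVec 1) p)
    (by rw [mvfderiv_fld h.mem_atlas h.mem_source]; simp))
  rw [mvfderiv_fld h.mem_atlas h.mem_source, h.map_base] at h0 h1
  exact P.eventually_mem_iff h h.mem_source (by simp [h.map_base]) (by simpa [diagForm] using h0)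
    (by simpa [diagForm, p0.ne'] using h1)

/-- A totally geodesic surface which is neither tangent to `ξ` nor a coordinate plane forces
constant curvature. -/
lemma eventually_bending_eq_zero (h : IsAdaptedChart ξ p Ψ δ r)
    (hS : IsTotallyGeodesicSurface S) (hp : p ∈ S) (ht : ξ p ∉ tangentPlane S p)
    (h2 : ¬ ∀ᶠ x in 𝓝 p, x ∈ S ↔ Ψ x 2 = 0) (h1 : ¬ ∀ᶠ x in 𝓝 p, x ∈ S ↔ Ψ x 1 = 0) :
    ∀ᶠ s in 𝓝 0, bending r s = 0 := by
  obtain ⟨z₀, ε, G, β, P⟩ := h.exists_normalPatch hS h.mem_source hp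
  rw [h.field_mem_iff P] at ht
  by_contra hb
  rw [Filter.not_eventually] at hb
  have hA : ∃ᶠ s in 𝓝 (Ψ p 0), bending r s ≠ 0 := by simpa [h.map_base] using hb
  have hβ : ¬(β z₀ 1 = 0 ∧ β z₀ 2 = 0) := fun ⟨a, b⟩ => ht (by simp [a, b])
  obtain ⟨h01, h02, h12⟩ := P.mul_eq_zero_of_frequently h hA hβ
  have hβ0 : β z₀ 0 = 0 := by
    by_contra hne
    exact hβ ⟨(mul_eq_zero.1 h01).resolve_left hne, (mul_eq_zero.1 h02).resolve_left hne⟩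
  -- The normal is along `∂₂` or along `∂₁`. Uniqueness identifies `S` with `x₂ = 0` in the first
  -- case and, after exchanging the coordinates, with `x₁ = 0` in the second.
  rcases mul_eq_zero.1 h12 with hz | hz
  · refine h2 (h.eventually_mem_iff hS hp fun v hv => ?_)
    rw [P.tangent]
    simp [diagForm, hβ0, hz, hv]
  · refine h1 ?_
    have h3 := h.swap.eventually_mem_iff hS hp fun v hv => ?_
    · simpa [swapChart_apply] using h3
    · rw [mvfderiv_swapChart h.mem_atlas h.mem_source] at hv
      rw [P.tangent]
      rw [coordSwap_apply, Equiv.swap_apply_right] at hv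
      simp [diagForm, hβ0, hz, hv]

/-- A normal along `∂₀` is the case of a surface touching a level of `x₀`. Any other normal
orthogonal to `ξ` cannot be along `∂₁` or `∂₂`, because `ξ` has a nonzero product with both, so the
curvature condition applies. -/
lemma bending_of_tangent (h : IsAdaptedChart ξ p Ψ δ r)
    (hS : IsTotallyGeodesicSurface S) (hp : p ∈ S) (ht : ξ p ∈ tangentPlane S p)
    (hr : deriv r 0 ≠ 0) : ∀ᶠ s in 𝓝 0, bending r s = 0 := by
  obtain ⟨z₀, ε, G, β, P⟩ := h.exists_normalPatch hS h.mem_source hp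
  rw [h.field_mem_iff P] at ht
  have hb0 : Ψ p 0 = 0 := by simp [h.map_base]
  have p0 := h.pos 0 (by simpa using h.delta_pos)
  have p1 := sub_pos.2 (h.lt_one 0 (by simpa using h.delta_pos))
  by_cases hβ : β z₀ 1 = 0 ∧ β z₀ 2 = 0
  · have h1 := P.eventually_bending_eq_zero h hβ (by rwa [hb0])
    rwa [hb0] at h1
  · by_contra hb
    rw [Filter.not_eventually] at hb
    obtain ⟨-, -, h12⟩ := P.mul_eq_zero_of_frequently h (by rwa [hb0]) hβ
    rcases mul_eq_zero.1 h12 with hz | hz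
    · exact hβ ⟨hz, by simpa [hz, p1.ne'] using ht⟩
    · exact hβ ⟨by simpa [hz, p0.ne'] using ht, hz⟩

end IsAdaptedChart

end MainTheorem

end

theorem theorem3 {M : Type*} [TopologicalSpace M] [T2Space M] [ChartedSpace E3 M]
    [IsManifold (𝓡 3) ∞ M] [RiemannianBundle (fun x : M => TangentSpace (𝓡 3) x)]
    [IsContMDiffRiemannianBundle (𝓡 3) ∞ E3 (fun x : M => TangentSpace (𝓡 3) x)]
    (ξ : ∀ x : M, TangentSpace (𝓡 3) x) (hξ : IsKillingField ξ) (hunit : ∀ x, ‖ξ x‖ = 1)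
    (p : M) (S₁ : Set M) (hS₁ : IsTotallyGeodesicSurface S₁) (hp₁ : p ∈ S₁)
    (h_not_orth : ξ p ∉ (tangentPlane S₁ p)ᗮ) (h_not_tang : ξ p ∉ tangentPlane S₁ p) :
    -- (1) a second surface `S₀`, orthogonal to `S₁`
    (∃ S₀ : Set M, IsTotallyGeodesicSurface S₀ ∧ p ∈ S₀ ∧
      (∀ q ∈ S₀ ∩ S₁, (tangentPlane S₁ q)ᗮ ≤ tangentPlane S₀ q) ∧
      ξ p ∉ (tangentPlane S₀ p)ᗮ ∧ ξ p ∉ tangentPlane S₀ p ∧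
      -- (2) consequence of the existence of a third surface, different from `S₀` and `S₁` near `p`
      ∀ S₂ : Set M, IsTotallyGeodesicSurface S₂ → p ∈ S₂ → ξ p ∉ tangentPlane S₂ p →
        (¬ ∀ᶠ x in 𝓝 p, (x ∈ S₂ ↔ x ∈ S₁)) → (¬ ∀ᶠ x in 𝓝 p, (x ∈ S₂ ↔ x ∈ S₀)) →
        ∃ c : ℝ, 0 ≤ c ∧ HasConstantCurvatureNear p c ∧
          (0 < c → IsLocallyIsometricToSphere p (1 / √c)) ∧
          (c = 0 → IsLocallyIsometricToEuclidean p)) ∧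
    -- (3) for either orientation near `p`
    (∀ e : OrthonormalBasis (Fin 3) ℝ (TangentSpace (𝓡 3) p),
      ∃ τ : ℝ, IsTau ξ e τ ∧ (∀ t, IsTau ξ e t → t = τ) ∧
        ((¬ ∃ c : ℝ, 0 < c ∧ HasConstantCurvatureNear p c) →
          ((∃ S : Set M, IsTotallyGeodesicSurface S ∧ p ∈ S ∧ ξ p ∈ tangentPlane S p) ↔
            τ = 0))) := by
  obtain ⟨Ψ, δ, r, h, hmem⟩ := exists_adaptedChart hξ hunit hS₁ hp₁ h_not_orth h_not_tang
  have p0 := h.pos 0 (by simpa using h.delta_pos)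
  have p1 := sub_pos.2 (h.lt_one 0 (by simpa using h.delta_pos))
  have hplane : ∀ i, Ψ p i = 0 := fun i => by simp [h.map_base]
  have hev : ∀ q ∈ Ψ.source, ∀ᶠ x in 𝓝 q, x ∈ S₁ ↔ Ψ x 2 = 0 := fun q hq => by
    filter_upwards [Ψ.open_source.mem_nhds hq] with x hx using hmem x hx
  refine ⟨⟨{x | x ∈ Ψ.source ∧ Ψ x 1 = 0}, h.isTotallyGeodesicSurface_coordPlane_one,
    ⟨h.mem_source, hplane 1⟩, ?_, h.field_notMem_orthogonal (i := 1)
      (h.mem_tangentPlane_coordPlane h.mem_source (hplane 1)), ?_, ?_⟩, ?_⟩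
  · rintro q ⟨⟨hq, hq1⟩, hq2⟩
    exact h.orthogonal_le hq
      (mem_tangentPlane_iff h.mem_atlas hq (hev q hq) ((hmem q hq).1 hq2))
      (h.mem_tangentPlane_coordPlane hq hq1)
  · rw [h.mem_tangentPlane_coordPlane h.mem_source (hplane 1), h.field_eq p h.mem_source]
    simp
  · intro S₂ hS₂ hp₂ ht h21 h20
    have hb := h.eventually_bending_eq_zero hS₂ hp₂ ht
      (fun hh => h21 (by
        filter_upwards [hh, hev p h.mem_source] with x hx hx'
        rw [hx, hx']))
      (fun hh => h20 (by
        filter_upwards [hh, Ψ.open_source.mem_nhds h.mem_source] with x hx hx'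
        rw [hx]
        exact ⟨fun h1 => ⟨hx', h1⟩, fun h1 => h1.2⟩))
    -- The constant is `c = r'(0)² / (4 r(0) (1 - r(0)))`; in particular `c = 0` means `r'(0) = 0`.
    refine ⟨_, by positivity, h.hasConstantCurvatureNear hb,
      fun hc => h.isLocallyIsometricToSphere hb hc rfl,
      fun hc => h.isLocallyIsometricToEuclidean hb ?_⟩
    simpa [p0.ne', p1.ne'] using hc
  · intro e
    obtain ⟨τ, hτ, huniq, hτ0⟩ := h.exists_isTau (hξ.1 p) (hunit p) e
    refine ⟨τ, hτ, huniq, fun hnc => ?_⟩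
    rw [hτ0]
    constructor
    · rintro ⟨S, hS, hp, ht⟩
      -- With `r'(0) ≠ 0` the surface would force constant curvature of the positive value `r'(0)² /
      -- (4 r(0) (1 - r(0)))`, which is excluded.
      by_contra hr
      exact hnc ⟨_, by positivity,
        h.hasConstantCurvatureNear (h.bending_of_tangent hS hp ht hr)⟩
    · intro hr
      -- The plane `x₀ = 0` contains the direction `∂₁ + ∂₂` of `ξ`.
      refine ⟨_, h.isTotallyGeodesicSurface_coordPlane_zero hr, ⟨h.mem_source, hplane 0⟩, ?_⟩
      rw [h.mem_tangentPlane_coordPlane h.mem_source (hplane 0), h.field_eq p h.mem_source]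
      simp
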